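/- Let $d\ge 1$ be an integer and let $\alpha\ge 2$ be real. For real $A>0$ and $R>0$ let $$B_R^{\alpha,A}=\{(z,t)\in\mathbb{R}^{2d}\times\mathbb{R} : |z|^{\alpha}+A|t|^{\alpha/2}\le R^{\alpha}\},$$ where $|z|$ is the Euclidean norm; this is the ball of radius $R$ of the Heisenberg norm $(|z|^\alpha+A|t|^{\alpha/2})^{1/\alpha}$ on the Heisenberg group $\mathsf{H}_d=\mathbb{R}^{2d}\times\mathbb{R}$. Write $|B|$ for the Lebesgue measure of $B\subset\mathbb{R}^{2d+1}$, and put $$\delta=\delta(\alpha)=\frac{2\left(\frac12-\frac2\alpha\right)}{d+\frac12-\frac2\alpha}.$$ Then for every compact interval $[a,b]\subset(0,\infty)$ there is a constant $C$, depending only on $d,\alpha,a,b$, such that for all $A\in[a,b]$ and all $R\ge 2$ $$\left|\#\left(\mathbb{Z}^{2d+1}\cap B_R^{\alpha,A}\right)-\left|B_R^{\alpha,A}\right|\right|\le C\cdot\begin{cases}R^{2d} & \text{if } \alpha=2,\\ R^{2d}\log R & \text{if } 2<\alpha\le 4,\\ R^{2d+\delta} & \text{if } \alpha>4.\end{cases}$$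 In particular, for each fixed $A>0$ the error is $O(R^{2d})$, $O(R^{2d}\log R)$ and $O(R^{2d+\delta})$ as $R\to\infty$ in the respective cases. -/

import Mathlib

/-- The underlying space `ℝ^{2d} × ℝ` of the Heisenberg group `H_d`, with points `(z, t)`.
The first factor carries the Euclidean norm. Haar measure of `H_d` is Lebesgue measure, which is
the (product) `volume` of this space. -/
abbrev HeisenbergSpace (d : ℕ) : Type := EuclideanSpace ℝ (Fin (2 * d)) × ℝ

/-- The ball `{(z, t) : |z|^α + A |t|^{α/2} ≤ R^α}` of radius `R` for the Heisenberg norm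
`(|z|^α + A |t|^{α/2})^{1/α}`. -/
def heisenbergBall (d : ℕ) (α A R : ℝ) : Set (HeisenbergSpace d) :=
  {p | ‖p.1‖ ^ α + A * |p.2| ^ (α / 2) ≤ R ^ α}

/-- The lattice `ℤ^{2d+1}` of points of `ℝ^{2d} × ℝ` all of whose coordinates are integers. -/
def integerLattice (d : ℕ) : Set (HeisenbergSpace d) :=
  {p | (∀ i, ∃ n : ℤ, p.1 i = n) ∧ ∃ m : ℤ, p.2 = m}

/-- The balls are bounded, so that the volume and the number of lattice points below are those of
a bounded set, respectively a finite set. -/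
theorem heisenbergBall_isBounded (d : ℕ) {α A R : ℝ} (hα : 0 < α) (hA : 0 < A) (hR : 0 ≤ R) :
    Bornology.IsBounded (heisenbergBall d α A R) := by
  refine ((Metric.isBounded_closedBall (x := (0 : EuclideanSpace ℝ (Fin (2 * d)))) (r := R)).prod
    (Metric.isBounded_closedBall (x := (0 : ℝ)) (r := (R ^ α / A) ^ (2 / α)))).subset ?_
  rintro ⟨z, t⟩ h
  have h : ‖z‖ ^ α + A * |t| ^ (α / 2) ≤ R ^ α := h
  have h1 : 0 ≤ A * |t| ^ (α / 2) := by positivity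
  have h2 : 0 ≤ ‖z‖ ^ α := by positivity
  refine ⟨?_, ?_⟩
  · rw [mem_closedBall_zero_iff]
    exact (Real.rpow_le_rpow_iff (norm_nonneg z) hR hα).1 (by linarith)
  · rw [mem_closedBall_zero_iff, Real.norm_eq_abs]
    have h3 : |t| ^ (α / 2) ≤ R ^ α / A := by
      rw [le_div_iff₀ hA]; linarith
    have h4 := Real.rpow_le_rpow (by positivity) h3 (show 0 ≤ 2 / α by positivity)
    rwa [← Real.rpow_mul (abs_nonneg t), show α / 2 * (2 / α) = 1 by field_simp,
      Real.rpow_one] at h4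

theorem integerLattice_inter_heisenbergBall_finite (d : ℕ) {α A R : ℝ} (hα : 0 < α) (hA : 0 < A)
    (hR : 0 ≤ R) : (integerLattice d ∩ heisenbergBall d α A R).Finite := by
  obtain ⟨M, hM⟩ := (heisenbergBall_isBounded d hα hA hR).exists_norm_le
  let F : (Fin (2 * d) → ℤ) × ℤ → HeisenbergSpace d :=
    fun q => (WithLp.toLp 2 fun i => (q.1 i : ℝ), (q.2 : ℝ))
  have hfin : ((Set.univ.pi fun _ : Fin (2 * d) => Set.Icc (-⌈M⌉) ⌈M⌉) ×ˢ
      Set.Icc (-⌈M⌉) ⌈M⌉).Finite :=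
    (Set.Finite.pi fun _ => Set.finite_Icc _ _).prod (Set.finite_Icc _ _)
  have key : ∀ n : ℤ, |(n : ℝ)| ≤ M → n ∈ Set.Icc (-⌈M⌉) ⌈M⌉ := by
    intro n hn
    have h1 : ((|n| : ℤ) : ℝ) ≤ (⌈M⌉ : ℤ) := by push_cast; exact hn.trans (Int.le_ceil M)
    exact abs_le.1 (by exact_mod_cast h1)
  refine (hfin.image F).subset ?_
  rintro ⟨z, t⟩ ⟨⟨hz, m, hm⟩, hb⟩
  choose n hn using hz
  have hN := hM _ hb
  refine ⟨(n, m), ⟨fun i _ => key _ ?_, key _ ?_⟩, ?_⟩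
  · rw [← hn i, ← Real.norm_eq_abs]
    exact (PiLp.norm_apply_le z i).trans ((norm_fst_le (z, t)).trans hN)
  · rw [← hm, ← Real.norm_eq_abs]
    exact (norm_snd_le (z, t)).trans hN
  · refine Prod.ext ?_ hm.symm
    ext i
    exact (hn i).symm

/-- The error term `|#(ℤ^{2d+1} ∩ B_R) - |B_R||` of the lattice point problem. -/
noncomputable def latticeError (d : ℕ) (α A R : ℝ) : ℝ :=
  |((integerLattice d ∩ heisenbergBall d α A R).ncard : ℝ) -
    (MeasureTheory.volume (heisenbergBall d α A R)).toReal|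

/-- The exponent `δ(α) = 2 (1/2 - 2/α) / (d + 1/2 - 2/α)`. -/
noncomputable def errorExponent (d : ℕ) (α : ℝ) : ℝ :=
  2 * (1 / 2 - 2 / α) / (d + 1 / 2 - 2 / α)

/-! Slice the ball by `z`. Over a lattice point `k` of `ℝ^{2d}` with `|k| ≤ R` there are `2⌊x⌋ + 1`
admissible integers `t`, where `x = A^{-2/α} (R^α - |k|^α)^{2/α}`, against a slice of length `2x`.
Each column costs at most 1, in total `O(R^{2d})`, and what is left is the error of a Riemann sum
over `ℤ^{2d}` for the radial function `profile α R`. The parameter `A` enters only through the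
factor `A^{-2/α}`.

For `α = 2` the profile is `R² - |x|²` and the midpoint rule on unit cubes suffices: second
differences are bounded inside and `O(R)` at the `O(R^{2d-1})` cubes near the boundary
(`exists_abs_sum_tent_sub_integral_le`).

For `α > 2`, writing the profile as the integral of minus its derivative turns the Riemann sum error
into `∫ E(ρ) w(ρ) dρ`, where `E = ballError` is the lattice point error of the Euclidean ball of
radius `ρ` and `w = profileWeight α R ≥ 0` has mass `R²` (`sum_profile_sub_integral`). If `2d ≥ 4`,
the pointwise bound `E(ρ) ≪ (1 + ρ)^{2d-2} log (2 + ρ)` gives `R^{2d} log R`, and for `α > 4` the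
logarithm is absorbed by `R^δ`. In dimension 4 that bound comes from Jacobi's four squares theorem
and the elementary asymptotics of `∑ σ(n)`; higher-dimensional balls are sliced into 4-dimensional
ones, which leaves a Riesz mean of order two, again handled by the midpoint rule.

For `d = 1` pointwise bounds lose too much, and cancellation in the integral over `ρ` is needed. Up
to `O(1)`, `E` is `-8` times a sum of sawtooth values over an octant of the circle. The sawtooth
lies between difference quotients of the periodic second Bernoulli function with steps `±1/K`, up to
`O(1/K)`; this costs `R³/K` and, by an absolutely convergent Fourier series, leads to the
exponential sums `circleSum k ρ`. Against `ρ dρ` these have small primitives, by an explicit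
antiderivative, van der Corput's test and Abel summation. As `w(ρ)/ρ` is increasing, the second mean
value theorem carries this over to `w` up to distance `1/k` from `R`; there van der Corput's test
alone is enough. With `γ = 1/2 - 2/α` the outcome is `≪ R^{2+γ} k^γ + R²/k`
(`norm_weightedCircleSum_le`). Summed with weights `min(1/k, K/k²)` this is `≪ R² log R` for `γ ≤ 0`
and `K ≈ R`. For `γ > 0` the main term is `R^{2+γ} K^γ`, and balancing it with `R³/K` gives the
exponent `2 + δ`. -/

open Finset in
/-- An antitone sequence on `[a, b)` crosses each level once. -/
theorem exists_crossing {a b : ℕ} (hab : a ≤ b) {g : ℕ → ℝ}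
    (hg : ∀ n, a ≤ n → n + 1 < b → g (n + 1) ≤ g n) (c : ℝ) :
    ∃ p, a ≤ p ∧ p ≤ b ∧ (∀ n, a ≤ n → n < p → c < g n) ∧ ∀ n, p ≤ n → n < b → g n ≤ c := by
  induction b, hab using Nat.le_induction with
  | base => exact ⟨a, le_rfl, le_rfl, fun n h1 h2 => by omega, fun n h1 h2 => by omega⟩
  | succ b hab ih =>
    obtain ⟨p, h1, h2, h3, h4⟩ := ih fun n hn hn' => hg n hn (by omega)
    rcases lt_or_ge p b with h | h
    · refine ⟨p, h1, by omega, h3, fun n hn hn' => ?_⟩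
      rcases Nat.lt_succ_iff_lt_or_eq.1 hn' with h5 | rfl
      · exact h4 n hn h5
      · obtain ⟨q, rfl⟩ : ∃ q, n = q + 1 := ⟨n - 1, by omega⟩
        exact (hg q (by omega) (by omega)).trans (h4 q (by omega) (by omega))
    · obtain rfl : p = b := le_antisymm h2 h
      rcases le_or_gt (g p) c with h5 | h5
      · exact ⟨p, h1, by omega, h3, fun n hn hn' => by
          obtain rfl : n = p := by omega
          exact h5⟩
      · refine ⟨p + 1, by omega, le_rfl, fun n hn hn' => ?_, fun n hn hn' => by omega⟩
        rcases Nat.lt_succ_iff_lt_or_eq.1 hn' with h6 | rfl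
        · exact h3 n hn h6
        · exact h5

/-! ### Exponential sums: Kuzmin–Landau and van der Corput -/

/-- The additive character `x ↦ exp (2πix)` of `ℝ`. -/
noncomputable def expTwoPi (x : ℝ) : ℂ := Complex.exp ((2 * Real.pi * x : ℝ) * Complex.I)

theorem expTwoPi_eq (x : ℝ) :
    expTwoPi x = Real.cos (2 * Real.pi * x) + Real.sin (2 * Real.pi * x) * Complex.I := by
  rw [expTwoPi, Complex.exp_mul_I, ← Complex.ofReal_cos, ← Complex.ofReal_sin]

@[simp] theorem norm_expTwoPi (x : ℝ) : ‖expTwoPi x‖ = 1 := Complex.norm_exp_ofReal_mul_I _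

theorem expTwoPi_add (x y : ℝ) : expTwoPi (x + y) = expTwoPi x * expTwoPi y := by
  rw [expTwoPi, expTwoPi, expTwoPi, ← Complex.exp_add]
  congr 1
  push_cast
  ring

theorem expTwoPi_intCast (m : ℤ) : expTwoPi m = 1 := by
  rw [expTwoPi, Complex.exp_eq_one_iff]
  exact ⟨m, by push_cast; ring⟩

theorem norm_sum_expTwoPi_le_card (a b : ℕ) (f : ℕ → ℝ) :
    ‖∑ n ∈ Finset.Ico a b, expTwoPi (f n)‖ ≤ (b - a : ℕ) :=
  (norm_sum_le _ _).trans (by simp)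

theorem expTwoPi_eq_mk (x : ℝ) :
    expTwoPi x = ⟨Real.cos (2 * Real.pi * x), Real.sin (2 * Real.pi * x)⟩ := by
  rw [expTwoPi_eq, Complex.mk_eq_add_mul_I]

/-- `(1 - e(x))⁻¹ = (1 + i cot πx) / 2`. -/
theorem one_sub_expTwoPi_mul {x : ℝ} (hx : Real.sin (Real.pi * x) ≠ 0) :
    (1 - expTwoPi x) *
      (⟨1 / 2, Real.cos (Real.pi * x) / Real.sin (Real.pi * x) / 2⟩ : ℂ) = 1 := by
  have h := Real.sin_sq_add_cos_sq (Real.pi * x)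
  rw [expTwoPi_eq_mk, mul_assoc, Real.cos_two_mul, Real.sin_two_mul]
  set s := Real.sin (Real.pi * x)
  set c := Real.cos (Real.pi * x)
  have h2 : c ^ 2 = 1 - s ^ 2 := by linarith
  apply Complex.ext
  · simp only [Complex.mul_re, Complex.sub_re, Complex.one_re, Complex.sub_im, Complex.one_im]
    field_simp
    linear_combination 0 * h2
  · simp only [Complex.mul_im, Complex.sub_re, Complex.one_re, Complex.sub_im, Complex.one_im]
    field_simp
    linear_combination (-2 * c) * h2

/-- The **Kuzmin–Landau inequality**. -/
theorem kuzmin_landau {a b : ℕ} {f : ℕ → ℝ} {θ : ℝ} (hθ : 0 < θ) (m : ℤ)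
    (hf : ∀ n, a ≤ n → n + 1 < b → f (n + 2) - f (n + 1) ≤ f (n + 1) - f n)
    (hl : ∀ n, a ≤ n → n < b → m + θ ≤ f (n + 1) - f n)
    (hu : ∀ n, a ≤ n → n < b → f (n + 1) - f n ≤ m + 1 - θ) :
    ‖∑ n ∈ Finset.Ico a b, expTwoPi (f n)‖ ≤ 1 / θ := by
  rcases le_or_gt b a with hab | hab
  · rw [Finset.Ico_eq_empty (by omega)]; simp; exact hθ.le
  set x : ℕ → ℝ := fun n => f (n + 1) - f n - m with hx
  have hxl : ∀ n, a ≤ n → n < b → θ ≤ x n := fun n h1 h2 => by have := hl n h1 h2; simp [hx]; linarith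
  have hxu : ∀ n, a ≤ n → n < b → x n ≤ 1 - θ := fun n h1 h2 => by
    have := hu n h1 h2; simp [hx]; linarith
  have hxm : ∀ n, a ≤ n → n + 1 < b → x (n + 1) ≤ x n := fun n h1 h2 => by
    have := hf n h1 h2; simp [hx]; linarith
  have hpi := Real.pi_pos
  have hsl : ∀ n, a ≤ n → n < b → 2 * θ ≤ Real.sin (Real.pi * x n) := by
    intro n h1 h2
    have h3 := hxl n h1 h2
    have h4 := hxu n h1 h2
    rcases le_total (x n) (1 / 2) with h | h
    · have := Real.mul_le_sin (x := Real.pi * x n) (mul_nonneg hpi.le (by linarith))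
        (by nlinarith)
      have h5 : 2 / Real.pi * (Real.pi * x n) = 2 * x n := by field_simp
      linarith
    · have := Real.mul_le_sin (x := Real.pi * (1 - x n)) (mul_nonneg hpi.le (by linarith))
        (by nlinarith)
      have h5 : 2 / Real.pi * (Real.pi * (1 - x n)) = 2 * (1 - x n) := by field_simp
      rw [show Real.pi * (1 - x n) = Real.pi - Real.pi * x n by ring, Real.sin_pi_sub] at this
      have h6 : 2 / Real.pi * (Real.pi - Real.pi * x n) = 2 * (1 - x n) := by field_simp
      linarith
  set t : ℕ → ℝ := fun n => Real.cos (Real.pi * x n) / Real.sin (Real.pi * x n) / 2 with ht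
  set c : ℕ → ℂ := fun n => ⟨1 / 2, t n⟩ with hc
  -- Each term is `c n` times the difference of consecutive terms, because `c n = (1 - e(x n))⁻¹`;
  -- the sum is thereby ready for partial summation.
  have hstep : ∀ n, a ≤ n → n < b →
      expTwoPi (f n) + c n * expTwoPi (f (n + 1)) = c n * expTwoPi (f n) := by
    intro n h1 h2
    have h3 := one_sub_expTwoPi_mul (x := x n) (by
      have := hsl n h1 h2
      have : 0 < Real.sin (Real.pi * x n) := by linarith
      exact this.ne')
    have h4 : expTwoPi (f (n + 1)) = expTwoPi (f n) * expTwoPi (x n) := by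
      rw [← expTwoPi_add, ← mul_one (expTwoPi (f (n + 1))), ← expTwoPi_intCast (-m), ← expTwoPi_add]
      congr 1; simp [hx]; ring
    rw [h4]
    change (1 - expTwoPi (x n)) * c n = 1 at h3
    linear_combination (-expTwoPi (f n)) * h3
  have hcn : ∀ n, a ≤ n → n < b → ‖c n‖ ≤ 1 / (4 * θ) := by
    intro n h1 h2
    have h3 := hsl n h1 h2
    have hs : 0 < Real.sin (Real.pi * x n) := by linarith
    have h4 : ‖c n‖ ^ 2 = (1 / (2 * Real.sin (Real.pi * x n))) ^ 2 := by
      rw [← Complex.normSq_eq_norm_sq, Complex.normSq_apply]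
      simp only [hc, ht]
      field_simp
      linarith [Real.sin_sq_add_cos_sq (Real.pi * x n)]
    have h5 : ‖c n‖ = 1 / (2 * Real.sin (Real.pi * x n)) :=
      (pow_left_inj₀ (norm_nonneg _) (by positivity) (by norm_num)).1 h4
    rw [h5]
    exact one_div_le_one_div_of_le (by positivity) (by linarith)
  -- The cotangent decreases and `x` decreases, so `t` increases. The total variation of `c` is then
  -- just the difference of the end values of `t`.
  have htm : ∀ n, a ≤ n → n + 1 < b → t n ≤ t (n + 1) := by
    intro n h1 h2
    have s1 := hsl n h1 (by omega)
    have s2 := hsl (n + 1) (by omega) h2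
    simp only [ht]
    have : 0 ≤ Real.sin (Real.pi * x n - Real.pi * x (n + 1)) := by
      have b1 := hxm n h1 h2
      have b2 := hxl (n + 1) (by omega) h2
      have b3 := hxu n h1 (by omega)
      exact Real.sin_nonneg_of_nonneg_of_le_pi (by nlinarith) (by nlinarith)
    rw [Real.sin_sub] at this
    gcongr ?_ / 2
    rw [div_le_div_iff₀ (by linarith) (by linarith)]
    linarith
  have key : ∀ j, a + 1 + j ≤ b → ‖∑ n ∈ Finset.Ico a (a + 1 + j), expTwoPi (f n) +
      c (a + j) * expTwoPi (f (a + 1 + j))‖ ≤ ‖c a‖ + (t (a + j) - t a) := by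
    intro j
    induction j with
    | zero => intro h; simp; rw [hstep a le_rfl hab]; simp
    | succ j ih =>
      intro h
      have h1 := ih (by omega)
      rw [show a + 1 + (j + 1) = (a + 1 + j) + 1 by ring,
        Finset.sum_Ico_succ_top (by omega : a ≤ a + 1 + j),
        show a + (j + 1) = a + 1 + j by ring, add_assoc, hstep _ (by omega) (by omega),
        show ∑ n ∈ Finset.Ico a (a + 1 + j), expTwoPi (f n) +
          c (a + 1 + j) * expTwoPi (f (a + 1 + j)) = (∑ n ∈ Finset.Ico a (a + 1 + j),
          expTwoPi (f n) + c (a + j) * expTwoPi (f (a + 1 + j))) +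
          (c (a + 1 + j) - c (a + j)) * expTwoPi (f (a + 1 + j)) by ring]
      refine (norm_add_le _ _).trans ?_
      have h2 : ‖(c (a + 1 + j) - c (a + j)) * expTwoPi (f (a + 1 + j))‖ =
          t (a + 1 + j) - t (a + j) := by
        have := htm (a + j) (by omega) (by omega)
        rw [show a + j + 1 = a + 1 + j by ring] at this
        rw [norm_mul, norm_expTwoPi, mul_one, show c (a + 1 + j) - c (a + j) =
          ((t (a + 1 + j) - t (a + j) : ℝ) : ℂ) * Complex.I by
            apply Complex.ext <;> simp [hc], norm_mul,
          Complex.norm_I, mul_one, Complex.norm_real, Real.norm_of_nonneg (by linarith)]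
      linarith
  have h1 := key (b - (a + 1)) (by omega)
  rw [show a + 1 + (b - (a + 1)) = b by omega] at h1
  have htc : ∀ n, |t n| ≤ ‖c n‖ := fun n => by
    have := Complex.abs_im_le_norm (c n)
    simpa [hc] using this
  have hA := hcn a le_rfl hab
  have hB := hcn (a + (b - (a + 1))) (by omega) (by omega)
  have h2 := htc a
  have h3 := htc (a + (b - (a + 1)))
  have h4 : ‖∑ n ∈ Finset.Ico a b, expTwoPi (f n)‖ ≤ ‖∑ n ∈ Finset.Ico a b, expTwoPi (f n) +
      c (a + (b - (a + 1))) * expTwoPi (f b)‖ + ‖c (a + (b - (a + 1)))‖ := by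
    have := norm_sub_le (∑ n ∈ Finset.Ico a b, expTwoPi (f n) +
      c (a + (b - (a + 1))) * expTwoPi (f b)) (c (a + (b - (a + 1))) * expTwoPi (f b))
    simpa using this
  -- Four boundary quantities remain, `‖c‖` and `|t|` at the two ends, each at most `1 / (4θ)`.
  have h5 : 1 / (4 * θ) = 1 / θ / 4 := by field_simp
  rw [h5] at hA hB
  have := abs_le.1 h2
  have := abs_le.1 h3
  linarith

/-- Number of steps of a sequence decreasing by at least `l` per step inside an interval. -/
theorem steps_le {a b : ℕ} {g : ℕ → ℝ} {l u w : ℝ} (hl : 0 < l) (huw : u ≤ w)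
    (hg : ∀ n, a ≤ n → n + 1 < b → g (n + 1) + l ≤ g n)
    (hgu : ∀ n, a ≤ n → n < b → u ≤ g n) (hgw : ∀ n, a ≤ n → n < b → g n ≤ w) :
    ((b - a : ℕ) : ℝ) ≤ (w - u) / l + 1 := by
  rcases le_or_gt b a with hab | hab
  · have : b - a = 0 := by omega
    have : 0 ≤ (w - u) / l := div_nonneg (by linarith) hl.le
    simp [*]; linarith
  have key : ∀ j : ℕ, a + j < b → g (a + j) + j * l ≤ g a := by
    intro j
    induction j with
    | zero => intro _; simp
    | succ j ih =>
      intro h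
      have := ih (by omega)
      have := hg (a + j) (by omega) (by omega)
      push_cast
      rw [← add_assoc] at *
      linarith
  have h1 := key (b - a - 1) (by omega)
  have h2 := hgu (a + (b - a - 1)) (by omega) (by omega)
  have h3 := hgw a le_rfl hab
  have h4 : ((b - a - 1 : ℕ) : ℝ) ≤ (w - u) / l := by rw [le_div_iff₀ hl]; linarith
  have h5 : b - a = (b - a - 1) + 1 := by omega
  rw [h5]; push_cast; linarith

/-- The increments stay in one unit interval and drop by at least `l` per step, so they spend at
most `√l / l + 1` steps within `√l` of either end. In between, Kuzmin–Landau applies with `θ = √l`.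
The threshold `√l` makes all three pieces of size `1 / √l`. -/
theorem vanDerCorput_unit {a b : ℕ} (hab : a ≤ b) {f : ℕ → ℝ} {l : ℝ} (hl : 0 < l) (hl' : l ≤ 1)
    (m : ℤ)
    (hf : ∀ n, a ≤ n → n + 1 < b → f (n + 2) - f (n + 1) + l ≤ f (n + 1) - f n)
    (hlo : ∀ n, a ≤ n → n < b → m ≤ f (n + 1) - f n)
    (hup : ∀ n, a ≤ n → n < b → f (n + 1) - f n ≤ m + 1) :
    ‖∑ n ∈ Finset.Ico a b, expTwoPi (f n)‖ ≤ 5 / √l := by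
  have hs : 0 < √l := Real.sqrt_pos.2 hl
  have hs1 : √l ≤ 1 := Real.sqrt_le_one.2 hl'
  have hsl : √l / l = 1 / √l := by
    rw [div_eq_div_iff hl.ne' hs.ne', one_mul, Real.mul_self_sqrt hl.le]
  have hs2 : 1 ≤ 1 / √l := (one_le_div hs).2 hs1
  set g : ℕ → ℝ := fun n => f (n + 1) - f n with hg
  have hga : ∀ n, a ≤ n → n + 1 < b → g (n + 1) ≤ g n := fun n h1 h2 => by
    have := hf n h1 h2
    simp only [hg]; linarith
  obtain ⟨p, hap, hpb, hp1, hp2⟩ := exists_crossing hab hga (m + 1 - √l)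
  obtain ⟨q, hpq, hqb, hq1, hq2⟩ := exists_crossing hpb
    (fun n h1 h2 => hga n (by omega) h2) (m + √l)
  rw [← Finset.sum_Ico_consecutive _ hap hpb, ← Finset.sum_Ico_consecutive _ hpq hqb]
  have e1 : ‖∑ n ∈ Finset.Ico a p, expTwoPi (f n)‖ ≤ √l / l + 1 := by
    refine (norm_sum_expTwoPi_le_card _ _ _).trans ?_
    have := steps_le (a := a) (b := p) (g := g) (u := m + 1 - √l) (w := m + 1) hl (by linarith)
      (fun n h1 h2 => hf n h1 (by omega)) (fun n h1 h2 => (hp1 n h1 h2).le)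
      (fun n h1 h2 => hup n h1 (by omega))
    rwa [show (m : ℝ) + 1 - (m + 1 - √l) = √l by ring] at this
  have e3 : ‖∑ n ∈ Finset.Ico q b, expTwoPi (f n)‖ ≤ √l / l + 1 := by
    refine (norm_sum_expTwoPi_le_card _ _ _).trans ?_
    have := steps_le (a := q) (b := b) (g := g) (u := m) (w := m + √l) hl (by linarith)
      (fun n h1 h2 => hf n (by omega) (by omega)) (fun n h1 h2 => hlo n (by omega) h2)
      (fun n h1 h2 => hq2 n h1 h2)
    rwa [show (m : ℝ) + √l - m = √l by ring] at this
  have e2 : ‖∑ n ∈ Finset.Ico p q, expTwoPi (f n)‖ ≤ 1 / √l :=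
    kuzmin_landau hs m (fun n h1 h2 => hga n (by omega) (by omega))
      (fun n h1 h2 => (hq1 n h1 h2).le) (fun n h1 h2 => hp2 n h1 (by omega))
  have h1 := norm_add_le (∑ n ∈ Finset.Ico a p, expTwoPi (f n))
    (∑ n ∈ Finset.Ico p q, expTwoPi (f n) + ∑ n ∈ Finset.Ico q b, expTwoPi (f n))
  have h2 := norm_add_le (∑ n ∈ Finset.Ico p q, expTwoPi (f n))
    (∑ n ∈ Finset.Ico q b, expTwoPi (f n))
  have h3 : 5 / √l = 5 * (1 / √l) := by ring
  rw [h3]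
  rw [hsl] at e1 e3
  linarith

/-- **Van der Corput's second derivative test**, in terms of differences. -/
theorem vanDerCorput {l : ℝ} (hl : 0 < l) (hl' : l ≤ 1) {f : ℕ → ℝ} (m : ℤ) (K : ℕ) :
    ∀ {a b : ℕ}, a ≤ b →
    (∀ n, a ≤ n → n + 1 < b → f (n + 2) - f (n + 1) + l ≤ f (n + 1) - f n) →
    (∀ n, a ≤ n → n < b → m ≤ f (n + 1) - f n) →
    (∀ n, a ≤ n → n < b → f (n + 1) - f n ≤ m + (K + 1 : ℕ)) →
    ‖∑ n ∈ Finset.Ico a b, expTwoPi (f n)‖ ≤ (K + 1 : ℕ) * (5 / √l) := by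
  induction K with
  | zero =>
    intro a b hab hf hlo hup
    simpa using vanDerCorput_unit hab hl hl' m hf hlo (by simpa using hup)
  | succ K ih =>
    intro a b hab hf hlo hup
    obtain ⟨p, hap, hpb, hp1, hp2⟩ := exists_crossing hab (g := fun n => f (n + 1) - f n)
      (fun n h1 h2 => by have := hf n h1 h2; linarith) (m + (K + 1 : ℕ))
    rw [← Finset.sum_Ico_consecutive _ hap hpb]
    have e1 := vanDerCorput_unit hap hl hl' (m + (K + 1 : ℕ)) (f := f)
      (fun n h1 h2 => hf n h1 (by omega))
      (fun n h1 h2 => by have := (hp1 n h1 h2).le; push_cast at this ⊢; linarith)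
      (fun n h1 h2 => by have := hup n h1 (by omega); push_cast at this ⊢; linarith)
    have e2 := ih hpb (fun n h1 h2 => hf n (by omega) h2) (fun n h1 h2 => hlo n (by omega) h2) hp2
    refine (norm_add_le _ _).trans ((add_le_add e1 e2).trans (le_of_eq ?_))
    push_cast; ring

/-! ### Exponential sums along a circle -/

theorem sqrt_sub_sqrt_div {x y : ℝ} (hx : 0 < x) (hy : 0 ≤ y) : √x - √y = (x - y) / (√x + √y) := by
  have := Real.sqrt_pos.2 hx
  rw [eq_div_iff (by positivity)]
  linarith [Real.sq_sqrt hx.le, Real.sq_sqrt hy, sq (√x), sq (√y)]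

/-- Exponential sums along the circle of radius `ρ`. -/
theorem norm_circle_expSum_le {ρ : ℝ} (hρ : 0 ≤ ρ) {k : ℕ} (hk : 1 ≤ k) {M : ℕ}
    (hM : 2 * (M : ℝ) ^ 2 ≤ ρ ^ 2) :
    ‖∑ n ∈ Finset.Ico 1 (M + 1), expTwoPi (k * √(ρ ^ 2 - n ^ 2))‖ ≤ 6 * √(k * ρ) := by
  rcases Nat.eq_zero_or_pos M with rfl | hM0
  · simp; positivity
  have hk' : (1 : ℝ) ≤ k := by exact_mod_cast hk
  have hM1 : (1 : ℝ) ≤ M := by exact_mod_cast hM0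
  have hMρ : (M : ℝ) ≤ ρ := by nlinarith
  have hρ1 : 1 ≤ ρ := by linarith
  have hρ0 : 0 < ρ := by linarith
  set s : ℕ → ℝ := fun n => √(ρ ^ 2 - n ^ 2) with hs
  have hin : ∀ n : ℕ, n ≤ M → (n : ℝ) ^ 2 ≤ ρ ^ 2 - n ^ 2 := by
    intro n hn
    have : (n : ℝ) ≤ M := by exact_mod_cast hn
    nlinarith [Nat.cast_nonneg (α := ℝ) n]
  have hpos : ∀ n : ℕ, n ≤ M → 0 < ρ ^ 2 - (n : ℝ) ^ 2 := by
    intro n hn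
    rcases Nat.eq_zero_or_pos n with rfl | h
    · simp; positivity
    · have := hin n hn
      have : (1 : ℝ) ≤ n := by exact_mod_cast h
      nlinarith
  have hsn : ∀ n : ℕ, n ≤ M → (n : ℝ) ≤ s n := fun n hn =>
    Real.le_sqrt_of_sq_le (hin n hn)
  have hsρ : ∀ n : ℕ, s n ≤ ρ := fun n => Real.sqrt_le_iff.2 ⟨hρ, by
    have := sq_nonneg (n : ℝ); linarith⟩
  have hs0 : ∀ n : ℕ, n ≤ M → 0 < s n := fun n hn => Real.sqrt_pos.2 (hpos n hn)
  have hdiff : ∀ n : ℕ, n + 1 ≤ M → s n - s (n + 1) = (2 * n + 1) / (s n + s (n + 1)) := by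
    intro n hn
    have := sqrt_sub_sqrt_div (hpos n (by omega)) (hpos (n + 1) hn).le
    simp only [hs]
    rw [this]
    congr 1
    push_cast; ring
  have hdec : ∀ n : ℕ, n + 1 ≤ M → s (n + 1) ≤ s n := by
    intro n hn
    have := hdiff n hn
    have h1 := hs0 n (by omega)
    have h2 := hs0 (n + 1) hn
    have : 0 ≤ (2 * (n : ℝ) + 1) / (s n + s (n + 1)) := by positivity
    linarith
  have hkρ : 1 ≤ √(k * ρ) := Real.one_le_sqrt.2 (by nlinarith)
  -- Van der Corput is used with `l = k / ρ`, which must not exceed 1. For `k > ρ` the trivial bound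
  -- `M ≤ ρ ≤ √(kρ)` is already good enough.
  rcases le_or_gt (k : ℝ) ρ with hkl | hkl
  · rw [Finset.sum_Ico_succ_top (by omega)]
    -- On this arc the slope of the circle lies between `-1` and `0`, so the increments of `k * s`
    -- fill at most the `k` unit intervals from `-k` to `0`. The term `n = M` is split off because
    -- its increment would leave the arc; it costs `1 ≤ √(kρ)`, whence 6 in place of 5.
    have hmain := vanDerCorput (l := k / ρ) (by positivity) ((div_le_one hρ0).2 hkl)
      (f := fun n => k * s n) (-k) (k - 1) (a := 1) (b := M) hM0 ?_ ?_ ?_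
    · rw [Nat.sub_add_cancel hk] at hmain
      have h3 : (k : ℝ) * (5 / √(k / ρ)) = 5 * √(k * ρ) := by
        have hk0 : (0 : ℝ) < k := by linarith
        rw [Real.sqrt_div hk0.le, Real.sqrt_mul hk0.le]
        have := Real.mul_self_sqrt hk0.le
        have := Real.sqrt_pos.2 hk0
        field_simp
        linarith
      rw [h3] at hmain
      refine (norm_add_le _ _).trans ?_
      rw [norm_expTwoPi]
      linarith
    · intro n h1 h2
      have d1 := hdiff n (by omega)
      have d2 := hdiff (n + 1) (by omega)
      have p0 := hs0 n (by omega)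
      have p1 := hs0 (n + 1) (by omega)
      have p2 := hs0 (n + 2) (by omega)
      have q1 := hdec n (by omega)
      have q2 := hdec (n + 1) (by omega)
      -- The drop is `(2n + 1) / (s n + s (n + 1))`. From one step to the next its numerator grows
      -- by 2, while its denominator does not grow and is at most `2ρ`.
      have : 1 / ρ ≤ (s (n + 1) - s (n + 2)) - (s n - s (n + 1)) := by
        rw [show n + 1 + 1 = n + 2 by ring] at *
        rw [d1, d2]
        have e1 : (2 * (n : ℝ) + 1) / (s n + s (n + 1)) ≤
            (2 * (n : ℝ) + 1) / (s (n + 1) + s (n + 2)) := by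
          exact div_le_div_of_nonneg_left (by positivity) (by linarith) (by linarith)
        have e2 : 1 / ρ ≤ 2 / (s (n + 1) + s (n + 2)) := by
          rw [div_le_div_iff₀ hρ0 (by linarith)]
          linarith [hsρ (n + 1), hsρ (n + 2)]
        have e3 : (2 * ((n + 1 : ℕ) : ℝ) + 1) / (s (n + 1) + s (n + 2)) =
            (2 * (n : ℝ) + 1) / (s (n + 1) + s (n + 2)) + 2 / (s (n + 1) + s (n + 2)) := by
          push_cast; ring
        linarith
      have h5 := mul_le_mul_of_nonneg_left this (by linarith : (0 : ℝ) ≤ k)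
      rw [mul_one_div] at h5
      linarith
    · intro n h1 h2
      have d1 := hdiff n (by omega)
      have h3 : s n - s (n + 1) ≤ 1 := by
        rw [d1, div_le_one (by linarith [hs0 n (by omega), hs0 (n + 1) (by omega)])]
        have e1 := hsn n (by omega)
        have e2 := hsn (n + 1) (by omega)
        push_cast at e2
        linarith
      push_cast
      nlinarith
    · intro n h1 h2
      rw [Nat.sub_add_cancel hk]
      have := hdec n (by omega)
      push_cast
      nlinarith
  · refine (norm_sum_expTwoPi_le_card _ _ _).trans ?_
    simp only [Nat.add_sub_cancel]
    have : ρ ≤ √(k * ρ) := Real.le_sqrt_of_sq_le (by nlinarith)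
    linarith

/-! ### Jacobi's two squares theorem -/

open ArithmeticFunction in
/-- `∑_{d ∣ n} χ₄(d)`. -/
def chiSum (n : ℕ) : ℤ := ∑ d ∈ n.divisors, ZMod.χ₄ d

/-- The divisors of `p m` are those of `m` together with their multiples by `p`; the overlap is `p`
times the divisors of `m / p`, if `p ∣ m`. This recursion is matched by `rTwo_prime_mul`, and the
two determine both functions from their values at 1. -/
theorem chiSum_prime_mul {p : ℕ} (hp : p.Prime) {m : ℕ} (hm : m ≠ 0) :
    chiSum (p * m) = chiSum m + ZMod.χ₄ p * (chiSum m - if p ∣ m then chiSum (m / p) else 0) := by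
  have hinj : Function.Injective (fun d : ℕ => p * d) := fun a b h =>
    Nat.eq_of_mul_eq_mul_left hp.pos h
  have himg : ∀ n, ∑ d ∈ n.divisors.image (fun d => p * d), ZMod.χ₄ (d : ℕ) =
      ZMod.χ₄ p * chiSum n := by
    intro n
    rw [Finset.sum_image (fun a _ b _ h => hinj h), chiSum, Finset.mul_sum]
    refine Finset.sum_congr rfl fun d _ => ?_
    push_cast
    rw [map_mul]
  have hun : (p * m).divisors = m.divisors ∪ m.divisors.image (fun d => p * d) := by
    ext d
    simp only [Nat.mem_divisors, Finset.mem_union, Finset.mem_image, mul_ne_zero hp.ne_zero hm, hm,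
      ne_eq, not_false_eq_true, and_true]
    constructor
    · intro h
      by_cases hpd : p ∣ d
      · obtain ⟨c, rfl⟩ := hpd
        exact Or.inr ⟨c, Nat.dvd_of_mul_dvd_mul_left hp.pos h, rfl⟩
      · exact Or.inl ((Nat.Coprime.dvd_mul_left ((hp.coprime_iff_not_dvd.2 hpd).symm)).1 h)
    · rintro (h | ⟨c, hc, rfl⟩)
      · exact h.mul_left p
      · exact mul_dvd_mul_left p hc
  have hint : ∑ d ∈ m.divisors ∩ m.divisors.image (fun d => p * d), ZMod.χ₄ (d : ℕ) =
      ZMod.χ₄ p * if p ∣ m then chiSum (m / p) else 0 := by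
    split_ifs with h
    · obtain ⟨c, rfl⟩ := h
      rw [Nat.mul_div_cancel_left _ hp.pos, ← himg]
      congr 1
      ext d
      have hc : c ≠ 0 := fun h => hm (by simp [h])
      simp only [Finset.mem_inter, Finset.mem_image, Nat.mem_divisors, hm, hc, ne_eq,
        not_false_eq_true, and_true]
      constructor
      · rintro ⟨h1, e, h2, rfl⟩
        exact ⟨e, Nat.dvd_of_mul_dvd_mul_left hp.pos h1, rfl⟩
      · rintro ⟨e, h, rfl⟩
        exact ⟨mul_dvd_mul_left p h, e, h.mul_left p, rfl⟩
    · rw [mul_zero]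
      refine Finset.sum_eq_zero fun d hd => ?_
      simp only [Finset.mem_inter, Finset.mem_image, Nat.mem_divisors] at hd
      obtain ⟨h1, e, h2, rfl⟩ := hd
      exact absurd ((dvd_mul_right p e).trans h1.1) h
  have := Finset.sum_union_inter (s₁ := m.divisors) (s₂ := m.divisors.image (fun d => p * d))
    (f := fun d : ℕ => ZMod.χ₄ (d : ℕ))
  rw [hint, himg, ← hun] at this
  change chiSum (p * m) + _ = chiSum m + _ at this
  linarith

theorem gaussianInt_norm_eq (z : GaussianInt) : z.norm = z.re ^ 2 + z.im ^ 2 := by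
  rw [Zsqrtd.norm_def]; ring

theorem finite_norm_eq (n : ℕ) : {z : GaussianInt | z.norm = n}.Finite := by
  refine ((Set.finite_Icc (-(n : ℤ)) n).prod (Set.finite_Icc (-(n : ℤ)) n)).image
    (fun p => (⟨p.1, p.2⟩ : GaussianInt)) |>.subset fun z hz => ?_
  have hz : z.norm = n := hz
  rw [gaussianInt_norm_eq] at hz
  refine ⟨(z.re, z.im), ⟨⟨?_, ?_⟩, ?_, ?_⟩, rfl⟩ <;> simp only <;>
    nlinarith [sq_nonneg z.re, sq_nonneg z.im]

/-- The Gaussian integers of norm `n`. -/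
noncomputable def normSet (n : ℕ) : Finset GaussianInt := (finite_norm_eq n).toFinset

@[simp] theorem mem_normSet {n : ℕ} {z : GaussianInt} : z ∈ normSet n ↔ z.norm = n := by
  simp [normSet]

/-- The number of representations of `n` as a sum of two squares. -/
noncomputable def rTwo (n : ℕ) : ℕ := (normSet n).card

theorem rTwo_zero : rTwo 0 = 1 := by
  have : normSet 0 = {0} := by
    ext z; simp [GaussianInt.norm_eq_zero]
  rw [rTwo, this, Finset.card_singleton]

theorem rTwo_one : rTwo 1 = 4 := by
  have : normSet 1 = {⟨1, 0⟩, ⟨-1, 0⟩, ⟨0, 1⟩, ⟨0, -1⟩} := by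
    ext ⟨x, y⟩
    simp only [mem_normSet, gaussianInt_norm_eq, Finset.mem_insert, Finset.mem_singleton,
      Zsqrtd.ext_iff]
    constructor
    · intro h
      push_cast at h
      have hx : x ≤ 1 := by nlinarith
      have hx' : -1 ≤ x := by nlinarith
      have hy : y ≤ 1 := by nlinarith
      have hy' : -1 ≤ y := by nlinarith
      interval_cases x <;> interval_cases y <;> simp_all
    · rintro (⟨rfl, rfl⟩ | ⟨rfl, rfl⟩ | ⟨rfl, rfl⟩ | ⟨rfl, rfl⟩) <;> norm_num
  rw [rTwo, this]
  decide

theorem mul_normSet {π : GaussianInt} {p : ℕ} (hp : p ≠ 0) (hπ : π.norm = p) (m : ℕ) {z : GaussianInt} :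
    z ∈ (normSet m).image (fun w => π * w) ↔ π ∣ z ∧ z ∈ normSet (p * m) := by
  have hp' : (p : ℤ) ≠ 0 := by exact_mod_cast hp
  simp only [Finset.mem_image, mem_normSet]
  constructor
  · rintro ⟨w, hw, rfl⟩
    exact ⟨dvd_mul_right _ _, by rw [Zsqrtd.norm_mul, hπ, hw]; push_cast; rfl⟩
  · rintro ⟨⟨w, rfl⟩, h⟩
    rw [Zsqrtd.norm_mul, hπ] at h
    push_cast at h
    exact ⟨w, mul_left_cancel₀ hp' h, rfl⟩

theorem card_mul_normSet {π : GaussianInt} {p : ℕ} (hp : p ≠ 0) (hπ : π.norm = p) (m : ℕ) :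
    ((normSet m).image (fun w => π * w)).card = rTwo m := by
  refine Finset.card_image_of_injective _ fun a b h => mul_left_cancel₀ ?_ h
  rintro rfl
  simp at hπ
  exact hp (by exact_mod_cast hπ.symm)

theorem prime_of_norm_eq_prime {π : GaussianInt} {p : ℕ} (hp : p.Prime) (hπ : π.norm = p) :
    Prime π := by
  rw [← irreducible_iff_prime]
  refine ⟨fun h => ?_, fun a b h => ?_⟩
  · rw [← Zsqrtd.norm_eq_one_iff, hπ] at h
    simp at h
    exact hp.one_lt.ne' h
  · have h1 : a.norm.natAbs * b.norm.natAbs = p := by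
      rw [← Int.natAbs_mul, ← Zsqrtd.norm_mul, ← h, hπ]; rfl
    rw [← Zsqrtd.norm_eq_one_iff, ← Zsqrtd.norm_eq_one_iff]
    rcases (Nat.dvd_prime hp).1 (Dvd.intro _ h1) with h2 | h2
    · exact Or.inl h2
    · right
      rw [h2] at h1
      exact Nat.eq_of_mul_eq_mul_left hp.pos (by rw [h1, mul_one])

theorem dvd_mul_star_of_norm {z : GaussianInt} {n : ℕ} {p : ℕ} (h : z.norm = (p * n : ℕ)) :
    (p : GaussianInt) ∣ z * star z := by
  rw [← Zsqrtd.norm_eq_mul_conj, h]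
  push_cast
  exact dvd_mul_right _ _

theorem star_dvd {a z : GaussianInt} (h : a ∣ star z) : star a ∣ z := by
  obtain ⟨w, hw⟩ := h
  exact ⟨star w, by rw [← star_star z, hw, star_mul, mul_comm]⟩

theorem norm_star' (z : GaussianInt) : (star z).norm = z.norm := by
  rw [gaussianInt_norm_eq, gaussianInt_norm_eq]; simp

/-- The prime `1 + i` is associated to its conjugate, so it divides every Gaussian integer of even
norm. -/
theorem rTwo_two_mul (m : ℕ) : rTwo (2 * m) = rTwo m := by
  have hπ : (⟨1, 1⟩ : GaussianInt).norm = (2 : ℕ) := by rw [gaussianInt_norm_eq]; norm_num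
  rw [← card_mul_normSet two_ne_zero hπ m, rTwo]
  congr 1
  ext z
  rw [mul_normSet two_ne_zero hπ]
  refine ⟨fun h => ⟨?_, h⟩, fun h => h.2⟩
  have h2 : (⟨1, 1⟩ : GaussianInt) ∣ ((2 : ℕ) : GaussianInt) := ⟨⟨1, -1⟩, by
    rw [Zsqrtd.ext_iff]; simp⟩
  have h1 := h2.trans (dvd_mul_star_of_norm (mem_normSet.1 h))
  rcases (prime_of_norm_eq_prime Nat.prime_two hπ).dvd_or_dvd h1 with h3 | h3
  · exact h3
  · have := star_dvd h3
    refine dvd_trans ⟨⟨0, -1⟩, ?_⟩ this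
    rw [Zsqrtd.ext_iff]; simp

theorem norm_natCast' (p : ℕ) : ((p : GaussianInt)).norm = (p * p : ℕ) := by
  rw [gaussianInt_norm_eq]; simp [sq]

/-- Such a `p` stays prime in the Gaussian integers, hence divides every `z` whose norm it divides;
the norm is then divisible by `p²`. -/
theorem rTwo_prime_mul_three {p : ℕ} (hp : p.Prime) (h4 : p % 4 = 3) (m : ℕ) :
    rTwo (p * m) = if p ∣ m then rTwo (m / p) else 0 := by
  have := Fact.mk hp
  have hpr : Prime (p : GaussianInt) := GaussianInt.prime_of_nat_prime_of_mod_four_eq_three p h4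
  have hdvd : ∀ z ∈ normSet (p * m), (p : GaussianInt) ∣ z := by
    intro z hz
    rcases hpr.dvd_or_dvd (dvd_mul_star_of_norm (mem_normSet.1 hz)) with h | h
    · exact h
    · have := star_dvd h
      rwa [star_natCast] at this
  have hpp : p * p ≠ 0 := (mul_pos hp.pos hp.pos).ne'
  split_ifs with h
  · obtain ⟨c, rfl⟩ := h
    rw [Nat.mul_div_cancel_left _ hp.pos, ← card_mul_normSet hpp (norm_natCast' p) c, rTwo]
    congr 1
    ext z
    rw [mul_normSet hpp (norm_natCast' p), mul_assoc]
    exact ⟨fun h => ⟨hdvd z h, h⟩, fun h => h.2⟩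
  · rw [rTwo, Finset.card_eq_zero, Finset.eq_empty_iff_forall_notMem]
    intro z hz
    obtain ⟨w, rfl⟩ := hdvd z hz
    rw [mem_normSet, Zsqrtd.norm_mul, norm_natCast'] at hz
    push_cast at hz
    rw [mul_assoc] at hz
    have h3 := mul_left_cancel₀ (by exact_mod_cast hp.ne_zero : (p : ℤ) ≠ 0) hz
    exact h (by exact_mod_cast Dvd.intro _ h3)

/-- Here `p` splits as `π π̄`. Every element of norm `p m` is divisible by `π` or `π̄`, each case
accounting for `rTwo m` elements. Since `π` and `π̄` are not associated, divisibility by both means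
divisibility by `p`, and inclusion-exclusion gives the relation. -/
theorem rTwo_prime_mul_one {p : ℕ} (hp : p.Prime) (h4 : p % 4 = 1) (m : ℕ) :
    rTwo (p * m) + (if p ∣ m then rTwo (m / p) else 0) = 2 * rTwo m := by
  have := Fact.mk hp
  obtain ⟨a, b, hab⟩ := Nat.Prime.sq_add_sq (p := p) (by omega)
  set π : GaussianInt := ⟨a, b⟩ with hπdef
  have hπ : π.norm = p := by rw [gaussianInt_norm_eq, ← hab]; push_cast; rfl
  have hπ' : (star π).norm = p := by rw [norm_star', hπ]
  have hpr := prime_of_norm_eq_prime hp hπ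
  have hpr' := prime_of_norm_eq_prime hp hπ'
  have hmulp : π * star π = p := by rw [← Zsqrtd.norm_eq_mul_conj, hπ]; rfl
  -- Otherwise `π` divides `π + π̄ = 2a`. Taking norms gives `p ∣ a`, then `p ∣ b`, and `p²` would
  -- divide `a² + b² = p`.
  have hnd : ¬ π ∣ star π := by
    intro h
    have h1 : π ∣ (2 * a : ℤ) := by
      have := dvd_add (dvd_refl π) h
      have e : π + star π = ((2 * a : ℤ) : GaussianInt) := by
        rw [Zsqrtd.ext_iff]; simp [hπdef]; ring
      rwa [e] at this
    have h2 : (p : ℤ) ∣ (2 * a) * (2 * a) := by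
      obtain ⟨w, hw⟩ := h1
      refine ⟨w.norm, ?_⟩
      rw [← hπ, ← Zsqrtd.norm_mul, ← hw, gaussianInt_norm_eq]
      simp [sq]
    have h3 : (p : ℤ) ∣ 2 * a := by
      have hpi := Nat.prime_iff_prime_int.1 hp
      exact (hpi.dvd_or_dvd h2).elim id id
    have h4' : p ∣ 2 * a := by exact_mod_cast h3
    have h5 : p ∣ a := (hp.dvd_mul.1 h4').resolve_left fun h => by
      have := Nat.le_of_dvd (by norm_num) h
      have := hp.two_le
      omega
    have h6 : p ∣ b := by
      have : p ∣ b ^ 2 := (Nat.dvd_add_right (h5.trans (Dvd.intro_left _ (sq a).symm))).1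
        (by rw [hab])
      exact hp.dvd_of_dvd_pow this
    obtain ⟨c, rfl⟩ := h5
    obtain ⟨d, rfl⟩ := h6
    have h7 : p * (p * (c ^ 2 + d ^ 2)) = p * 1 := by rw [mul_one]; nlinarith
    have h8 := Nat.eq_of_mul_eq_mul_left hp.pos h7
    exact hp.one_lt.ne' (Nat.eq_one_of_mul_eq_one_right h8)
  have hun : normSet (p * m) = (normSet m).image (fun w => π * w) ∪
      (normSet m).image (fun w => star π * w) := by
    ext z
    rw [Finset.mem_union, mul_normSet hp.ne_zero hπ, mul_normSet hp.ne_zero hπ', ← or_and_right]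
    refine ⟨fun h => ⟨?_, h⟩, fun h => h.2⟩
    have h1 : π ∣ z * star z :=
      (Dvd.intro _ hmulp).trans (dvd_mul_star_of_norm (mem_normSet.1 h))
    exact (hpr.dvd_or_dvd h1).imp id star_dvd
  have hpp : p * p ≠ 0 := (mul_pos hp.pos hp.pos).ne'
  have hboth : ∀ z : GaussianInt, π ∣ z → star π ∣ z → (p : GaussianInt) ∣ z := by
    rintro z h1 ⟨w, rfl⟩
    rcases hpr.dvd_or_dvd h1 with h2 | ⟨v, rfl⟩
    · exact absurd h2 hnd
    · exact ⟨v, by rw [← hmulp]; ring⟩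
  have hint : ((normSet m).image (fun w => π * w) ∩
      (normSet m).image (fun w => star π * w)).card = if p ∣ m then rTwo (m / p) else 0 := by
    split_ifs with h
    · obtain ⟨c, rfl⟩ := h
      rw [Nat.mul_div_cancel_left _ hp.pos, ← card_mul_normSet hpp (norm_natCast' p) c]
      congr 1
      ext z
      rw [Finset.mem_inter, mul_normSet hp.ne_zero hπ, mul_normSet hp.ne_zero hπ',
        mul_normSet hpp (norm_natCast' p), mul_assoc]
      constructor
      · rintro ⟨⟨h1, h2⟩, h3, -⟩
        exact ⟨hboth z h1 h3, h2⟩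
      · rintro ⟨h1, h2⟩
        exact ⟨⟨(Dvd.intro _ hmulp).trans h1, h2⟩, (Dvd.intro_left _ hmulp).trans h1, h2⟩
    · rw [Finset.card_eq_zero, Finset.eq_empty_iff_forall_notMem]
      intro z hz
      rw [Finset.mem_inter, mul_normSet hp.ne_zero hπ, mul_normSet hp.ne_zero hπ'] at hz
      obtain ⟨⟨h1, h2⟩, h3, -⟩ := hz
      obtain ⟨w, rfl⟩ := hboth z h1 h3
      rw [mem_normSet, Zsqrtd.norm_mul, norm_natCast'] at h2
      push_cast at h2
      rw [mul_assoc] at h2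
      have h3 := mul_left_cancel₀ (by exact_mod_cast hp.ne_zero : (p : ℤ) ≠ 0) h2
      exact h (by exact_mod_cast Dvd.intro _ h3)
  have := Finset.card_union_add_card_inter ((normSet m).image (fun w => π * w))
    ((normSet m).image (fun w => star π * w))
  rw [← hun, hint, card_mul_normSet hp.ne_zero hπ, card_mul_normSet hp.ne_zero hπ'] at this
  rw [two_mul, ← this]
  rfl

theorem rTwo_prime_mul {p : ℕ} (hp : p.Prime) (m : ℕ) :
    (rTwo (p * m) : ℤ) = rTwo m + ZMod.χ₄ p * (rTwo m - if p ∣ m then rTwo (m / p) else 0) := by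
  rcases hp.eq_two_or_odd with rfl | h
  · rw [rTwo_two_mul, ZMod.χ₄_nat_eq_if_mod_four]
    simp
  · rcases (by omega : p % 4 = 1 ∨ p % 4 = 3) with h4 | h4
    · have := rTwo_prime_mul_one hp h4 m
      rw [ZMod.χ₄_nat_one_mod_four h4]
      by_cases hpm : p ∣ m
      · rw [if_pos hpm] at this ⊢; linarith
      · rw [if_neg hpm] at this ⊢; push_cast; linarith
    · rw [ZMod.χ₄_nat_three_mod_four h4, rTwo_prime_mul_three hp h4 m]
      split_ifs <;> push_cast <;> ring

/-- **Jacobi's two squares theorem**. -/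
theorem rTwo_eq {n : ℕ} (hn : n ≠ 0) : (rTwo n : ℤ) = 4 * chiSum n := by
  induction n using Nat.strong_induction_on with
  | _ n ih =>
    rcases eq_or_ne n 1 with rfl | h1
    · rw [rTwo_one]; simp [chiSum]
    · obtain ⟨p, hp, m, rfl⟩ := Nat.exists_prime_and_dvd h1
      have hm : m ≠ 0 := fun h => hn (by simp [h])
      have hlt : m < p * m := lt_mul_of_one_lt_left (Nat.pos_of_ne_zero hm) hp.one_lt
      rw [rTwo_prime_mul hp, chiSum_prime_mul hp hm, ih m hlt hm]
      split_ifs with h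
      · rw [ih (m / p) ((Nat.div_le_self m p).trans_lt hlt)
          (Nat.div_pos (Nat.le_of_dvd (Nat.pos_of_ne_zero hm) h) hp.pos).ne']
        ring
      · ring

/-! ### The convolution of `chiSum` with itself, by a sign-reversing involution -/

theorem chi_mul_chi {e u : ℕ} (he : e % 2 = 1) :
    ZMod.χ₄ ((e + 2 * u : ℕ) : ZMod 4) * ZMod.χ₄ (e : ZMod 4) = (-1) ^ u := by
  rw [ZMod.χ₄_nat_eq_if_mod_four, ZMod.χ₄_nat_eq_if_mod_four]
  rcases Nat.even_or_odd u with hu | hu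
  · rw [hu.neg_one_pow]
    obtain ⟨c, rfl⟩ := hu
    rcases (by omega : e % 4 = 1 ∨ e % 4 = 3) with h | h
    · rw [if_neg (by omega), if_pos (by omega), if_neg (by omega), if_pos (by omega)]; rfl
    · rw [if_neg (by omega), if_neg (by omega), if_neg (by omega), if_neg (by omega)]; rfl
  · rw [hu.neg_one_pow]
    obtain ⟨c, rfl⟩ := hu
    rcases (by omega : e % 4 = 1 ∨ e % 4 = 3) with h | h
    · rw [if_neg (by omega), if_neg (by omega), if_neg (by omega), if_pos (by omega)]; rfl
    · rw [if_neg (by omega), if_pos (by omega), if_neg (by omega), if_neg (by omega)]; rfl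

/-- Quadruples `(e, k, u, v)` with `e v + u k = m`, `e`, `k` odd, `u, v ≥ 1` and `k < 2 v`. -/
def involutionSet (m : ℕ) : Finset (ℕ × ℕ × ℕ × ℕ) :=
  (Finset.range (m + 1) ×ˢ Finset.range (m + 1) ×ˢ Finset.range (m + 1) ×ˢ
    Finset.range (m + 1)).filter fun q => q.1 * q.2.2.2 + q.2.2.1 * q.2.1 = m ∧ q.1 % 2 = 1 ∧
      q.2.1 % 2 = 1 ∧ 1 ≤ q.2.2.1 ∧ 1 ≤ q.2.2.2 ∧ q.2.1 < 2 * q.2.2.2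

theorem mem_involutionSet {m e k u v : ℕ} : (e, k, u, v) ∈ involutionSet m ↔
    e * v + u * k = m ∧ e % 2 = 1 ∧ k % 2 = 1 ∧ 1 ≤ u ∧ 1 ≤ v ∧ k < 2 * v := by
  simp only [involutionSet, Finset.mem_filter, Finset.mem_product, Finset.mem_range,
    and_iff_right_iff_imp]
  rintro ⟨h, h1, h2, h3, h4, h5⟩
  have he : 1 ≤ e := by omega
  have hk : 1 ≤ k := by omega
  refine ⟨?_, ?_, ?_, ?_⟩ <;> nlinarith

/-- Divide with remainder, `e = 2uq + e'`, and send `(e, k, u, v)` to `(k + 2qv, e', v, u)`. The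
constraint `k < 2v` says that `k` is the remainder of the new first entry modulo `2v`, so the map is
an involution. Reducing the equation modulo 2 shows that `u + v` is odd, hence the sign changes. -/
theorem sum_involutionSet {m : ℕ} (hm : m % 2 = 1) :
    ∑ q ∈ involutionSet m, (-1 : ℤ) ^ q.2.2.1 = 0 := by
  have parity : ∀ e k u v, (e, k, u, v) ∈ involutionSet m → (u + v) % 2 = 1 := by
    intro e k u v h
    rw [mem_involutionSet] at h
    obtain ⟨h, h1, h2, -⟩ := h
    obtain ⟨e, rfl⟩ : ∃ e', e = 2 * e' + 1 := ⟨e / 2, by omega⟩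
    obtain ⟨k, rfl⟩ : ∃ k', k = 2 * k' + 1 := ⟨k / 2, by omega⟩
    have : (2 * e + 1) * v + u * (2 * k + 1) = 2 * (e * v + u * k) + (u + v) := by ring
    omega
  refine Finset.sum_involution
    (fun q _ => (q.2.1 + 2 * (q.1 / (2 * q.2.2.1)) * q.2.2.2, q.1 % (2 * q.2.2.1), q.2.2.2,
      q.2.2.1)) ?_ ?_ ?_ ?_
  · rintro ⟨e, k, u, v⟩ h
    have := parity e k u v h
    simp only
    rcases Nat.even_or_odd u with hu | hu
    · have hv : Odd v := by rw [Nat.odd_iff]; obtain ⟨c, rfl⟩ := hu; omega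
      rw [hu.neg_one_pow, hv.neg_one_pow]; rfl
    · have hv : Even v := by rw [Nat.even_iff]; obtain ⟨c, rfl⟩ := hu; omega
      rw [hu.neg_one_pow, hv.neg_one_pow]; rfl
  · rintro ⟨e, k, u, v⟩ h - h2
    have := parity e k u v h
    simp only [Prod.mk.injEq] at h2
    omega
  · rintro ⟨e, k, u, v⟩ h
    simp only
    rw [mem_involutionSet] at h ⊢
    obtain ⟨h, h1, h2, h3, h4, h5⟩ := h
    have hd := Nat.div_add_mod e (2 * u)
    refine ⟨?_, ?_, ?_, h4, h3, Nat.mod_lt _ (by omega)⟩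
    · rw [← h]
      calc _ = u * k + (2 * u * (e / (2 * u)) + e % (2 * u)) * v := by ring
        _ = _ := by rw [hd]; ring
    · rw [mul_assoc]; omega
    · have : 2 * u * (e / (2 * u)) = 2 * (u * (e / (2 * u))) := by ring
      omega
  · rintro ⟨e, k, u, v⟩ h
    simp only
    rw [mem_involutionSet] at h
    obtain ⟨h, h1, h2, h3, h4, h5⟩ := h
    have e1 : (k + 2 * (e / (2 * u)) * v) / (2 * v) = e / (2 * u) := by
      rw [show k + 2 * (e / (2 * u)) * v = k + 2 * v * (e / (2 * u)) by ring,
        Nat.add_mul_div_left _ _ (by omega), Nat.div_eq_of_lt h5, zero_add]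
    have e2 : (k + 2 * (e / (2 * u)) * v) % (2 * v) = k := by
      rw [show k + 2 * (e / (2 * u)) * v = k + 2 * v * (e / (2 * u)) by ring,
        Nat.add_mul_mod_self_left, Nat.mod_eq_of_lt h5]
    rw [e1, e2]
    have hd := Nat.div_add_mod e (2 * u)
    simp only [Prod.mk.injEq, and_true]
    linarith [hd, mul_right_comm 2 (e / (2 * u)) u, mul_right_comm 2 u (e / (2 * u))]

/-- Quadruples `(d, k, e, l)` of odd numbers with `d k + e l = 2 m`. -/
def oddSolutions (m : ℕ) : Finset (ℕ × ℕ × ℕ × ℕ) :=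
  (Finset.range (2 * m + 1) ×ˢ Finset.range (2 * m + 1) ×ˢ Finset.range (2 * m + 1) ×ˢ
    Finset.range (2 * m + 1)).filter fun q => q.1 * q.2.1 + q.2.2.1 * q.2.2.2 = 2 * m ∧
      q.1 % 2 = 1 ∧ q.2.1 % 2 = 1 ∧ q.2.2.1 % 2 = 1 ∧ q.2.2.2 % 2 = 1

theorem mem_oddSolutions {m d k e l : ℕ} : (d, k, e, l) ∈ oddSolutions m ↔
    d * k + e * l = 2 * m ∧ d % 2 = 1 ∧ k % 2 = 1 ∧ e % 2 = 1 ∧ l % 2 = 1 := by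
  simp only [oddSolutions, Finset.mem_filter, Finset.mem_product, Finset.mem_range,
    and_iff_right_iff_imp]
  rintro ⟨h, h1, h2, h3, h4⟩
  have hd : 1 ≤ d := by omega
  have hk : 1 ≤ k := by omega
  have he : 1 ≤ e := by omega
  have hl : 1 ≤ l := by omega
  refine ⟨?_, ?_, ?_, ?_⟩ <;> nlinarith

/-- The substitution `d = e + 2u`, `k + l = 2v` turns `d k + e l = 2m` into `e v + u k = m`, with `l
> 0` becoming `k < 2v`. The product of characters becomes `(-1)^u`, and the involution cancels
everything. -/
theorem sum_oddSolutions_gt {m : ℕ} (hm : m % 2 = 1) :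
    ∑ q ∈ (oddSolutions m).filter (fun q => q.2.2.1 < q.1),
      ZMod.χ₄ (q.1 : ZMod 4) * ZMod.χ₄ (q.2.2.1 : ZMod 4) = 0 := by
  rw [← sum_involutionSet hm]
  refine Finset.sum_nbij' (fun q => (q.2.2.1, q.2.1, (q.1 - q.2.2.1) / 2, (q.2.1 + q.2.2.2) / 2))
    (fun q => (q.1 + 2 * q.2.2.1, q.2.1, q.1, 2 * q.2.2.2 - q.2.1)) ?_ ?_ ?_ ?_ ?_
  · rintro ⟨d, k, e, l⟩ h
    simp only [Finset.mem_filter, mem_oddSolutions] at h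
    obtain ⟨⟨h, h1, h2, h3, h4⟩, h5⟩ := h
    simp only [mem_involutionSet]
    obtain ⟨u, rfl⟩ : ∃ u, d = e + 2 * u := ⟨(d - e) / 2, by omega⟩
    obtain ⟨v, hv⟩ : ∃ v, k + l = 2 * v := ⟨(k + l) / 2, by omega⟩
    rw [show (e + 2 * u - e) / 2 = u by omega, show (k + l) / 2 = v by omega]
    refine ⟨?_, h3, h2, by omega, by omega, by omega⟩
    have : 2 * (e * v + u * k) = 2 * m := by
      rw [← h]
      calc _ = e * (2 * v) + 2 * u * k := by ring
        _ = _ := by rw [← hv]; ring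
    omega
  · rintro ⟨e, k, u, v⟩ h
    rw [mem_involutionSet] at h
    obtain ⟨h, h1, h2, h3, h4, h5⟩ := h
    simp only [Finset.mem_filter, mem_oddSolutions]
    obtain ⟨l, hl⟩ : ∃ l, 2 * v = k + l := ⟨2 * v - k, by omega⟩
    rw [hl, Nat.add_sub_cancel_left]
    refine ⟨⟨?_, by omega, h2, h1, by omega⟩, by omega⟩
    rw [← h]
    calc _ = e * (k + l) + 2 * u * k := by ring
      _ = _ := by rw [← hl]; ring
  · rintro ⟨d, k, e, l⟩ h
    simp only [Finset.mem_filter, mem_oddSolutions] at h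
    change (e + 2 * ((d - e) / 2), k, e, 2 * ((k + l) / 2) - k) = (d, k, e, l)
    rw [show e + 2 * ((d - e) / 2) = d by omega, show 2 * ((k + l) / 2) - k = l by omega]
  · rintro ⟨e, k, u, v⟩ h
    rw [mem_involutionSet] at h
    change (e, k, (e + 2 * u - e) / 2, (k + (2 * v - k)) / 2) = (e, k, u, v)
    rw [show (e + 2 * u - e) / 2 = u by omega, show (k + (2 * v - k)) / 2 = v by omega]
  · rintro ⟨d, k, e, l⟩ h
    simp only [Finset.mem_filter, mem_oddSolutions] at h
    obtain ⟨⟨h, h1, h2, h3, h4⟩, h5⟩ := h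
    simp only
    rw [← chi_mul_chi h3]
    congr 4
    omega

/-- Only the diagonal `d = e` survives. There the characters multiply to 1 and `d (k + l) = 2m`, so
`d ∣ m` and `k` runs through the `m / d` odd numbers below `2m / d`; the sum of all `m / d` is the
divisor sum. -/
theorem sum_oddSolutions_eq {m : ℕ} (hm : m % 2 = 1) :
    ∑ q ∈ (oddSolutions m).filter (fun q => q.2.2.1 = q.1),
      ZMod.χ₄ (q.1 : ZMod 4) * ZMod.χ₄ (q.2.2.1 : ZMod 4) = ∑ d ∈ m.divisors, (d : ℤ) := by
  have h1 : ∑ d ∈ m.divisors, (d : ℤ) =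
      ∑ p ∈ m.divisors.sigma (fun d => Finset.range (m / d)), 1 := by
    rw [Finset.sum_sigma]
    simp only [Finset.sum_const, Finset.card_range, nsmul_eq_mul, mul_one]
    exact (Nat.sum_div_divisors m (fun d => (d : ℤ))).symm
  rw [h1]
  have hm0 : m ≠ 0 := by rintro rfl; omega
  refine Finset.sum_nbij' (fun q => ⟨q.1, q.2.1 / 2⟩)
    (fun p => (p.1, 2 * p.2 + 1, p.1, 2 * (m / p.1 - p.2) - 1)) ?_ ?_ ?_ ?_ ?_
  · rintro ⟨d, k, e, l⟩ h
    simp only [Finset.mem_filter, mem_oddSolutions] at h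
    obtain ⟨⟨h, h1, h2, h3, h4⟩, rfl⟩ := h
    simp only [Finset.mem_sigma, Nat.mem_divisors, Finset.mem_range]
    obtain ⟨v, hv⟩ : ∃ v, k + l = 2 * v := ⟨(k + l) / 2, by omega⟩
    have : e * v = m := by
      have : 2 * (e * v) = 2 * m := by
        rw [← h]
        calc _ = e * (2 * v) := by ring
          _ = _ := by rw [← hv]; ring
      omega
    have he : 0 < e := by omega
    refine ⟨⟨Dvd.intro _ this, hm0⟩, ?_⟩
    rw [← this, Nat.mul_div_cancel_left _ he]
    omega
  · rintro ⟨d, i⟩ h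
    simp only [Finset.mem_sigma, Nat.mem_divisors, Finset.mem_range] at h
    obtain ⟨⟨⟨c, rfl⟩, -⟩, hi⟩ := h
    have hd : 0 < d := Nat.pos_of_ne_zero fun h => hm0 (by simp [h])
    rw [Nat.mul_div_cancel_left _ hd] at hi
    simp only [Finset.mem_filter, mem_oddSolutions, and_true]
    rw [Nat.mul_div_cancel_left _ hd]
    have hdo : d % 2 = 1 := by
      rcases Nat.mod_two_eq_zero_or_one d with h | h
      · simp [Nat.mul_mod, h] at hm
      · exact h
    refine ⟨?_, hdo, by omega, hdo, by omega⟩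
    rw [← mul_add, show 2 * i + 1 + (2 * (c - i) - 1) = 2 * c by omega]
    ring
  · rintro ⟨d, k, e, l⟩ h
    simp only [Finset.mem_filter, mem_oddSolutions] at h
    obtain ⟨⟨h, h1, h2, h3, h4⟩, rfl⟩ := h
    simp only [Prod.mk.injEq, true_and]
    obtain ⟨v, hv⟩ : ∃ v, k + l = 2 * v := ⟨(k + l) / 2, by omega⟩
    have : e * v = m := by
      have : 2 * (e * v) = 2 * m := by
        rw [← h]
        calc _ = e * (2 * v) := by ring
          _ = _ := by rw [← hv]; ring
      omega
    have he : 0 < e := by omega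
    rw [← this, Nat.mul_div_cancel_left _ he]
    omega
  · rintro ⟨d, i⟩ h
    simp
    omega
  · rintro ⟨d, k, e, l⟩ h
    simp only [Finset.mem_filter, mem_oddSolutions] at h
    obtain ⟨⟨h, h1, h2, h3, h4⟩, rfl⟩ := h
    have := chi_mul_chi (u := 0) h3
    simpa using this

theorem sum_oddSolutions {m : ℕ} (hm : m % 2 = 1) :
    ∑ q ∈ oddSolutions m, ZMod.χ₄ (q.1 : ZMod 4) * ZMod.χ₄ (q.2.2.1 : ZMod 4) =
      ∑ d ∈ m.divisors, (d : ℤ) := by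
  have hlt : ∑ q ∈ (oddSolutions m).filter (fun q => q.1 < q.2.2.1),
      ZMod.χ₄ (q.1 : ZMod 4) * ZMod.χ₄ (q.2.2.1 : ZMod 4) = 0 := by
    rw [← sum_oddSolutions_gt hm]
    refine Finset.sum_nbij' (fun q => (q.2.2.1, q.2.2.2, q.1, q.2.1))
      (fun q => (q.2.2.1, q.2.2.2, q.1, q.2.1)) ?_ ?_ ?_ ?_ ?_
    · rintro ⟨d, k, e, l⟩ h
      simp only [Finset.mem_filter, mem_oddSolutions] at h ⊢
      omega
    · rintro ⟨d, k, e, l⟩ h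
      simp only [Finset.mem_filter, mem_oddSolutions] at h ⊢
      omega
    · rintro ⟨d, k, e, l⟩ h; rfl
    · rintro ⟨d, k, e, l⟩ h; rfl
    · rintro ⟨d, k, e, l⟩ h; exact mul_comm _ _
  have h1 := Finset.sum_filter_add_sum_filter_not (oddSolutions m) (fun q => q.2.2.1 < q.1)
    (fun q => ZMod.χ₄ (q.1 : ZMod 4) * ZMod.χ₄ (q.2.2.1 : ZMod 4))
  have h2 := Finset.sum_filter_add_sum_filter_not
    ((oddSolutions m).filter fun q => ¬ q.2.2.1 < q.1) (fun q => q.2.2.1 = q.1)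
    (fun q => ZMod.χ₄ (q.1 : ZMod 4) * ZMod.χ₄ (q.2.2.1 : ZMod 4))
  rw [Finset.filter_filter, Finset.filter_filter,
    Finset.filter_congr (q := fun q => q.2.2.1 = q.1) (fun q _ => by omega),
    Finset.filter_congr (p := fun q : ℕ × ℕ × ℕ × ℕ => ¬ q.2.2.1 < q.1 ∧ ¬ q.2.2.1 = q.1)
      (q := fun q : ℕ × ℕ × ℕ × ℕ => q.1 < q.2.2.1) (fun q _ => by omega), hlt, sum_oddSolutions_eq hm] at h2
  rw [← h1, sum_oddSolutions_gt hm, ← h2]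
  ring

theorem sum_chiSum_mul_chiSum {m : ℕ} (hm : m % 2 = 1) :
    ∑ p ∈ (Finset.HasAntidiagonal.antidiagonal (2 * m)).filter (fun p => p.1 % 2 = 1),
      chiSum p.1 * chiSum p.2 = ∑ d ∈ m.divisors, (d : ℤ) := by
  rw [← sum_oddSolutions hm]
  have h1 : ∀ p : ℕ × ℕ, chiSum p.1 * chiSum p.2 =
      ∑ q ∈ p.1.divisorsAntidiagonal ×ˢ p.2.divisorsAntidiagonal,
        ZMod.χ₄ (q.1.1 : ZMod 4) * ZMod.χ₄ (q.2.1 : ZMod 4) := by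
    intro p
    rw [Finset.sum_product, chiSum, chiSum, Finset.sum_mul_sum]
    rw [Nat.sum_divisorsAntidiagonal (f := fun d _ => ∑ y ∈ p.2.divisorsAntidiagonal,
      ZMod.χ₄ (d : ZMod 4) * ZMod.χ₄ (y.1 : ZMod 4))]
    refine Finset.sum_congr rfl fun d _ => ?_
    rw [Nat.sum_divisorsAntidiagonal (f := fun e _ => ZMod.χ₄ (d : ZMod 4) * ZMod.χ₄ (e : ZMod 4))]
  simp_rw [h1]
  rw [Finset.sum_sigma']
  refine Finset.sum_nbij' (fun q => (q.2.1.1, q.2.1.2, q.2.2.1, q.2.2.2))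
    (fun q => ⟨(q.1 * q.2.1, q.2.2.1 * q.2.2.2), ((q.1, q.2.1), (q.2.2.1, q.2.2.2))⟩) ?_ ?_ ?_ ?_ ?_
  · rintro ⟨⟨a, b⟩, ⟨d, k⟩, ⟨e, l⟩⟩ h
    simp only [Finset.mem_sigma, Finset.mem_filter, Finset.HasAntidiagonal.mem_antidiagonal, Finset.mem_product,
      Nat.mem_divisorsAntidiagonal] at h
    obtain ⟨⟨h1, h2⟩, ⟨rfl, h3⟩, rfl, h4⟩ := h
    rw [mem_oddSolutions]
    have h5 : (e * l) % 2 = 1 := by omega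
    have h2' := Nat.odd_mul.1 (Nat.odd_iff.2 h2)
    have h5' := Nat.odd_mul.1 (Nat.odd_iff.2 h5)
    exact ⟨h1, Nat.odd_iff.1 h2'.1, Nat.odd_iff.1 h2'.2, Nat.odd_iff.1 h5'.1, Nat.odd_iff.1 h5'.2⟩
  · rintro ⟨d, k, e, l⟩ h
    rw [mem_oddSolutions] at h
    obtain ⟨h, h1, h2, h3, h4⟩ := h
    simp only [Finset.mem_sigma, Finset.mem_filter, Finset.HasAntidiagonal.mem_antidiagonal, Finset.mem_product,
      Nat.mem_divisorsAntidiagonal]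
    refine ⟨⟨h, Nat.odd_iff.1 ((Nat.odd_iff.2 h1).mul (Nat.odd_iff.2 h2))⟩, ⟨trivial, ?_⟩, trivial, ?_⟩
    · exact mul_ne_zero (by omega) (by omega)
    · exact mul_ne_zero (by omega) (by omega)
  · rintro ⟨⟨a, b⟩, ⟨d, k⟩, ⟨e, l⟩⟩ h
    simp only [Finset.mem_sigma, Finset.mem_filter, Finset.HasAntidiagonal.mem_antidiagonal, Finset.mem_product,
      Nat.mem_divisorsAntidiagonal] at h
    obtain ⟨⟨h1, h2⟩, ⟨rfl, h3⟩, rfl, h4⟩ := h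
    rfl
  · rintro ⟨d, k, e, l⟩ h; rfl
  · rintro ⟨⟨a, b⟩, ⟨d, k⟩, ⟨e, l⟩⟩ h; rfl

/-! ### Jacobi's four squares theorem -/

open Finset.HasAntidiagonal (antidiagonal)

/-- The number of representations of `n` as a sum of four squares. -/
noncomputable def rFour (n : ℕ) : ℕ := ∑ p ∈ antidiagonal n, rTwo p.1 * rTwo p.2

theorem sum_antidiagonal_even (n : ℕ) :
    ∑ p ∈ (antidiagonal (2 * n)).filter (fun p => p.1 % 2 = 0), rTwo p.1 * rTwo p.2 = rFour n := by
  rw [rFour]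
  refine Finset.sum_nbij' (fun p => (p.1 / 2, p.2 / 2)) (fun p => (2 * p.1, 2 * p.2)) ?_ ?_ ?_ ?_ ?_
  · rintro ⟨a, b⟩ h
    simp only [Finset.mem_filter, Finset.HasAntidiagonal.mem_antidiagonal] at h ⊢
    omega
  · rintro ⟨a, b⟩ h
    simp only [Finset.mem_filter, Finset.HasAntidiagonal.mem_antidiagonal] at h ⊢
    omega
  · rintro ⟨a, b⟩ h
    simp only [Finset.mem_filter, Finset.HasAntidiagonal.mem_antidiagonal] at h
    change (2 * (a / 2), 2 * (b / 2)) = (a, b)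
    rw [show 2 * (a / 2) = a by omega, show 2 * (b / 2) = b by omega]
  · rintro ⟨a, b⟩ h
    change (2 * a / 2, 2 * b / 2) = (a, b)
    rw [show 2 * a / 2 = a by omega, show 2 * b / 2 = b by omega]
  · rintro ⟨a, b⟩ h
    simp only [Finset.mem_filter, Finset.HasAntidiagonal.mem_antidiagonal] at h
    change rTwo a * rTwo b = rTwo (a / 2) * rTwo (b / 2)
    rw [← rTwo_two_mul (a / 2), ← rTwo_two_mul (b / 2), show 2 * (a / 2) = a by omega,
      show 2 * (b / 2) = b by omega]

theorem int_sq_emod_four (x : ℤ) : x ^ 2 % 4 = x % 2 := by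
  rcases Int.even_or_odd' x with ⟨c, rfl | rfl⟩
  · rw [show (2 * c) ^ 2 = 4 * c ^ 2 by ring]; omega
  · rw [show (2 * c + 1) ^ 2 = 4 * (c ^ 2 + c) + 1 by ring]; omega

theorem rTwo_eq_zero {n : ℕ} (h : n % 4 = 3) : rTwo n = 0 := by
  rw [rTwo, Finset.card_eq_zero, Finset.eq_empty_iff_forall_notMem]
  intro z hz
  rw [mem_normSet, gaussianInt_norm_eq] at hz
  have := int_sq_emod_four z.re
  have := int_sq_emod_four z.im
  omega

/-- If two odd numbers add up to a multiple of 4, one of them is 3 modulo 4 and is not a sum of two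
squares. Only pairs of even norms contribute. -/
theorem rFour_four_mul (n : ℕ) : rFour (4 * n) = rFour (2 * n) := by
  have h := Finset.sum_filter_add_sum_filter_not (antidiagonal (4 * n)) (fun p => p.1 % 2 = 0)
    (fun p => rTwo p.1 * rTwo p.2)
  rw [show 4 * n = 2 * (2 * n) by ring, sum_antidiagonal_even] at h
  rw [show 4 * n = 2 * (2 * n) by ring, rFour, ← h, add_eq_left]
  refine Finset.sum_eq_zero fun p hp => ?_
  simp only [Finset.mem_filter, Finset.HasAntidiagonal.mem_antidiagonal] at hp
  rcases (by omega : p.1 % 4 = 3 ∨ p.2 % 4 = 3) with h | h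
  · rw [rTwo_eq_zero h, zero_mul]
  · rw [rTwo_eq_zero h, mul_zero]

theorem sum_antidiagonal_odd {m : ℕ} (hm : m % 2 = 1) :
    ∑ p ∈ (antidiagonal (2 * m)).filter (fun p => ¬ p.1 % 2 = 0), rTwo p.1 * rTwo p.2 =
      16 * ∑ d ∈ m.divisors, d := by
  zify
  rw [← sum_chiSum_mul_chiSum hm, Finset.mul_sum, Finset.filter_congr (q := fun p => p.1 % 2 = 1)
    (fun p _ => by omega)]
  refine Finset.sum_congr rfl fun p hp => ?_
  simp only [Finset.mem_filter, Finset.HasAntidiagonal.mem_antidiagonal] at hp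
  rw [rTwo_eq (by omega), rTwo_eq (by omega)]
  ring

/-- Pairs of Gaussian integers with given pairs of norms. -/
noncomputable def normPairs (A : Finset (ℕ × ℕ)) : Finset (GaussianInt × GaussianInt) :=
  A.biUnion fun p => normSet p.1 ×ˢ normSet p.2

theorem mem_normPairs {A : Finset (ℕ × ℕ)} {q : GaussianInt × GaussianInt} :
    q ∈ normPairs A ↔ ∃ p ∈ A, q.1.norm = (p.1 : ℕ) ∧ q.2.norm = (p.2 : ℕ) := by
  simp [normPairs, Finset.mem_biUnion]

theorem card_normPairs (A : Finset (ℕ × ℕ)) :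
    (normPairs A).card = ∑ p ∈ A, rTwo p.1 * rTwo p.2 := by
  rw [normPairs, Finset.card_biUnion]
  · simp [rTwo]
  · intro p _ q _ hpq
    rw [Function.onFun, Finset.disjoint_left]
    rintro ⟨z, w⟩ h1 h2
    simp only [Finset.mem_product, mem_normSet] at h1 h2
    apply hpq
    ext
    · exact_mod_cast h1.1.symm.trans h2.1
    · exact_mod_cast h1.2.symm.trans h2.2

theorem mem_normPairs_antidiagonal {n : ℕ} {P : ℕ → Prop} [DecidablePred P]
    {q : GaussianInt × GaussianInt} :
    q ∈ normPairs ((antidiagonal n).filter fun p => P p.1) ↔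
      q.1.re ^ 2 + q.1.im ^ 2 + (q.2.re ^ 2 + q.2.im ^ 2) = n ∧
        P (q.1.re ^ 2 + q.1.im ^ 2).toNat := by
  rw [mem_normPairs]
  simp only [gaussianInt_norm_eq, Finset.mem_filter, Finset.HasAntidiagonal.mem_antidiagonal]
  constructor
  · rintro ⟨p, ⟨h1, h2⟩, h3, h4⟩
    rw [h3, h4, Int.toNat_natCast]
    exact ⟨by exact_mod_cast h1, h2⟩
  · rintro ⟨h1, h2⟩
    have h3 : 0 ≤ q.1.re ^ 2 + q.1.im ^ 2 := by positivity
    have h4 : 0 ≤ q.2.re ^ 2 + q.2.im ^ 2 := by positivity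
    refine ⟨((q.1.re ^ 2 + q.1.im ^ 2).toNat, (q.2.re ^ 2 + q.2.im ^ 2).toNat), ⟨?_, h2⟩, ?_, ?_⟩
    · simp only; omega
    · simp only; omega
    · simp only; omega

/-- In a representation of `2m ≡ 2 (mod 4)` by four squares exactly two coordinates are odd. So
among the three ways to split the coordinates into two pairs, exactly one has pairs of even norm.
Permuting coordinates shows that the three classes have equal size, and the class of the given
splitting has size `rFour m`. -/
theorem rFour_two_mul {m : ℕ} (hm : m % 2 = 1) : rFour (2 * m) = 3 * rFour m := by
  have h := Finset.sum_filter_add_sum_filter_not (antidiagonal (2 * m)) (fun p => p.1 % 2 = 0)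
    (fun p => rTwo p.1 * rTwo p.2)
  rw [rFour, ← h]
  have hE := sum_antidiagonal_even m
  rw [hE]
  rw [← card_normPairs] at hE ⊢
  have hsplit := Finset.card_filter_add_card_filter_not
    (s := normPairs ((antidiagonal (2 * m)).filter fun p => ¬ p.1 % 2 = 0))
    (fun q : GaussianInt × GaussianInt => (q.1.re + q.2.re) % 2 = 0)
  have e1 : (Finset.filter (fun q : GaussianInt × GaussianInt => (q.1.re + q.2.re) % 2 = 0)
      (normPairs ((antidiagonal (2 * m)).filter fun p => ¬ p.1 % 2 = 0))).card = rFour m := by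
    rw [← hE]
    refine Finset.card_nbij' (fun q => (⟨q.1.re, q.2.re⟩, ⟨q.1.im, q.2.im⟩))
      (fun q => (⟨q.1.re, q.2.re⟩, ⟨q.1.im, q.2.im⟩)) ?_ ?_ ?_ ?_
    · rintro ⟨⟨x, y⟩, ⟨z, w⟩⟩ h
      have := int_sq_emod_four x
      have := int_sq_emod_four y
      have := int_sq_emod_four z
      have := int_sq_emod_four w
      have := sq_nonneg x
      have := sq_nonneg y
      have := sq_nonneg z
      have := sq_nonneg w
      simp only [Finset.coe_filter, Set.mem_ofPred_eq, Finset.mem_coe,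
        mem_normPairs_antidiagonal (P := fun a => ¬ a % 2 = 0),
        mem_normPairs_antidiagonal (P := fun a => a % 2 = 0)] at h ⊢
      omega
    · rintro ⟨⟨x, y⟩, ⟨z, w⟩⟩ h
      have := int_sq_emod_four x
      have := int_sq_emod_four y
      have := int_sq_emod_four z
      have := int_sq_emod_four w
      have := sq_nonneg x
      have := sq_nonneg y
      have := sq_nonneg z
      have := sq_nonneg w
      simp only [Finset.coe_filter, Set.mem_ofPred_eq, Finset.mem_coe,
        mem_normPairs_antidiagonal (P := fun a => ¬ a % 2 = 0),
        mem_normPairs_antidiagonal (P := fun a => a % 2 = 0)] at h ⊢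
      omega
    · rintro ⟨⟨x, y⟩, ⟨z, w⟩⟩ h; rfl
    · rintro ⟨⟨x, y⟩, ⟨z, w⟩⟩ h; rfl
  have e2 : (Finset.filter (fun q : GaussianInt × GaussianInt => ¬ (q.1.re + q.2.re) % 2 = 0)
      (normPairs ((antidiagonal (2 * m)).filter fun p => ¬ p.1 % 2 = 0))).card = rFour m := by
    rw [← hE]
    refine Finset.card_nbij' (fun q => (⟨q.1.re, q.2.im⟩, ⟨q.1.im, q.2.re⟩))
      (fun q => (⟨q.1.re, q.2.re⟩, ⟨q.2.im, q.1.im⟩)) ?_ ?_ ?_ ?_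
    · rintro ⟨⟨x, y⟩, ⟨z, w⟩⟩ h
      have := int_sq_emod_four x
      have := int_sq_emod_four y
      have := int_sq_emod_four z
      have := int_sq_emod_four w
      have := sq_nonneg x
      have := sq_nonneg y
      have := sq_nonneg z
      have := sq_nonneg w
      simp only [Finset.coe_filter, Set.mem_ofPred_eq, Finset.mem_coe,
        mem_normPairs_antidiagonal (P := fun a => ¬ a % 2 = 0),
        mem_normPairs_antidiagonal (P := fun a => a % 2 = 0)] at h ⊢
      omega
    · rintro ⟨⟨x, y⟩, ⟨z, w⟩⟩ h
      have := int_sq_emod_four x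
      have := int_sq_emod_four y
      have := int_sq_emod_four z
      have := int_sq_emod_four w
      have := sq_nonneg x
      have := sq_nonneg y
      have := sq_nonneg z
      have := sq_nonneg w
      simp only [Finset.coe_filter, Set.mem_ofPred_eq, Finset.mem_coe,
        mem_normPairs_antidiagonal (P := fun a => ¬ a % 2 = 0),
        mem_normPairs_antidiagonal (P := fun a => a % 2 = 0)] at h ⊢
      omega
    · rintro ⟨⟨x, y⟩, ⟨z, w⟩⟩ h; rfl
    · rintro ⟨⟨x, y⟩, ⟨z, w⟩⟩ h; rfl
  omega

/-- The representations of `2m` number `3 rFour m`. Those with even norms number `rFour m` and those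
with odd norms number `16 σ(m)` by the convolution identity, so `2 rFour m = 16 σ(m)`. -/
theorem rFour_odd {m : ℕ} (hm : m % 2 = 1) : rFour m = 8 * ∑ d ∈ m.divisors, d := by
  have h := Finset.sum_filter_add_sum_filter_not (antidiagonal (2 * m)) (fun p => p.1 % 2 = 0)
    (fun p => rTwo p.1 * rTwo p.2)
  rw [sum_antidiagonal_even, sum_antidiagonal_odd hm] at h
  change _ = rFour (2 * m) at h
  rw [rFour_two_mul hm] at h
  omega

theorem rFour_two_pow_mul (j : ℕ) {m : ℕ} (hm : m % 2 = 1) :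
    rFour (2 ^ (j + 1) * m) = 24 * ∑ d ∈ m.divisors, d := by
  induction j with
  | zero => rw [zero_add, pow_one, rFour_two_mul hm, rFour_odd hm]; ring
  | succ j ih =>
    rw [← ih, show 2 ^ (j + 1 + 1) * m = 4 * (2 ^ j * m) by ring, rFour_four_mul]
    congr 1; ring

theorem sum_divisors_two_pow_mul (j : ℕ) {m : ℕ} (hm : m % 2 = 1) :
    ∑ d ∈ (2 ^ j * m).divisors, (d : ℤ) = (2 ^ (j + 1) - 1) * ∑ d ∈ m.divisors, (d : ℤ) := by
  have hc : Nat.Coprime (2 ^ j) m := Nat.Coprime.pow_left _ (Nat.coprime_two_left.2 (Nat.odd_iff.2 hm))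
  have h1 := hc.sum_divisors_mul
  have h2 : ∑ d ∈ (2 ^ j : ℕ).divisors, (d : ℤ) = 2 ^ (j + 1) - 1 := by
    rw [Nat.sum_divisors_prime_pow Nat.prime_two]
    push_cast
    have := geom_sum_mul (2 : ℤ) (j + 1)
    linarith
  rw [← h2]
  have := congrArg (Nat.cast : ℕ → ℤ) h1
  push_cast at this
  exact this

/-- **Jacobi's four squares theorem**. -/
theorem rFour_eq {n : ℕ} (hn : n ≠ 0) : (rFour n : ℤ) = 8 * ∑ d ∈ n.divisors, (d : ℤ) -
    if 4 ∣ n then 32 * ∑ d ∈ (n / 4).divisors, (d : ℤ) else 0 := by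
  obtain ⟨j, m, hm, rfl⟩ := Nat.exists_eq_two_pow_mul_odd hn
  have hm' := Nat.odd_iff.1 hm
  rcases j with _ | _ | j
  · rw [if_neg (by omega)]
    simp [rFour_odd hm']
  · rw [if_neg (by omega), rFour_two_pow_mul _ hm', sum_divisors_two_pow_mul _ hm']
    push_cast; ring
  · have : 2 ^ (j + 1 + 1) * m = 4 * (2 ^ j * m) := by ring
    rw [if_pos (Dvd.intro _ this.symm), this, Nat.mul_div_cancel_left _ (by norm_num), ← this,
      rFour_two_pow_mul _ hm', sum_divisors_two_pow_mul _ hm', sum_divisors_two_pow_mul _ hm']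
    push_cast; ring

/-! ### Lattice points, unit cubes and the midpoint rule -/

open MeasureTheory

section Lattice

variable {ι : Type*}

/-- The vector of `ι → ℝ` underlying an integer vector. -/
def toReal (k : ι → ℤ) : ι → ℝ := fun i => k i

/-- The integer vector nearest to a real vector. -/
noncomputable def nearest (x : ι → ℝ) : ι → ℤ := fun i => ⌊x i + 1 / 2⌋

theorem abs_sub_nearest (x : ι → ℝ) (i : ι) : |(x - toReal (nearest x)) i| ≤ 1 / 2 := by
  have h1 := Int.floor_le (x i + 1 / 2)
  have h2 := Int.lt_floor_add_one (x i + 1 / 2)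
  simp only [Pi.sub_apply, toReal, nearest]
  rw [abs_le]
  constructor <;> linarith

theorem nearest_preimage (k : ι → ℤ) : nearest ⁻¹' {k} =
    Set.pi Set.univ fun i => Set.Ico ((k i : ℝ) - 1 / 2) (k i + 1 / 2) := by
  ext x
  simp only [Set.mem_preimage, Set.mem_singleton_iff, Set.mem_pi, Set.mem_univ, true_imp_iff,
    Set.mem_Ico, funext_iff, nearest, Int.floor_eq_iff]
  refine forall_congr' fun i => ?_
  constructor <;> rintro ⟨h1, h2⟩ <;> constructor <;> linarith

variable [Fintype ι]

/-- The Euclidean norm of a vector of `ι → ℝ`. -/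
noncomputable def euc (x : ι → ℝ) : ℝ := ‖(WithLp.toLp 2 x : EuclideanSpace ℝ ι)‖

theorem euc_sq (x : ι → ℝ) : euc x ^ 2 = ∑ i, x i ^ 2 := by
  rw [euc, EuclideanSpace.norm_sq_eq]
  simp

theorem euc_nonneg (x : ι → ℝ) : 0 ≤ euc x := norm_nonneg _

theorem euc_add_le (x y : ι → ℝ) : euc (x + y) ≤ euc x + euc y := by
  rw [euc, WithLp.toLp_add]; exact norm_add_le _ _

theorem euc_sub_le (x y : ι → ℝ) : euc (x - y) ≤ euc x + euc y := by
  rw [euc, WithLp.toLp_sub]; exact norm_sub_le _ _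

theorem euc_neg (x : ι → ℝ) : euc (-x) = euc x := by
  rw [euc, WithLp.toLp_neg, norm_neg, euc]

theorem continuous_euc : Continuous (euc : (ι → ℝ) → ℝ) :=
  continuous_norm.comp (PiLp.continuous_toLp 2 _)

theorem abs_le_euc (x : ι → ℝ) (i : ι) : |x i| ≤ euc x := by
  have := PiLp.norm_apply_le (WithLp.toLp 2 x : EuclideanSpace ℝ ι) i
  simpa [euc] using this

theorem euc_le_of_abs_le_half {u : ι → ℝ} (hu : ∀ i, |u i| ≤ 1 / 2) :
    euc u ≤ Fintype.card ι := by
  have h1 : euc u ^ 2 ≤ (Fintype.card ι : ℝ) ^ 2 := by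
    rw [euc_sq]
    calc ∑ i, u i ^ 2 ≤ ∑ _i : ι, (1 : ℝ) := by
          refine Finset.sum_le_sum fun i _ => ?_
          rw [← sq_abs]
          nlinarith [hu i, abs_nonneg (u i)]
      _ = Fintype.card ι := by simp
      _ ≤ _ := by
          have : (Fintype.card ι : ℝ) ≤ Fintype.card ι * Fintype.card ι := by
            exact_mod_cast Nat.le_mul_self _
          linarith [sq (Fintype.card ι : ℝ)]
  exact (pow_le_pow_iff_left₀ (euc_nonneg u) (Nat.cast_nonneg _) two_ne_zero).1 h1

theorem nearest_preimage_ae_eq (k : ι → ℤ) : (nearest ⁻¹' {k} : Set (ι → ℝ)) =ᵐ[volume]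
    Set.Icc (fun i => (k i : ℝ) - 1 / 2) (fun i => (k i : ℝ) + 1 / 2) := by
  rw [nearest_preimage]
  exact Measure.univ_pi_Ico_ae_eq_Icc

theorem measurableSet_nearest_preimage (k : ι → ℤ) :
    MeasurableSet (nearest ⁻¹' {k} : Set (ι → ℝ)) := by
  rw [nearest_preimage]
  exact MeasurableSet.univ_pi fun i => measurableSet_Ico

theorem volume_nearest_preimage (k : ι → ℤ) :
    volume (nearest ⁻¹' {k} : Set (ι → ℝ)) = 1 := by
  rw [nearest_preimage, volume_pi_pi]
  simp only [Real.volume_Ico]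
  rw [Finset.prod_eq_one]
  intro i _
  rw [← ENNReal.ofReal_one]; congr 1; ring

theorem volume_nearest_preimage_finset (S : Finset (ι → ℤ)) :
    volume (nearest ⁻¹' (S : Set (ι → ℤ)) : Set (ι → ℝ)) = S.card := by
  have : (nearest ⁻¹' (S : Set (ι → ℤ)) : Set (ι → ℝ)) = ⋃ k ∈ S, nearest ⁻¹' {k} := by
    ext x; simp
  rw [this, measure_biUnion_finset]
  · simp [volume_nearest_preimage]
  · intro k _ l _ hkl
    rw [Function.onFun, Set.disjoint_left]
    intro x hx hx'
    exact hkl (hx.symm.trans hx')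
  · exact fun k _ => measurableSet_nearest_preimage k

theorem card_le_volume {S : Finset (ι → ℤ)} {T : Set (ι → ℝ)} (hT : volume T ≠ ⊤)
    (h : ∀ x, nearest x ∈ S → x ∈ T) : (S.card : ℝ) ≤ volume.real T := by
  have h1 : volume (nearest ⁻¹' (S : Set (ι → ℤ)) : Set (ι → ℝ)) ≤ volume T :=
    measure_mono fun x hx => h x hx
  rw [volume_nearest_preimage_finset] at h1
  have := ENNReal.toReal_mono hT h1
  simpa [measureReal_def] using this

/-- **Midpoint rule** on the lattice `ℤ^ι`. -/
theorem abs_sum_sub_integral_le {f : (ι → ℝ) → ℝ} (hf : Continuous f) {S : Finset (ι → ℤ)}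
    (hS : ∀ x, nearest x ∉ S → f x = 0) {B : (ι → ℤ) → ℝ}
    (hB : ∀ k ∈ S, ∀ u : ι → ℝ, (∀ i, |u i| ≤ 1 / 2) →
      |f (toReal k + u) + f (toReal k - u) - 2 * f (toReal k)| ≤ B k) :
    |∑ k ∈ S, f (toReal k) - ∫ x, f x| ≤ ∑ k ∈ S, B k := by
  have hmeas : ∀ k ∈ S, MeasurableSet (nearest ⁻¹' {k} : Set (ι → ℝ)) :=
    fun k _ => measurableSet_nearest_preimage k
  have hint : ∀ k : ι → ℤ, IntegrableOn f (Set.Icc (fun i => (k i : ℝ) - 1 / 2)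
      (fun i => (k i : ℝ) + 1 / 2) : Set (ι → ℝ)) := fun k =>
    hf.continuousOn.integrableOn_compact isCompact_Icc
  have h1 : ∫ x, f x = ∑ k ∈ S, ∫ x in nearest ⁻¹' {k}, f x := by
    rw [← integral_biUnion_finset S hmeas]
    · refine (setIntegral_eq_integral_of_forall_compl_eq_zero fun x hx => hS x fun h => hx ?_).symm
      exact Set.mem_biUnion h rfl
    · intro k _ l _ hkl
      rw [Function.onFun, Set.disjoint_left]
      intro x hx hx'
      exact hkl (hx.symm.trans hx')
    · exact fun k _ => (hint k).congr_set_ae (nearest_preimage_ae_eq k)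
  rw [h1, ← Finset.sum_sub_distrib]
  refine (Finset.abs_sum_le_sum_abs _ _).trans (Finset.sum_le_sum fun k hk => ?_)
  set Q : Set (ι → ℝ) := Set.Icc (fun _ => -(1 / 2 : ℝ)) (fun _ => (1 / 2 : ℝ)) with hQ
  have hQ1 : volume Q = 1 := by
    rw [hQ, Real.volume_Icc_pi, Finset.prod_eq_one]
    intro i _
    rw [← ENNReal.ofReal_one]; congr 1; ring
  have hQr : volume.real Q = 1 := by rw [measureReal_def, hQ1]; rfl
  have hQm : MeasurableSet Q := measurableSet_Icc
  have hQc : IsCompact Q := isCompact_Icc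
  have e1 : ∫ x in nearest ⁻¹' {k}, f x = ∫ u in Q, f (toReal k + u) := by
    rw [setIntegral_congr_set (nearest_preimage_ae_eq k)]
    have := (measurePreserving_add_left (volume : Measure (ι → ℝ)) (toReal k)).setIntegral_preimage_emb
      (measurableEmbedding_addLeft (toReal k)) f (Set.Icc (fun i => (k i : ℝ) - 1 / 2)
      (fun i => (k i : ℝ) + 1 / 2))
    rw [← this]
    congr 2
    ext u
    simp only [Set.mem_preimage, Set.mem_Icc, Pi.le_def, Pi.add_apply, toReal, hQ]
    constructor <;> rintro ⟨h1, h2⟩ <;> constructor <;> intro i <;> linarith [h1 i, h2 i]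
  have e2 : ∫ u in Q, f (toReal k + u) = ∫ u in Q, f (toReal k - u) := by
    have := (Measure.measurePreserving_neg (volume : Measure (ι → ℝ))).setIntegral_preimage_emb
      (MeasurableEquiv.neg (ι → ℝ)).measurableEmbedding (fun u => f (toReal k + u)) Q
    rw [← this]
    have hQn : Neg.neg ⁻¹' Q = Q := by
      ext u
      simp only [Set.mem_preimage, Set.mem_Icc, Pi.le_def, Pi.neg_apply, hQ]
      constructor <;> rintro ⟨h1, h2⟩ <;> constructor <;> intro i <;> linarith [h1 i, h2 i]
    rw [hQn]
    simp only [← sub_eq_add_neg]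
  have i1 : IntegrableOn (fun u => f (toReal k + u)) Q :=
    (hf.comp (continuous_const.add continuous_id)).continuousOn.integrableOn_compact hQc
  have i2 : IntegrableOn (fun u => f (toReal k - u)) Q :=
    (hf.comp (continuous_const.sub continuous_id)).continuousOn.integrableOn_compact hQc
  -- The unit cube is symmetric about its centre, so averaging over `u` and `-u` removes the first
  -- order term and leaves a second difference.
  have e3 : ∫ u in Q, (f (toReal k + u) + f (toReal k - u) - 2 * f (toReal k)) =
      2 * ((∫ x in nearest ⁻¹' {k}, f x) - f (toReal k)) := by
    have i3 : IntegrableOn (fun u => f (toReal k + u) + f (toReal k - u)) Q := i1.add i2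
    have i4 : IntegrableOn (fun _ : ι → ℝ => 2 * f (toReal k)) Q :=
      continuous_const.continuousOn.integrableOn_compact hQc
    rw [integral_sub i3 i4, integral_add i1 i2, ← e2, ← e1]
    simp [hQr]
    ring
  have e4 := norm_setIntegral_le_of_norm_le_const (μ := volume) (s := Q) (by rw [hQ1]; simp)
    (f := fun u => f (toReal k + u) + f (toReal k - u) - 2 * f (toReal k)) (C := B k)
    (fun u hu => hB k hk u fun i => abs_le.2 ⟨hu.1 i, hu.2 i⟩)
  rw [e3, hQr, mul_one, Real.norm_eq_abs, abs_mul, abs_two, abs_sub_comm] at e4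
  linarith [abs_nonneg (f (toReal k) - ∫ x in nearest ⁻¹' {k}, f x)]

/-- The lattice points in the ball of radius `r`. -/
theorem finite_lattice_ball (r : ℝ) : {k : ι → ℤ | euc (toReal k) ≤ r}.Finite := by
  refine (Set.Finite.pi fun _ : ι => Set.finite_Icc (-⌈r⌉) ⌈r⌉).subset fun k hk i _ => ?_
  have h1 : |(k i : ℝ)| ≤ r := (abs_le_euc (toReal k) i).trans hk
  have h2 : ((|k i| : ℤ) : ℝ) ≤ (⌈r⌉ : ℤ) := by push_cast; exact h1.trans (Int.le_ceil r)
  exact abs_le.1 (by exact_mod_cast h2)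

variable (ι) in
/-- The lattice points in the ball of radius `r`. -/
noncomputable def latticeBall (r : ℝ) : Finset (ι → ℤ) := (finite_lattice_ball r).toFinset

@[simp] theorem mem_latticeBall {r : ℝ} {k : ι → ℤ} :
    k ∈ latticeBall ι r ↔ euc (toReal k) ≤ r := by simp [latticeBall]

variable (ι) in
/-- The volume of the unit ball of `ℝ^ι`. -/
noncomputable def unitBallVolume : ℝ := volume.real {x : ι → ℝ | euc x ≤ 1}

theorem euc_le_eq_preimage (r : ℝ) : {x : ι → ℝ | euc x ≤ r} =
    WithLp.toLp 2 ⁻¹' Metric.closedBall (0 : EuclideanSpace ℝ ι) r := by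
  ext x; simp [euc]

theorem volume_euc_le (r : ℝ) : volume {x : ι → ℝ | euc x ≤ r} =
    volume (Metric.closedBall (0 : EuclideanSpace ℝ ι) r) := by
  rw [euc_le_eq_preimage]
  exact (PiLp.volume_preserving_toLp ι).measure_preimage measurableSet_closedBall.nullMeasurableSet

theorem volume_euc_le_ne_top (r : ℝ) : volume {x : ι → ℝ | euc x ≤ r} ≠ ⊤ := by
  rw [volume_euc_le]; exact measure_closedBall_lt_top.ne

theorem volumeReal_euc_le {r : ℝ} (hr : 0 ≤ r) : volume.real {x : ι → ℝ | euc x ≤ r} =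
    unitBallVolume ι * r ^ Fintype.card ι := by
  rw [unitBallVolume, measureReal_def, measureReal_def, volume_euc_le, volume_euc_le,
    Measure.addHaar_closedBall' _ _ hr, ENNReal.toReal_mul,
    ENNReal.toReal_ofReal (by positivity), finrank_euclideanSpace, mul_comm]

theorem unitBallVolume_nonneg : 0 ≤ unitBallVolume ι := measureReal_nonneg

theorem euc_le_add_of_nearest (x : ι → ℝ) :
    euc x ≤ euc (toReal (nearest x)) + Fintype.card ι := by
  have h := euc_add_le (toReal (nearest x)) (x - toReal (nearest x))
  rw [add_sub_cancel] at h
  linarith [euc_le_of_abs_le_half (abs_sub_nearest x)]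

theorem euc_nearest_le_add (x : ι → ℝ) :
    euc (toReal (nearest x)) ≤ euc x + Fintype.card ι := by
  have h := euc_sub_le x (x - toReal (nearest x))
  rw [sub_sub_cancel] at h
  linarith [euc_le_of_abs_le_half (abs_sub_nearest x)]

theorem card_latticeBall_le {r : ℝ} (hr : 0 ≤ r) : ((latticeBall ι r).card : ℝ) ≤
    unitBallVolume ι * (r + Fintype.card ι) ^ Fintype.card ι := by
  rw [← volumeReal_euc_le (by positivity)]
  refine card_le_volume (volume_euc_le_ne_top _) fun x hx => ?_
  rw [mem_latticeBall] at hx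
  exact (euc_le_add_of_nearest x).trans (by linarith)

end Lattice

/-! ### Riesz means of order one and two of the lattice points in a ball -/

section Midpoint

variable {ι : Type*} [Fintype ι]

theorem euc_parallelogram (x u : ι → ℝ) :
    euc (x + u) ^ 2 + euc (x - u) ^ 2 = 2 * euc x ^ 2 + 2 * euc u ^ 2 := by
  simp only [euc_sq, ← Finset.sum_add_distrib, Finset.mul_sum, Pi.add_apply, Pi.sub_apply]
  exact Finset.sum_congr rfl fun i _ => by ring

/-- A mean value estimate multiplied through by `a`, which avoids the exponent `n - 1` and so covers
dimension 0. The annulus bound below carries a factor `r` for the same reason. -/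
theorem mul_pow_sub_pow_le {a b : ℝ} (hb : 0 ≤ b) (hab : b ≤ a) (n : ℕ) :
    a * (a ^ n - b ^ n) ≤ n * (a - b) * a ^ n := by
  induction n with
  | zero => simp
  | succ n ih =>
    have ha : 0 ≤ a := hb.trans hab
    have h1 : b ^ n ≤ a ^ n := pow_le_pow_left₀ hb hab n
    have h2 := mul_le_mul_of_nonneg_left ih ha
    have h3 := mul_le_mul_of_nonneg_left h1 (mul_nonneg ha (sub_nonneg.2 hab))
    push_cast
    rw [pow_succ, pow_succ]
    linarith

theorem card_latticeBall_le_mul_pow : ∃ C : ℝ, 0 ≤ C ∧ ∀ r : ℝ, 1 ≤ r →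
    ((latticeBall ι (r + Fintype.card ι)).card : ℝ) ≤ C * r ^ Fintype.card ι := by
  set n := Fintype.card ι
  refine ⟨unitBallVolume ι * (1 + n + n) ^ n, mul_nonneg unitBallVolume_nonneg (by positivity),
    fun r hr => ?_⟩
  refine (card_latticeBall_le (by positivity)).trans ?_
  rw [mul_assoc, ← mul_pow]
  refine mul_le_mul_of_nonneg_left (pow_le_pow_left₀ (by positivity) ?_ _) unitBallVolume_nonneg
  have : (0 : ℝ) ≤ n := Nat.cast_nonneg _
  change r + n + n ≤ _
  nlinarith

/-- The unit cubes around these points lie in the shell between the radii `r - 2n` and `r + 2n`: one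
`n` allows for the annulus and one for the cubes. -/
theorem mul_card_annulus_le : ∃ C : ℝ, 0 ≤ C ∧ ∀ r : ℝ, 1 ≤ r →
    r * (((latticeBall ι (r + Fintype.card ι)).filter
      fun k => ¬ euc (toReal k) ≤ r - Fintype.card ι).card : ℝ) ≤ C * r ^ Fintype.card ι := by
  set n := Fintype.card ι with hn
  refine ⟨unitBallVolume ι * (n * (4 * n) * (1 + 2 * n) ^ n),
    mul_nonneg unitBallVolume_nonneg (by positivity), fun r hr => ?_⟩
  have hn0 : (0 : ℝ) ≤ n := Nat.cast_nonneg _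
  set a : ℝ := r + 2 * n with ha
  set b : ℝ := max (r - 2 * n) 0 with hb
  have hb0 : 0 ≤ b := le_max_right _ _
  have hba : b ≤ a := max_le (by linarith) (by linarith)
  have hab : a - b ≤ 4 * n := by have := le_max_left (r - 2 * n) 0; linarith
  have h1 : (((latticeBall ι (r + n)).filter fun k => ¬ euc (toReal k) ≤ r - n).card : ℝ) ≤
      volume.real ({x : ι → ℝ | euc x ≤ a} \ {x : ι → ℝ | euc x < b}) := by
    refine card_le_volume (ne_top_of_le_ne_top (volume_euc_le_ne_top a)
      (measure_mono Set.sdiff_subset)) fun x hx => ?_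
    rw [Finset.mem_filter, mem_latticeBall, not_le] at hx
    have h2 := euc_le_add_of_nearest x
    have h3 := euc_nearest_le_add x
    rw [← hn] at h2 h3
    refine ⟨show euc x ≤ a by linarith, fun h4 => ?_⟩
    have h4 : euc x < b := h4
    rcases max_cases (r - 2 * n) (0 : ℝ) with ⟨h5, -⟩ | ⟨h5, -⟩
    · linarith
    · linarith [euc_nonneg x]
  have hlt : volume.real {x : ι → ℝ | euc x < b} = unitBallVolume ι * b ^ n := by
    rw [← volumeReal_euc_le hb0, measureReal_def, measureReal_def]
    congr 1
    rw [volume_euc_le]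
    have : {x : ι → ℝ | euc x < b} =
        WithLp.toLp 2 ⁻¹' Metric.ball (0 : EuclideanSpace ℝ ι) b := by
      ext x; simp [euc]
    rw [this, (PiLp.volume_preserving_toLp ι).measure_preimage
      measurableSet_ball.nullMeasurableSet]
    -- In dimension 0 spheres need not be null sets. There `b = r` is positive, so both sets are the
    -- whole one-point space.
    rcases isEmpty_or_nonempty ι with hι | hι
    · have h0 : n = 0 := Fintype.card_eq_zero
      have hb1 : 0 < b := by
        rw [hb, h0]; exact lt_max_of_lt_left (by push_cast; linarith)
      congr 1
      ext x
      simp [Subsingleton.elim x 0, hb0, hb1]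
    · exact (Measure.addHaar_closedBall_eq_addHaar_ball _ _ _).symm
  have h2 : volume.real ({x : ι → ℝ | euc x ≤ a} \ {x : ι → ℝ | euc x < b}) =
      unitBallVolume ι * (a ^ n - b ^ n) := by
    have hsub : {x : ι → ℝ | euc x < b} ⊆ {x : ι → ℝ | euc x ≤ a} :=
      fun x (hx : euc x < b) => hx.le.trans hba
    rw [measureReal_sdiff hsub (measurableSet_lt continuous_euc.measurable measurable_const)
      (volume_euc_le_ne_top a), hlt, volumeReal_euc_le (by positivity)]
    ring
  rw [h2] at h1
  have h3 := mul_pow_sub_pow_le hb0 hba n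
  have h4 : b ^ n ≤ a ^ n := pow_le_pow_left₀ hb0 hba n
  have h5 : a ^ n ≤ ((1 + 2 * n) * r) ^ n := pow_le_pow_left₀ (by positivity) (by nlinarith) _
  have hV := unitBallVolume_nonneg (ι := ι)
  calc r * _ ≤ r * (unitBallVolume ι * (a ^ n - b ^ n)) := by gcongr
    _ = unitBallVolume ι * (r * (a ^ n - b ^ n)) := by ring
    _ ≤ unitBallVolume ι * (a * (a ^ n - b ^ n)) := by
        gcongr
        linarith
    _ ≤ unitBallVolume ι * (n * (a - b) * a ^ n) := by gcongr
    _ ≤ unitBallVolume ι * (n * (4 * n) * ((1 + 2 * n) * r) ^ n) := by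
        gcongr
    _ = _ := by rw [mul_pow]; ring

theorem abs_euc_sq_sub_le {x u : ι → ℝ} : |euc (x + u) ^ 2 - euc x ^ 2| ≤
    2 * euc x * euc u + euc u ^ 2 := by
  have h1 := euc_add_le x u
  have h2 := euc_sub_le (x + u) u
  rw [add_sub_cancel_right] at h2
  have := euc_nonneg x
  have := euc_nonneg u
  have := euc_nonneg (x + u)
  rw [abs_le]
  constructor <;> nlinarith

/-- The Riesz mean of order one of the number of lattice points in a ball. -/
theorem exists_abs_sum_tent_sub_integral_le : ∃ C : ℝ, ∀ r : ℝ, 1 ≤ r →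
    |∑ k ∈ latticeBall ι r, (r ^ 2 - euc (toReal k) ^ 2) -
      ∫ x : ι → ℝ, max (r ^ 2 - euc x ^ 2) 0| ≤ C * r ^ Fintype.card ι := by
  obtain ⟨C₁, hC₁, h₁⟩ := card_latticeBall_le_mul_pow (ι := ι)
  obtain ⟨C₂, hC₂, h₂⟩ := mul_card_annulus_le (ι := ι)
  set n := Fintype.card ι with hn
  refine ⟨2 * n ^ 2 * C₁ + 12 * n * C₂, fun r hr => ?_⟩
  have hn0 : (0 : ℝ) ≤ n := Nat.cast_nonneg _
  have hcont : Continuous fun x : ι → ℝ => max (r ^ 2 - euc x ^ 2) 0 :=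
    (continuous_const.sub (continuous_euc.pow 2)).max continuous_const
  have hzero : ∀ x : ι → ℝ, r < euc x → max (r ^ 2 - euc x ^ 2) 0 = 0 := fun x hx =>
    max_eq_right (by nlinarith)
  have key := abs_sum_sub_integral_le hcont (S := latticeBall ι (r + n))
    -- Inside, the second difference of the tent is exactly `-2|u|²`. Within distance `n` of the
    -- sphere there is a kink, but the three values themselves are at most `4nr`.
    (B := fun k => 2 * n ^ 2 + if euc (toReal k) ≤ r - n then 0 else 12 * n * r) ?_ ?_
  · have hsum : ∑ k ∈ latticeBall ι r, (r ^ 2 - euc (toReal k) ^ 2) =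
        ∑ k ∈ latticeBall ι (r + n), max (r ^ 2 - euc (toReal k) ^ 2) 0 := by
      have hsub : latticeBall ι r ⊆ latticeBall ι (r + n) := fun k hk => by
        rw [mem_latticeBall] at hk ⊢; linarith
      rw [← Finset.sum_subset hsub fun k _ hk => hzero _ (by simpa using hk)]
      refine Finset.sum_congr rfl fun k hk => (max_eq_left ?_).symm
      rw [mem_latticeBall] at hk
      nlinarith [euc_nonneg (toReal k)]
    rw [hsum]
    refine key.trans ?_
    rw [Finset.sum_add_distrib, Finset.sum_const, nsmul_eq_mul, Finset.sum_ite, Finset.sum_const_zero,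
      zero_add, Finset.sum_const, nsmul_eq_mul]
    have e1 := mul_le_mul_of_nonneg_left (h₁ r hr) (by positivity : (0 : ℝ) ≤ 2 * n ^ 2)
    have e2 := mul_le_mul_of_nonneg_left (h₂ r hr) (by positivity : (0 : ℝ) ≤ 12 * n)
    linarith
  · intro x hx
    refine hzero x ?_
    rw [mem_latticeBall, not_le] at hx
    have := euc_nearest_le_add x
    linarith
  · intro k _ u hu
    have hun := euc_le_of_abs_le_half hu
    rw [← hn] at hun
    have hu0 := euc_nonneg u
    have hk0 := euc_nonneg (toReal k)
    have hpar := euc_parallelogram (toReal k) u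
    have a1 := euc_add_le (toReal k) u
    have a2 := euc_sub_le (toReal k) u
    have a3 := euc_sub_le (toReal k + u) u
    rw [add_sub_cancel_right] at a3
    have a4 := euc_add_le (toReal k - u) u
    rw [sub_add_cancel] at a4
    have a5 := euc_nonneg (toReal k + u)
    have a6 := euc_nonneg (toReal k - u)
    split_ifs with h
    · rw [max_eq_left (by nlinarith), max_eq_left (by nlinarith), max_eq_left (by nlinarith),
        show r ^ 2 - euc (toReal k + u) ^ 2 + (r ^ 2 - euc (toReal k - u) ^ 2) -
          2 * (r ^ 2 - euc (toReal k) ^ 2) = -(2 * euc u ^ 2) by linarith, abs_neg,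
        abs_of_nonneg (by positivity), add_zero]
      nlinarith
    · have hbd : ∀ t : ℝ, 0 ≤ t → r - 2 * n ≤ t → max (r ^ 2 - t ^ 2) 0 ≤ 4 * n * r := by
        intro t ht hrt
        refine max_le ?_ (by positivity)
        rcases le_or_gt r t with h1 | h1
        · have : 0 ≤ 4 * n * r := by positivity
          nlinarith
        · calc r ^ 2 - t ^ 2 = (r - t) * (r + t) := by ring
            _ ≤ (2 * n) * (2 * r) := by
              apply mul_le_mul <;> linarith
            _ = _ := by ring
      rw [not_le] at h
      have b1 := hbd _ hk0 (by linarith)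
      have b2 := hbd _ a5 (by linarith)
      have b3 := hbd _ a6 (by linarith)
      have c1 := le_max_right (r ^ 2 - euc (toReal k) ^ 2) 0
      have c2 := le_max_right (r ^ 2 - euc (toReal k + u) ^ 2) 0
      have c3 := le_max_right (r ^ 2 - euc (toReal k - u) ^ 2) 0
      have : 0 ≤ 4 * n * r := by positivity
      have : (0 : ℝ) ≤ 2 * n ^ 2 := by positivity
      rw [abs_le]
      constructor <;> linarith

/-- The function `y ↦ max y 0 ^ 2` is `C¹` with derivative `2 max y 0` and second derivative between
0 and 2, hence this bound on its first order Taylor remainder. -/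
theorem max_sq_sub_le (y a : ℝ) : max (y + a) 0 ^ 2 - max y 0 ^ 2 - 2 * max y 0 * a ≤ a ^ 2 ∧
    0 ≤ max (y + a) 0 ^ 2 - max y 0 ^ 2 - 2 * max y 0 * a := by
  rcases max_cases (y + a) 0 with ⟨h1, h2⟩ | ⟨h1, h2⟩ <;>
    rcases max_cases y 0 with ⟨h3, h4⟩ | ⟨h3, h4⟩ <;> rw [h1, h3] <;> constructor <;>
    nlinarith [sq_nonneg a]

/-- The squared tent has no kink, so the boundary needs no separate treatment. Each Taylor remainder
is at most `9 n² (r + n)²`, and the linear terms add up to at most `4 n² (r + n)²` because the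
parallelogram law makes the two increments nearly cancel; together this is the constant 22. -/
theorem exists_abs_sum_sq_sub_integral_le : ∃ C : ℝ, ∀ r : ℝ, 1 ≤ r →
    |∑ k ∈ latticeBall ι r, (r ^ 2 - euc (toReal k) ^ 2) ^ 2 -
      ∫ x : ι → ℝ, max (r ^ 2 - euc x ^ 2) 0 ^ 2| ≤ C * r ^ (Fintype.card ι + 2) := by
  obtain ⟨C₁, hC₁, h₁⟩ := card_latticeBall_le_mul_pow (ι := ι)
  set n := Fintype.card ι with hn
  refine ⟨22 * n ^ 2 * (1 + n) ^ 2 * C₁, fun r hr => ?_⟩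
  have hn0 : (0 : ℝ) ≤ n := Nat.cast_nonneg _
  have hcont : Continuous fun x : ι → ℝ => max (r ^ 2 - euc x ^ 2) 0 ^ 2 :=
    ((continuous_const.sub (continuous_euc.pow 2)).max continuous_const).pow 2
  have hzero : ∀ x : ι → ℝ, r < euc x → max (r ^ 2 - euc x ^ 2) 0 ^ 2 = 0 := fun x hx => by
    rw [max_eq_right (by nlinarith)]; ring
  have key := abs_sum_sub_integral_le hcont (S := latticeBall ι (r + n))
    (B := fun _ => 22 * n ^ 2 * (r + n) ^ 2) ?_ ?_
  · have hsum : ∑ k ∈ latticeBall ι r, (r ^ 2 - euc (toReal k) ^ 2) ^ 2 =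
        ∑ k ∈ latticeBall ι (r + n), max (r ^ 2 - euc (toReal k) ^ 2) 0 ^ 2 := by
      have hsub : latticeBall ι r ⊆ latticeBall ι (r + n) := fun k hk => by
        rw [mem_latticeBall] at hk ⊢; linarith
      rw [← Finset.sum_subset hsub fun k _ hk => hzero _ (by simpa using hk)]
      refine Finset.sum_congr rfl fun k hk => ?_
      rw [mem_latticeBall] at hk
      rw [max_eq_left (by nlinarith [euc_nonneg (toReal k)])]
    rw [hsum]
    refine key.trans ?_
    rw [Finset.sum_const, nsmul_eq_mul]
    have e2 : (r + n) ^ 2 ≤ ((1 + n) * r) ^ 2 := pow_le_pow_left₀ (by positivity) (by nlinarith) _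
    calc _ ≤ (C₁ * r ^ n) * (22 * n ^ 2 * ((1 + n) * r) ^ 2) := by
          gcongr
          exact h₁ r hr
      _ = _ := by ring
  · intro x hx
    refine hzero x ?_
    rw [mem_latticeBall, not_le] at hx
    have := euc_nearest_le_add x
    linarith
  · intro k hk u hu
    rw [mem_latticeBall] at hk
    have hun := euc_le_of_abs_le_half hu
    rw [← hn] at hun
    have hu0 := euc_nonneg u
    have hk0 := euc_nonneg (toReal k)
    have hpar := euc_parallelogram (toReal k) u
    have d1 := abs_euc_sq_sub_le (x := toReal k) (u := u)
    have d2 := abs_euc_sq_sub_le (x := toReal k) (u := -u)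
    rw [← sub_eq_add_neg, euc_neg] at d2
    have hM : 2 * euc (toReal k) * euc u + euc u ^ 2 ≤ 3 * n * (r + n) := by
      have : euc (toReal k) * euc u ≤ (r + n) * n := mul_le_mul hk hun hu0 (by positivity)
      have : euc u ^ 2 ≤ n ^ 2 := pow_le_pow_left₀ hu0 hun 2
      nlinarith
    set y := r ^ 2 - euc (toReal k) ^ 2 with hy
    set a := -(euc (toReal k + u) ^ 2 - euc (toReal k) ^ 2) with ha
    set b := -(euc (toReal k - u) ^ 2 - euc (toReal k) ^ 2) with hb
    rw [← abs_neg] at d1 d2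
    have hya : r ^ 2 - euc (toReal k + u) ^ 2 = y + a := by rw [hy, ha]; ring
    have hyb : r ^ 2 - euc (toReal k - u) ^ 2 = y + b := by rw [hy, hb]; ring
    have hab : a + b = -(2 * euc u ^ 2) := by rw [ha, hb]; linarith
    rw [hya, hyb]
    obtain ⟨p1, p2⟩ := max_sq_sub_le y a
    obtain ⟨p3, p4⟩ := max_sq_sub_le y b
    have hym : max y 0 ≤ (r + n) ^ 2 := max_le (by nlinarith [sq_nonneg (euc (toReal k))])
      (by positivity)
    have hy0 : 0 ≤ max y 0 := le_max_right _ _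
    have ha2 : a ^ 2 ≤ (3 * n * (r + n)) ^ 2 := by
      rw [← sq_abs]; exact pow_le_pow_left₀ (abs_nonneg _) (d1.trans hM) 2
    have hb2 : b ^ 2 ≤ (3 * n * (r + n)) ^ 2 := by
      rw [← sq_abs]; exact pow_le_pow_left₀ (abs_nonneg _) (d2.trans hM) 2
    have hq : max y 0 * (2 * euc u ^ 2) ≤ (r + n) ^ 2 * (2 * n ^ 2) := by
      gcongr
    have hq0 : 0 ≤ max y 0 * (2 * euc u ^ 2) := by positivity
    have hs : 2 * max y 0 * a + 2 * max y 0 * b = -(2 * (max y 0 * (2 * euc u ^ 2))) := by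
      rw [← mul_add, hab]; ring
    have : 0 ≤ (n : ℝ) ^ 2 * (r + n) ^ 2 := by positivity
    rw [abs_le]
    constructor <;> nlinarith

end Midpoint

/-! ### The summatory function of the divisor sum, and balls in dimension 4 -/

theorem sum_Ioc_cast_id (q : ℕ) : ∑ m ∈ Finset.Ioc 0 q, (m : ℝ) = q * (q + 1) / 2 := by
  induction q with
  | zero => simp
  | succ q ih => rw [Finset.sum_Ioc_succ_top (by omega), ih]; push_cast; ring

/-- The summatory function of the sum of divisors. -/
noncomputable def sigmaSum (N : ℕ) : ℝ := ∑ n ∈ Finset.Ioc 0 N, ((∑ d ∈ n.divisors, d : ℕ) : ℝ)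

theorem sigmaSum_eq (N : ℕ) :
    sigmaSum N = ∑ k ∈ Finset.Ioc 0 N, ((N / k : ℕ) : ℝ) * ((N / k : ℕ) + 1) / 2 := by
  have h := ArithmeticFunction.sum_Ioc_mul_eq_sum_sum (R := ℕ) ArithmeticFunction.zeta
    (ArithmeticFunction.pow 1) N
  rw [ArithmeticFunction.zeta_mul_pow_eq_sigma] at h
  have h' := congrArg (Nat.cast : ℕ → ℝ) h
  rw [sigmaSum]
  simp only [ArithmeticFunction.sigma_one_apply] at h'
  push_cast at h' ⊢
  rw [h']
  refine Finset.sum_congr rfl fun k hk => ?_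
  rw [Finset.mem_Ioc] at hk
  rw [ArithmeticFunction.zeta_apply_ne (by omega), Nat.cast_one, one_mul, ← sum_Ioc_cast_id]
  refine Finset.sum_congr rfl fun m hm => ?_
  rw [Finset.mem_Ioc] at hm
  simp [ArithmeticFunction.pow_apply]

theorem sum_inv_sq_bounds {N : ℕ} (hN : N ≠ 0) :
    ∑ k ∈ Finset.Ioc 0 N, 1 / (k : ℝ) ^ 2 ≤ Real.pi ^ 2 / 6 ∧
    Real.pi ^ 2 / 6 - 1 / (N : ℝ) ≤ ∑ k ∈ Finset.Ioc 0 N, 1 / (k : ℝ) ^ 2 := by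
  constructor
  · exact sum_le_hasSum _ (fun k _ => by positivity) hasSum_zeta_two
  · have h : ∀ s : Finset ℕ, (∑ k ∈ s, 1 / (k : ℝ) ^ 2) ≤
        (∑ k ∈ Finset.Ioc 0 N, 1 / (k : ℝ) ^ 2) + 1 / (N : ℝ) := by
      intro s
      set M := max N (s.sup id) with hM
      have h1 : ∑ k ∈ s, 1 / (k : ℝ) ^ 2 ≤ ∑ k ∈ Finset.Ioc 0 M, 1 / (k : ℝ) ^ 2 := by
        rw [← Finset.sum_erase s (a := 0) (by simp)]
        refine Finset.sum_le_sum_of_subset_of_nonneg (fun k hk => ?_) fun k _ _ => by positivity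
        rw [Finset.mem_erase] at hk
        rw [Finset.mem_Ioc]
        have : k ≤ s.sup id := Finset.le_sup (f := id) hk.2
        exact ⟨by omega, this.trans (le_max_right _ _)⟩
      have h2 := sum_Ioc_inv_sq_le_sub (α := ℝ) hN (le_max_left N (s.sup id))
      have h3 := Finset.sum_Ioc_consecutive (fun k : ℕ => 1 / (k : ℝ) ^ 2) (Nat.zero_le N)
        (le_max_left N (s.sup id))
      simp only [one_div] at h1 h3 ⊢
      have : (0 : ℝ) ≤ (M : ℝ)⁻¹ := by positivity
      linarith
    have := hasSum_le_of_sum_le hasSum_zeta_two h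
    linarith

/-- With `t = N / k` and `q = ⌊t⌋`, the term `q (q + 1) / 2` differs from `t² / 2` by at most `t /
2`. The main terms add up to `ζ(2) N² / 2` with a tail `O(N)`, the errors to a harmonic sum. -/
theorem abs_sigmaSum_sub_le (N : ℕ) :
    |sigmaSum N - Real.pi ^ 2 / 12 * N ^ 2| ≤ N * (2 + Real.log N) := by
  rcases Nat.eq_zero_or_pos N with rfl | hN
  · simp [sigmaSum]
  have hN1 : (1 : ℝ) ≤ N := by exact_mod_cast hN
  have hN0 : (0 : ℝ) < N := by linarith
  obtain ⟨h1, h2⟩ := sum_inv_sq_bounds hN.ne'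
  have hharm : ∑ k ∈ Finset.Ioc 0 N, 1 / (k : ℝ) ≤ 1 + Real.log N := by
    have := harmonic_le_one_add_log N
    rw [harmonic_eq_sum_Icc] at this
    push_cast at this
    simpa [one_div, ← Finset.Icc_succ_left_eq_Ioc] using this
  have h3 : |sigmaSum N - N ^ 2 / 2 * ∑ k ∈ Finset.Ioc 0 N, 1 / (k : ℝ) ^ 2| ≤
      N / 2 * ∑ k ∈ Finset.Ioc 0 N, 1 / (k : ℝ) := by
    rw [sigmaSum_eq, Finset.mul_sum, Finset.mul_sum, ← Finset.sum_sub_distrib]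
    refine (Finset.abs_sum_le_sum_abs _ _).trans (Finset.sum_le_sum fun k hk => ?_)
    rw [Finset.mem_Ioc] at hk
    have hk0 : (0 : ℝ) < k := by exact_mod_cast hk.1
    set t : ℝ := N / k with ht
    set q : ℝ := ((N / k : ℕ) : ℝ) with hq
    have hqt : q ≤ t := Nat.cast_div_le
    have htq : t < q + 1 := by
      rw [ht, div_lt_iff₀ hk0]
      have := Nat.lt_mul_of_div_lt (Nat.lt_succ_self (N / k)) hk.1
      have : (N : ℝ) < ((N / k : ℕ) + 1 : ℕ) * (k : ℝ) := by exact_mod_cast this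
      push_cast at this
      linarith
    have hq0 : 0 ≤ q := Nat.cast_nonneg _
    have e1 : (N : ℝ) ^ 2 / 2 * (1 / (k : ℝ) ^ 2) = t ^ 2 / 2 := by rw [ht]; field_simp
    have e2 : (N : ℝ) / 2 * (1 / (k : ℝ)) = t / 2 := by rw [ht]; field_simp
    rw [e1, e2, abs_le]
    constructor <;> nlinarith
  have h4 : |(N : ℝ) ^ 2 / 2 * ∑ k ∈ Finset.Ioc 0 N, 1 / (k : ℝ) ^ 2 -
      Real.pi ^ 2 / 12 * (N : ℝ) ^ 2| ≤ (N : ℝ) / 2 := by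
    have : (N : ℝ) ^ 2 * (1 / N) = N := by field_simp
    rw [abs_le]
    constructor <;> nlinarith [sq_nonneg (N : ℝ)]
  have h5 := abs_sub_le (sigmaSum N) (N ^ 2 / 2 * ∑ k ∈ Finset.Ioc 0 N, 1 / (k : ℝ) ^ 2)
    (Real.pi ^ 2 / 12 * N ^ 2)
  have h6 := mul_le_mul_of_nonneg_left hharm (by positivity : 0 ≤ (N : ℝ) / 2)
  have h7 : 0 ≤ Real.log N := Real.log_nonneg hN1
  nlinarith

theorem card_latticeBall_four_eq_sum (r : ℝ) (hr : 0 ≤ r) :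
    (latticeBall (Fin 4) r).card = ∑ n ∈ Finset.range (⌊r ^ 2⌋₊ + 1), rFour n := by
  set N := ⌊r ^ 2⌋₊ with hN
  have h1 : ∑ n ∈ Finset.range (N + 1), rFour n =
      (normPairs ((Finset.range (N + 1)).biUnion antidiagonal)).card := by
    rw [card_normPairs, Finset.sum_biUnion]
    · rfl
    · intro a _ b _ hab
      rw [Function.onFun, Finset.disjoint_left]
      intro p hp hp'
      rw [Finset.HasAntidiagonal.mem_antidiagonal] at hp hp'
      exact hab (hp.symm.trans hp')
  have hmem : ∀ a b c d : ℤ, ((⟨a, b⟩, ⟨c, d⟩) : GaussianInt × GaussianInt) ∈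
      normPairs ((Finset.range (N + 1)).biUnion antidiagonal) ↔
      (a : ℝ) ^ 2 + b ^ 2 + (c ^ 2 + d ^ 2) ≤ r ^ 2 := by
    intro a b c d
    rw [mem_normPairs]
    simp only [Finset.mem_biUnion, Finset.mem_range, Finset.HasAntidiagonal.mem_antidiagonal,
      gaussianInt_norm_eq]
    have hcast : ∀ n : ℕ, a ^ 2 + b ^ 2 + (c ^ 2 + d ^ 2) = (n : ℤ) →
        (a : ℝ) ^ 2 + b ^ 2 + (c ^ 2 + d ^ 2) = n := fun n h => by exact_mod_cast h
    constructor
    · rintro ⟨p, ⟨n, hn, hp⟩, h1, h2⟩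
      rw [hcast n (by rw [h1, h2]; exact_mod_cast hp)]
      exact (Nat.le_floor_iff (by positivity)).1 (Nat.lt_succ_iff.1 hn)
    · intro h
      have h3 : 0 ≤ a ^ 2 + b ^ 2 := by positivity
      have h4 : 0 ≤ c ^ 2 + d ^ 2 := by positivity
      refine ⟨((a ^ 2 + b ^ 2).toNat, (c ^ 2 + d ^ 2).toNat), ⟨_, ?_, rfl⟩, ?_, ?_⟩
      · rw [Nat.lt_succ_iff, hN, Nat.le_floor_iff (by positivity), ← hcast]
        · exact h
        · push_cast
          rw [Int.toNat_of_nonneg h3, Int.toNat_of_nonneg h4]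
      · exact (Int.toNat_of_nonneg h3).symm
      · exact (Int.toNat_of_nonneg h4).symm
  have hball : ∀ k : Fin 4 → ℤ, k ∈ latticeBall (Fin 4) r ↔
      (k 0 : ℝ) ^ 2 + k 1 ^ 2 + (k 2 ^ 2 + k 3 ^ 2) ≤ r ^ 2 := by
    intro k
    rw [mem_latticeBall, ← pow_le_pow_iff_left₀ (euc_nonneg _) hr two_ne_zero, euc_sq,
      Fin.sum_univ_four]
    simp only [toReal, add_assoc]
  rw [h1]
  refine Finset.card_nbij' (fun k => (⟨k 0, k 1⟩, ⟨k 2, k 3⟩))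
    (fun q => ![q.1.re, q.1.im, q.2.re, q.2.im]) ?_ ?_ ?_ ?_
  · intro k hk
    exact (hmem _ _ _ _).2 ((hball k).1 hk)
  · rintro ⟨⟨a, b⟩, ⟨c, d⟩⟩ h
    exact (hball _).2 ((hmem _ _ _ _).1 h)
  · intro k hk
    ext i
    fin_cases i <;> rfl
  · rintro ⟨⟨a, b⟩, ⟨c, d⟩⟩ h
    rfl

theorem sum_rFour_eq (N : ℕ) : ((∑ n ∈ Finset.range (N + 1), rFour n : ℕ) : ℝ) =
    1 + 8 * sigmaSum N - 32 * sigmaSum (N / 4) := by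
  have hterm : ∀ n ∈ Finset.Ioc 0 N, (rFour n : ℝ) = 8 * ((∑ d ∈ n.divisors, d : ℕ) : ℝ) -
      if 4 ∣ n then 32 * ((∑ d ∈ (n / 4).divisors, d : ℕ) : ℝ) else 0 := by
    intro n hn
    rw [Finset.mem_Ioc] at hn
    have := rFour_eq (n := n) (by omega)
    have h := congrArg (Int.cast : ℤ → ℝ) this
    push_cast at h ⊢
    exact h
  have h4 : ∑ n ∈ Finset.Ioc 0 N, (if 4 ∣ n then
      32 * ((∑ d ∈ (n / 4).divisors, d : ℕ) : ℝ) else 0) = 32 * sigmaSum (N / 4) := by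
    rw [← Finset.sum_filter, sigmaSum, Finset.mul_sum]
    refine Finset.sum_nbij' (fun n => n / 4) (fun n => 4 * n) ?_ ?_ ?_ ?_ ?_
    · intro n hn
      simp only [Finset.mem_filter, Finset.mem_Ioc] at hn ⊢
      omega
    · intro n hn
      simp only [Finset.mem_filter, Finset.mem_Ioc] at hn ⊢
      omega
    · intro n hn
      simp only [Finset.mem_filter, Finset.mem_Ioc] at hn ⊢
      omega
    · intro n hn
      omega
    · intro n hn; rfl
  have h0 : rFour 0 = 1 := by
    simp [rFour, rTwo_zero]
  rw [Finset.sum_range_succ', h0]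
  push_cast
  have h5 : ∑ n ∈ Finset.range N, (rFour (n + 1) : ℝ) = ∑ n ∈ Finset.Ioc 0 N, (rFour n : ℝ) := by
    clear hterm h4
    induction N with
    | zero => simp
    | succ N ih => rw [Finset.sum_range_succ, Finset.sum_Ioc_succ_top (by omega), ih]
  rw [h5, Finset.sum_congr rfl hterm, Finset.sum_sub_distrib, h4, ← Finset.mul_sum]
  change (8 * sigmaSum N - _) + 1 = _
  ring

theorem unitBallVolume_four : unitBallVolume (Fin 4) = Real.pi ^ 2 / 2 := by
  rw [unitBallVolume, MeasureTheory.measureReal_def, volume_euc_le,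
    EuclideanSpace.volume_closedBall]
  have h1 : Real.Gamma ((Fintype.card (Fin 4) : ℝ) / 2 + 1) = 2 := by
    have := Real.Gamma_nat_eq_factorial 2
    rw [Fintype.card_fin]
    norm_num at this ⊢
  rw [h1]
  have h2 : √Real.pi ^ 4 = Real.pi ^ 2 := by
    rw [show 4 = 2 * 2 by norm_num, pow_mul, Real.sq_sqrt Real.pi_pos.le]
  simp [h2]
  positivity

theorem half_le_log_two_add {r : ℝ} (hr : 0 ≤ r) : 1 / 2 ≤ Real.log (2 + r) := by
  have h1 : Real.log 2 ≤ Real.log (2 + r) := Real.log_le_log (by norm_num) (by linarith)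
  linarith [Real.log_two_gt_d9]

/-- Lattice points in four-dimensional balls. -/
theorem exists_abs_card_latticeBall_four_sub_le : ∃ C : ℝ, 0 ≤ C ∧ ∀ r : ℝ, 0 ≤ r →
    |((latticeBall (Fin 4) r).card : ℝ) - unitBallVolume (Fin 4) * r ^ 4| ≤
      C * ((1 + r) ^ 2 * Real.log (2 + r)) := by
  refine ⟨500, by norm_num, fun r hr => ?_⟩
  rw [card_latticeBall_four_eq_sum r hr, sum_rFour_eq, unitBallVolume_four]
  set N := ⌊r ^ 2⌋₊ with hN
  set L := Real.log (2 + r) with hL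
  have hL1 : 1 ≤ 2 * L := by linarith [half_le_log_two_add hr]
  have hL0 : 0 ≤ L := by linarith
  have hNr : (N : ℝ) ≤ r ^ 2 := Nat.floor_le (by positivity)
  have hrN : r ^ 2 < N + 1 := Nat.lt_floor_add_one _
  have hN0 : (0 : ℝ) ≤ N := Nat.cast_nonneg _
  have hlog : ∀ M : ℕ, (M : ℝ) ≤ r ^ 2 → M * (2 + Real.log M) ≤ r ^ 2 * (6 * L) := by
    intro M hM
    rcases Nat.eq_zero_or_pos M with rfl | h
    · simp; positivity
    · have h1 : (1 : ℝ) ≤ M := by exact_mod_cast h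
      have h2 : Real.log M ≤ 2 * L := by
        rw [hL, show 2 * Real.log (2 + r) = Real.log ((2 + r) ^ 2) by rw [Real.log_pow]; norm_num]
        exact Real.log_le_log (by linarith) (by nlinarith)
      have h3 : 0 ≤ Real.log M := Real.log_nonneg h1
      have h4 : 2 + Real.log M ≤ 6 * L := by linarith
      exact mul_le_mul hM h4 (by linarith) (by positivity)
  set q := N / 4 with hq
  have hq1 : (q : ℝ) ≤ N / 4 := Nat.cast_div_le
  have hq2 : (N : ℝ) / 4 ≤ q + 1 := by
    have : N ≤ 4 * q + 4 := by omega
    have : (N : ℝ) ≤ 4 * q + 4 := by exact_mod_cast this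
    linarith
  have hq0 : (0 : ℝ) ≤ q := Nat.cast_nonneg _
  -- The main terms match: `8 · π²/12 - 32 · π²/12 · 1/16 = π²/2`, the volume of the unit ball.
  -- Replacing `N / 4` and `⌊r²⌋` by real numbers costs only `O(r² + 1)`.
  have e1 := abs_le.1 ((abs_sigmaSum_sub_le N).trans (hlog N hNr))
  have e2 := abs_le.1 ((abs_sigmaSum_sub_le q).trans (hlog q (by linarith)))
  have hpi : Real.pi ^ 2 ≤ 10 := by nlinarith [Real.pi_lt_d2, Real.pi_pos]
  have hpi0 : 0 ≤ Real.pi ^ 2 := by positivity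
  have f1 : 0 ≤ (N : ℝ) ^ 2 / 16 - q ^ 2 := by nlinarith
  have f2 : (N : ℝ) ^ 2 / 16 - q ^ 2 ≤ N / 2 := by nlinarith
  have g1 : 0 ≤ r ^ 4 - (N : ℝ) ^ 2 := by nlinarith
  have g2 : r ^ 4 - (N : ℝ) ^ 2 ≤ 2 * r ^ 2 := by nlinarith
  have f3 := mul_nonneg hpi0 f1
  have g3 := mul_nonneg hpi0 g1
  have f4 : Real.pi ^ 2 * ((N : ℝ) ^ 2 / 16 - q ^ 2) ≤ 10 * (N / 2) :=
    mul_le_mul hpi f2 f1 (by norm_num)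
  have g4 : Real.pi ^ 2 * (r ^ 4 - (N : ℝ) ^ 2) ≤ 10 * (2 * r ^ 2) :=
    mul_le_mul hpi g2 g1 (by norm_num)
  have hrL : r ^ 2 ≤ r ^ 2 * (2 * L) := le_mul_of_one_le_right (by positivity) hL1
  have hbig : r ^ 2 * L + L ≤ (1 + r) ^ 2 * L := by
    have : 0 ≤ 2 * r * L := by positivity
    nlinarith
  rw [abs_le]
  constructor <;> nlinarith

/-! ### Lattice points in balls of dimension at least 4 -/

section Product

variable {κ ι : Type*} [Fintype κ] [Fintype ι]

theorem euc_sum_sq (x : κ ⊕ ι → ℝ) :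
    euc x ^ 2 = euc (fun i => x (.inl i)) ^ 2 + euc (fun i => x (.inr i)) ^ 2 := by
  simp only [euc_sq, Fintype.sum_sum_type]

theorem card_latticeBall_sum {r : ℝ} (hr : 0 ≤ r) : (latticeBall (κ ⊕ ι) r).card =
    ∑ w ∈ latticeBall κ r, (latticeBall ι √(r ^ 2 - euc (toReal w) ^ 2)).card := by
  rw [← Finset.card_sigma]
  have hmem : ∀ k : κ ⊕ ι → ℤ, k ∈ latticeBall (κ ⊕ ι) r ↔
      euc (toReal fun i => k (.inl i)) ^ 2 + euc (toReal fun i => k (.inr i)) ^ 2 ≤ r ^ 2 := by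
    intro k
    rw [mem_latticeBall, ← pow_le_pow_iff_left₀ (euc_nonneg _) hr two_ne_zero, euc_sum_sq]
    rfl
  have hmem' : ∀ (w : κ → ℤ) (y : ι → ℤ), ((⟨w, y⟩ : (_ : κ → ℤ) × (ι → ℤ)) ∈
      (latticeBall κ r).sigma fun w => latticeBall ι √(r ^ 2 - euc (toReal w) ^ 2)) ↔
      euc (toReal w) ^ 2 + euc (toReal y) ^ 2 ≤ r ^ 2 := by
    intro w y
    rw [Finset.mem_sigma, mem_latticeBall, mem_latticeBall,
      ← pow_le_pow_iff_left₀ (euc_nonneg _) hr two_ne_zero]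
    constructor
    · rintro ⟨h1, h2⟩
      rw [Real.le_sqrt (euc_nonneg _) (by linarith)] at h2
      linarith
    · intro h
      have h1 := sq_nonneg (euc (toReal y))
      have h2 := sq_nonneg (euc (toReal w))
      simp only
      exact ⟨by linarith, (Real.le_sqrt (euc_nonneg _) (by linarith)).2 (by linarith)⟩
  refine Finset.card_nbij' (fun k => ⟨fun i => k (.inl i), fun i => k (.inr i)⟩)
    (fun p => Sum.elim p.1 p.2) ?_ ?_ ?_ ?_
  · intro k hk
    exact (hmem' _ _).2 ((hmem k).1 hk)
  · rintro ⟨w, y⟩ h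
    exact (hmem _).2 ((hmem' _ _).1 h)
  · intro k _
    ext i
    rcases i with i | i <;> rfl
  · rintro ⟨w, y⟩ _
    rfl

/-- Fubini for the ball. The fibre dimension has to be positive for the power of `√0` to vanish
outside the projection. -/
theorem unitBallVolume_sum [Nonempty ι] {r : ℝ} (hr : 0 ≤ r) :
    unitBallVolume (κ ⊕ ι) * r ^ (Fintype.card κ + Fintype.card ι) =
      ∫ w : κ → ℝ, unitBallVolume ι * √(max (r ^ 2 - euc w ^ 2) 0) ^ Fintype.card ι := by
  rw [← Fintype.card_sum, ← volumeReal_euc_le hr]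
  have h1 := volume_measurePreserving_sumPiEquivProdPi (fun _ : κ ⊕ ι => ℝ)
  set T : Set ((κ → ℝ) × (ι → ℝ)) := {p | euc p.1 ^ 2 + euc p.2 ^ 2 ≤ r ^ 2} with hT
  have hTm : MeasurableSet T := by
    refine measurableSet_le ?_ measurable_const
    exact ((continuous_euc.comp continuous_fst).pow 2 |>.add
      ((continuous_euc.comp continuous_snd).pow 2)).measurable
  have h2 : {x : κ ⊕ ι → ℝ | euc x ≤ r} =
      (MeasurableEquiv.sumPiEquivProdPi fun _ : κ ⊕ ι => ℝ) ⁻¹' T := by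
    ext x
    change euc x ≤ r ↔ euc (fun i => x (.inl i)) ^ 2 + euc (fun i => x (.inr i)) ^ 2 ≤ r ^ 2
    rw [← euc_sum_sq, pow_le_pow_iff_left₀ (euc_nonneg _) hr two_ne_zero]
  rw [measureReal_def, h2, h1.measure_preimage hTm.nullMeasurableSet,
    Measure.volume_eq_prod, Measure.prod_apply hTm]
  have hslice : ∀ w : κ → ℝ, (volume (Prod.mk w ⁻¹' T)) =
      volume {y : ι → ℝ | euc y ^ 2 ≤ r ^ 2 - euc w ^ 2} := by
    intro w
    congr 1
    ext y
    change euc w ^ 2 + euc y ^ 2 ≤ r ^ 2 ↔ euc y ^ 2 ≤ r ^ 2 - euc w ^ 2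
    constructor <;> intro h <;> linarith
  have hslice' : ∀ w : κ → ℝ, {y : ι → ℝ | euc y ^ 2 ≤ r ^ 2 - euc w ^ 2} ⊆
      {y : ι → ℝ | euc y ≤ √(max (r ^ 2 - euc w ^ 2) 0)} := fun w y hy =>
    (Real.le_sqrt (euc_nonneg _) (le_max_right _ _)).2 (le_max_of_le_left hy)
  rw [← integral_toReal]
  · refine integral_congr_ae (Filter.Eventually.of_forall fun w => ?_)
    simp only
    rw [hslice]
    rcases le_or_gt 0 (r ^ 2 - euc w ^ 2) with h | h
    · rw [max_eq_left h, ← volumeReal_euc_le (Real.sqrt_nonneg _), measureReal_def]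
      congr 2
      ext y
      exact (Real.le_sqrt (euc_nonneg _) h).symm
    · have : {y : ι → ℝ | euc y ^ 2 ≤ r ^ 2 - euc w ^ 2} = ∅ := by
        ext y
        simp only [Set.mem_ofPred_eq, Set.mem_empty_iff_false, iff_false, not_le]
        linarith [sq_nonneg (euc y)]
      rw [this, max_eq_right h.le]
      simp
  · exact (measurable_measure_prodMk_left hTm).aemeasurable
  · refine Filter.Eventually.of_forall fun w => ?_
    rw [hslice]
    exact lt_of_le_of_lt (measure_mono (hslice' w)) (volume_euc_le_ne_top _).lt_top

theorem latticeBall_mono {r s : ℝ} (h : r ≤ s) : latticeBall ι r ⊆ latticeBall ι s :=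
  fun k hk => by rw [mem_latticeBall] at hk ⊢; linarith

/-- The fibres over `w` are 4-dimensional balls of squared radius `r² - |w|²`. Their errors `O((1 +
r)² log (2 + r))` occur `O(r^m)` times for `r ≥ 1`, with `m` the dimension of the base. Their main
terms form a Riesz mean of order two over the base, known up to `O(r^{m+2})`. Radii below 1 are
absorbed by the constant. -/
theorem exists_abs_card_latticeBall_sum_four_sub_le : ∃ C : ℝ, 0 ≤ C ∧ ∀ r : ℝ, 0 ≤ r →
    |((latticeBall (κ ⊕ Fin 4) r).card : ℝ) -
      unitBallVolume (κ ⊕ Fin 4) * r ^ (Fintype.card κ + 4)| ≤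
        C * ((1 + r) ^ (Fintype.card κ + 2) * Real.log (2 + r)) := by
  obtain ⟨C₁, hC₁, h₁⟩ := card_latticeBall_le_mul_pow (ι := κ)
  obtain ⟨C₂, h₂⟩ := exists_abs_sum_sq_sub_integral_le (ι := κ)
  obtain ⟨C₃, hC₃, h₃⟩ := exists_abs_card_latticeBall_four_sub_le
  set m := Fintype.card κ with hm
  set V₄ := unitBallVolume (Fin 4) with hV₄
  have hV₄0 : 0 ≤ V₄ := unitBallVolume_nonneg
  set V := unitBallVolume (κ ⊕ Fin 4) with hV
  have hV0 : 0 ≤ V := unitBallVolume_nonneg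
  set K := ((latticeBall (κ ⊕ Fin 4) 1).card : ℝ) with hK
  have hK0 : 0 ≤ K := Nat.cast_nonneg _
  refine ⟨C₁ * C₃ + 2 * (V₄ * |C₂|) + 2 * (K + V), by positivity, fun r hr => ?_⟩
  set L := Real.log (2 + r) with hL
  have hL1 : 1 ≤ 2 * L := by linarith [half_le_log_two_add hr]
  have hL0 : 0 ≤ L := by linarith
  have hX : 0 ≤ (1 + r) ^ (m + 2) * L := by positivity
  rcases le_or_gt 1 r with hr1 | hr1
  · have hmain : ∑ w ∈ latticeBall κ r, V₄ * (r ^ 2 - euc (toReal w) ^ 2) ^ 2 - V * r ^ (m + 4) =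
        V₄ * (∑ w ∈ latticeBall κ r, (r ^ 2 - euc (toReal w) ^ 2) ^ 2 -
          ∫ x : κ → ℝ, max (r ^ 2 - euc x ^ 2) 0 ^ 2) := by
      have := unitBallVolume_sum (κ := κ) (ι := Fin 4) hr
      rw [Fintype.card_fin] at this
      rw [hV, this, mul_sub, Finset.mul_sum, ← integral_const_mul]
      congr 2
      ext w
      rw [show 4 = 2 * 2 by norm_num, pow_mul, Real.sq_sqrt (le_max_right _ _)]
    have herr : |∑ w ∈ latticeBall κ r,
        (((latticeBall (Fin 4) √(r ^ 2 - euc (toReal w) ^ 2)).card : ℝ) -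
          V₄ * (r ^ 2 - euc (toReal w) ^ 2) ^ 2)| ≤
        ∑ w ∈ latticeBall κ r, C₃ * ((1 + r) ^ 2 * L) := by
      refine (Finset.abs_sum_le_sum_abs _ _).trans (Finset.sum_le_sum fun w hw => ?_)
      rw [mem_latticeBall] at hw
      have hw0 := euc_nonneg (toReal w)
      have hnn : 0 ≤ r ^ 2 - euc (toReal w) ^ 2 := by nlinarith
      have h := h₃ _ (Real.sqrt_nonneg (r ^ 2 - euc (toReal w) ^ 2))
      have h4 : √(r ^ 2 - euc (toReal w) ^ 2) ^ 4 = (r ^ 2 - euc (toReal w) ^ 2) ^ 2 := by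
        rw [show 4 = 2 * 2 by norm_num, pow_mul, Real.sq_sqrt hnn]
      rw [h4] at h
      refine h.trans ?_
      have hs : √(r ^ 2 - euc (toReal w) ^ 2) ≤ r := Real.sqrt_le_iff.2 ⟨hr, by
        linarith [sq_nonneg (euc (toReal w))]⟩
      have hs0 := Real.sqrt_nonneg (r ^ 2 - euc (toReal w) ^ 2)
      have hl := half_le_log_two_add hs0
      have hl2 : Real.log (2 + √(r ^ 2 - euc (toReal w) ^ 2)) ≤ L :=
        Real.log_le_log (by linarith) (by linarith)
      gcongr
    rw [Finset.sum_const, nsmul_eq_mul] at herr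
    have hcard : ((latticeBall κ r).card : ℝ) ≤ C₁ * r ^ m :=
      le_trans (by exact_mod_cast Finset.card_le_card (latticeBall_mono (by
        linarith [(Nat.cast_nonneg m : (0 : ℝ) ≤ m)]))) (h₁ r hr1)
    have hq := (h₂ r hr1).trans (mul_le_mul_of_nonneg_right (le_abs_self C₂) (by positivity))
    have hdecomp : ((latticeBall (κ ⊕ Fin 4) r).card : ℝ) - V * r ^ (m + 4) =
        ∑ w ∈ latticeBall κ r, (((latticeBall (Fin 4) √(r ^ 2 - euc (toReal w) ^ 2)).card : ℝ) -
          V₄ * (r ^ 2 - euc (toReal w) ^ 2) ^ 2) +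
        V₄ * (∑ w ∈ latticeBall κ r, (r ^ 2 - euc (toReal w) ^ 2) ^ 2 -
          ∫ x : κ → ℝ, max (r ^ 2 - euc x ^ 2) 0 ^ 2) := by
      rw [← hmain, Finset.sum_sub_distrib, card_latticeBall_sum hr]
      push_cast
      ring
    rw [hdecomp]
    refine (abs_add_le _ _).trans ?_
    rw [abs_mul, abs_of_nonneg hV₄0]
    have hrp : r ^ m ≤ (1 + r) ^ m := pow_le_pow_left₀ hr (by linarith) _
    have hrp2 : r ^ (m + 2) ≤ (1 + r) ^ (m + 2) := pow_le_pow_left₀ hr (by linarith) _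
    have e1 : ((latticeBall κ r).card : ℝ) * (C₃ * ((1 + r) ^ 2 * L)) ≤
        C₁ * C₃ * ((1 + r) ^ (m + 2) * L) := by
      calc _ ≤ (C₁ * (1 + r) ^ m) * (C₃ * ((1 + r) ^ 2 * L)) := by
            gcongr
            exact hcard.trans (mul_le_mul_of_nonneg_left hrp hC₁)
        _ = _ := by ring
    have e2 : V₄ * |∑ w ∈ latticeBall κ r, (r ^ 2 - euc (toReal w) ^ 2) ^ 2 -
          ∫ x : κ → ℝ, max (r ^ 2 - euc x ^ 2) 0 ^ 2| ≤
        2 * (V₄ * |C₂|) * ((1 + r) ^ (m + 2) * L) := by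
      calc _ ≤ V₄ * (|C₂| * (1 + r) ^ (m + 2)) :=
            mul_le_mul_of_nonneg_left (hq.trans (mul_le_mul_of_nonneg_left hrp2 (abs_nonneg _))) hV₄0
        _ ≤ V₄ * (|C₂| * ((1 + r) ^ (m + 2) * (2 * L))) := by
            gcongr
            exact le_mul_of_one_le_right (by positivity) hL1
        _ = _ := by ring
    have e3 : 0 ≤ 2 * (K + V) * ((1 + r) ^ (m + 2) * L) := by positivity
    linarith
  · have h1 : ((latticeBall (κ ⊕ Fin 4) r).card : ℝ) ≤ K := by
      rw [hK]
      exact_mod_cast Finset.card_le_card (latticeBall_mono hr1.le)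
    have h2 : V * r ^ (m + 4) ≤ V := mul_le_of_le_one_right hV0 (pow_le_one₀ hr hr1.le)
    have h3 : 0 ≤ V * r ^ (m + 4) := by positivity
    have h4 : (0 : ℝ) ≤ (latticeBall (κ ⊕ Fin 4) r).card := Nat.cast_nonneg _
    have h5 : 1 ≤ (1 + r) ^ (m + 2) := one_le_pow₀ (by linarith)
    have h6 : 1 ≤ 2 * ((1 + r) ^ (m + 2) * L) := by nlinarith
    have h7 : 0 ≤ (C₁ * C₃ + 2 * (V₄ * |C₂|)) * ((1 + r) ^ (m + 2) * L) := by positivity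
    have h8 : K + V ≤ (K + V) * (2 * ((1 + r) ^ (m + 2) * L)) :=
      le_mul_of_one_le_right (by positivity) h6
    rw [abs_le]
    constructor <;> linarith

end Product

theorem unitBallVolume_congr {ι ι' : Type*} [Fintype ι] [Fintype ι'] [Nonempty ι]
    (h : Fintype.card ι = Fintype.card ι') : unitBallVolume ι = unitBallVolume ι' := by
  have : Nonempty ι' := Fintype.card_pos_iff.1 (h ▸ Fintype.card_pos)
  rw [unitBallVolume, unitBallVolume, measureReal_def, measureReal_def, volume_euc_le,
    volume_euc_le, EuclideanSpace.volume_closedBall, EuclideanSpace.volume_closedBall, h]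

theorem card_latticeBall_congr {ι ι' : Type*} [Fintype ι] [Fintype ι'] (e : ι ≃ ι') (r : ℝ) :
    (latticeBall ι r).card = (latticeBall ι' r).card := by
  have heuc : ∀ x : ι' → ℝ, euc (fun i => x (e i)) = euc x := fun x => by
    rw [← pow_left_inj₀ (euc_nonneg _) (euc_nonneg _) two_ne_zero, euc_sq, euc_sq]
    exact e.sum_comp fun i => x i ^ 2
  refine Finset.card_nbij' (fun k i => k (e.symm i)) (fun k i => k (e i)) ?_ ?_ ?_ ?_
  · intro k hk
    rw [Finset.mem_coe, mem_latticeBall] at hk ⊢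
    rw [← heuc]
    refine le_of_eq_of_le (congrArg euc ?_) hk
    ext i
    simp [toReal]
  · intro k hk
    rw [Finset.mem_coe, mem_latticeBall] at hk ⊢
    rwa [← heuc] at hk
  · intro k _; simp
  · intro k _; simp

theorem exists_abs_card_latticeBall_sub_le {D : ℕ} (hD : 4 ≤ D) : ∃ C : ℝ, 0 ≤ C ∧
    ∀ r : ℝ, 0 ≤ r →
      |((latticeBall (Fin D) r).card : ℝ) - unitBallVolume (Fin D) * r ^ D| ≤
        C * ((1 + r) ^ (D - 2) * Real.log (2 + r)) := by
  obtain ⟨C, hC, h⟩ := exists_abs_card_latticeBall_sum_four_sub_le (κ := Fin (D - 4))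
  refine ⟨C, hC, fun r hr => ?_⟩
  have h1 := h r hr
  rw [card_latticeBall_congr (finSumFinEquiv.trans (finCongr (by omega : D - 4 + 4 = D))) r,
    unitBallVolume_congr (ι' := Fin D) (by simp; omega), Fintype.card_fin,
    show D - 4 + 4 = D by omega, show D - 4 + 2 = D - 2 by omega] at h1
  exact h1

/-! ### The radial profile, and its lattice sum in terms of the ball error -/

/-- The profile `ρ ↦ (R^α - ρ^α)^{2/α}`. -/
noncomputable def profile (α R ρ : ℝ) : ℝ := (R ^ α - ρ ^ α) ^ (2 / α)

/-- Minus the derivative of `profile α R`. -/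
noncomputable def profileWeight (α R ρ : ℝ) : ℝ :=
  2 * ρ ^ (α - 1) * (R ^ α - ρ ^ α) ^ (2 / α - 1)

theorem profileWeight_nonneg {α R ρ : ℝ} (hα : 0 < α) (hρ : 0 ≤ ρ) (hR : ρ ≤ R) :
    0 ≤ profileWeight α R ρ := by
  have : 0 ≤ R ^ α - ρ ^ α := sub_nonneg.2 (Real.rpow_le_rpow hρ hR hα.le)
  rw [profileWeight]
  positivity

theorem profile_nonneg {α R ρ : ℝ} (hα : 0 < α) (hρ : 0 ≤ ρ) (hR : ρ ≤ R) :
    0 ≤ profile α R ρ :=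
  Real.rpow_nonneg (sub_nonneg.2 (Real.rpow_le_rpow hρ hR hα.le)) _

theorem profile_self {α R : ℝ} (hα : 0 < α) : profile α R R = 0 := by
  rw [profile, sub_self, Real.zero_rpow (by positivity)]

theorem profile_zero {α R : ℝ} (hα : 0 < α) (hR : 0 ≤ R) : profile α R 0 = R ^ 2 := by
  rw [profile, Real.zero_rpow hα.ne', sub_zero, ← Real.rpow_mul hR,
    mul_div_cancel₀ _ hα.ne']
  norm_cast

theorem profile_two {R ρ : ℝ} : profile 2 R ρ = R ^ 2 - ρ ^ 2 := by
  rw [profile, div_self two_ne_zero, Real.rpow_one]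
  norm_cast

theorem hasDerivAt_profile {α R ρ : ℝ} (hα : 0 < α) (hρ : 0 < ρ) (hR : ρ < R) :
    HasDerivAt (profile α R) (-profileWeight α R ρ) ρ := by
  have h1 : R ^ α - ρ ^ α ≠ 0 := (sub_pos.2 (Real.rpow_lt_rpow hρ.le hR hα)).ne'
  have h2 := ((Real.hasDerivAt_rpow_const (x := ρ) (p := α) (Or.inl hρ.ne')).const_sub
    (R ^ α)).rpow_const (p := 2 / α) (Or.inl h1)
  refine h2.congr_deriv ?_
  unfold profileWeight
  field_simp

theorem continuous_profile {α R : ℝ} (hα : 0 < α) : Continuous (profile α R) :=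
  (continuous_const.sub (Real.continuous_rpow_const hα.le)).rpow_const
    fun _ => Or.inr (by positivity)

/-- For `α > 2` the weight is unbounded at `ρ = R`. Integrability follows because it is the
nonnegative derivative of a function that is continuous up to the end. -/
theorem integrableOn_profileWeight {α R : ℝ} (hα : 0 < α) :
    IntegrableOn (profileWeight α R) (Set.Ioc 0 R) := by
  have h := intervalIntegral.integrableOn_deriv_of_nonneg (a := 0) (b := R)
    (g := fun ρ => -profile α R ρ) (g' := profileWeight α R)
    (continuous_profile hα).neg.continuousOn (fun ρ hρ => by
      have := (hasDerivAt_profile hα hρ.1 hρ.2).neg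
      rwa [neg_neg] at this)
    (fun ρ hρ => profileWeight_nonneg hα hρ.1.le hρ.2.le)
  exact h

theorem integral_profileWeight {α R s : ℝ} (hα : 0 < α) (hs : 0 ≤ s) (hsR : s ≤ R) :
    ∫ ρ in Set.Ioc s R, profileWeight α R ρ = profile α R s := by
  rw [← intervalIntegral.integral_of_le hsR]
  have h := intervalIntegral.integral_eq_sub_of_hasDerivAt_of_le hsR
    (f := fun ρ => -profile α R ρ) (f' := profileWeight α R)
    (continuous_profile hα).neg.continuousOn (fun ρ hρ => by
      have := (hasDerivAt_profile hα (hs.trans_lt hρ.1) hρ.2).neg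
      rwa [neg_neg] at this) (by
      rw [intervalIntegrable_iff_integrableOn_Ioc_of_le hsR]
      exact (integrableOn_profileWeight hα).mono_set
        (Set.Ioc_subset_Ioc_left hs))
  rw [h, profile_self hα]
  ring

section

variable {ι : Type*} [Fintype ι]

variable (ι) in
/-- The error term for the number of lattice points in the ball of radius `ρ`. -/
noncomputable def ballError (ρ : ℝ) : ℝ :=
  (latticeBall ι ρ).card - unitBallVolume ι * ρ ^ Fintype.card ι

theorem setIntegral_indicator_le {E : Type*} [NormedAddCommGroup E] [NormedSpace ℝ E]
    {w : ℝ → E} {s R : ℝ} (hs : 0 ≤ s) :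
    ∫ ρ in Set.Ioc 0 R, (if s ≤ ρ then w ρ else 0) = ∫ ρ in Set.Ioc s R, w ρ := by
  have : (fun ρ => if s ≤ ρ then w ρ else 0) = (Set.Ici s).indicator w := by
    ext ρ; simp [Set.indicator, Set.mem_Ici]
  rw [this, setIntegral_indicator measurableSet_Ici]
  refine setIntegral_congr_set ?_
  rcases hs.eq_or_lt with rfl | h
  · exact Filter.EventuallyEq.of_eq (Set.inter_eq_left.2 fun x h => h.1.le)
  · have : Set.Ioc 0 R ∩ Set.Ici s = Set.Icc s R := by
      ext x
      simp only [Set.mem_inter_iff, Set.mem_Ioc, Set.mem_Ici, Set.mem_Icc]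
      constructor
      · rintro ⟨⟨h1, h2⟩, h3⟩; exact ⟨h3, h2⟩
      · rintro ⟨h1, h2⟩; exact ⟨⟨h.trans_le h1, h2⟩, h1⟩
    rw [this]
    exact Ioc_ae_eq_Icc.symm

/-- Layer cake: `profile α R s` is the integral of the weight from `s` to `R`, and exchanging sum
and integral counts the lattice points with `|k| ≤ ρ`. -/
theorem sum_profile_eq {α R : ℝ} (hα : 0 < α) :
    ∑ k ∈ latticeBall ι R, profile α R (euc (toReal k)) =
      ∫ ρ in Set.Ioc 0 R, ((latticeBall ι ρ).card : ℝ) * profileWeight α R ρ := by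
  have hI := integrableOn_profileWeight (R := R) hα
  have h1 : ∀ k ∈ latticeBall ι R, profile α R (euc (toReal k)) =
      ∫ ρ in Set.Ioc 0 R, if euc (toReal k) ≤ ρ then profileWeight α R ρ else 0 := by
    intro k hk
    rw [mem_latticeBall] at hk
    rw [setIntegral_indicator_le (euc_nonneg _), integral_profileWeight hα (euc_nonneg _) hk]
  rw [Finset.sum_congr rfl h1, ← integral_finsetSum]
  · refine setIntegral_congr_fun measurableSet_Ioc fun ρ hρ => ?_
    rw [← Finset.sum_filter, Finset.sum_const, nsmul_eq_mul]
    congr 3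
    ext k
    simp only [Finset.mem_filter, mem_latticeBall]
    exact ⟨fun h => h.2, fun h => ⟨h.trans hρ.2, h⟩⟩
  · intro k _
    have : (fun ρ => if euc (toReal k) ≤ ρ then profileWeight α R ρ else 0) =
        (Set.Ici (euc (toReal k))).indicator (profileWeight α R) := by
      ext ρ; simp [Set.indicator, Set.mem_Ici]
    rw [this]
    exact Integrable.indicator hI measurableSet_Ici

theorem integral_profile_eq {α R : ℝ} (hα : 0 < α) :
    ∫ x in {x : ι → ℝ | euc x ≤ R}, profile α R (euc x) =
      ∫ ρ in Set.Ioc 0 R, unitBallVolume ι * ρ ^ Fintype.card ι * profileWeight α R ρ := by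
  have hI := integrableOn_profileWeight (R := R) hα
  have hBm : MeasurableSet {x : ι → ℝ | euc x ≤ R} :=
    measurableSet_le continuous_euc.measurable measurable_const
  have h1 : ∫ x in {x : ι → ℝ | euc x ≤ R}, profile α R (euc x) =
      ∫ x in {x : ι → ℝ | euc x ≤ R}, ∫ ρ in Set.Ioc 0 R,
        if euc x ≤ ρ then profileWeight α R ρ else 0 := by
    refine setIntegral_congr_fun hBm fun x hx => ?_
    rw [setIntegral_indicator_le (euc_nonneg _), integral_profileWeight hα (euc_nonneg _) hx]
  have hfin : IsFiniteMeasure ((volume : Measure (ι → ℝ)).restrict {x : ι → ℝ | euc x ≤ R}) :=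
    ⟨by rw [Measure.restrict_apply_univ]; exact (volume_euc_le_ne_top R).lt_top⟩
  have hprod : Integrable (Function.uncurry fun (x : ι → ℝ) ρ =>
      if euc x ≤ ρ then profileWeight α R ρ else 0)
      ((volume.restrict {x : ι → ℝ | euc x ≤ R}).prod (volume.restrict (Set.Ioc 0 R))) := by
    have h2 : Integrable (fun p : (ι → ℝ) × ℝ => (1 : ℝ) * profileWeight α R p.2)
        ((volume.restrict {x : ι → ℝ | euc x ≤ R}).prod (volume.restrict (Set.Ioc 0 R))) :=
      Integrable.mul_prod (integrable_const (1 : ℝ)) hI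
    have hm : MeasurableSet {p : (ι → ℝ) × ℝ | euc p.1 ≤ p.2} :=
      measurableSet_le (continuous_euc.measurable.comp measurable_fst) measurable_snd
    refine (h2.indicator hm).congr (Filter.Eventually.of_forall fun p => ?_)
    simp [Set.indicator, Function.uncurry]
  rw [h1, integral_integral_swap hprod]
  refine setIntegral_congr_fun measurableSet_Ioc fun ρ hρ => ?_
  rw [← volumeReal_euc_le hρ.1.le]
  have : (fun x : ι → ℝ => if euc x ≤ ρ then profileWeight α R ρ else 0) =
      {x : ι → ℝ | euc x ≤ ρ}.indicator fun _ => profileWeight α R ρ := by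
    ext x; simp [Set.indicator]
  have hsub : {x : ι → ℝ | euc x ≤ R} ∩ {x : ι → ℝ | euc x ≤ ρ} = {x : ι → ℝ | euc x ≤ ρ} :=
    Set.inter_eq_right.2 fun x (hx : euc x ≤ ρ) => hx.trans hρ.2
  rw [this, setIntegral_indicator (measurableSet_le continuous_euc.measurable measurable_const),
    hsub, setIntegral_const, smul_eq_mul]

theorem monotone_card_latticeBall : Monotone fun ρ : ℝ => ((latticeBall ι ρ).card : ℝ) :=
  fun ρ σ h => by
    have : latticeBall ι ρ ⊆ latticeBall ι σ := fun k hk => by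
      rw [mem_latticeBall] at hk ⊢; linarith
    exact Nat.cast_le.2 (Finset.card_le_card this)

/-- A bounded measurable multiple of the weight is integrable. -/
theorem integrableOn_mul_profileWeight {α R M : ℝ} (hα : 0 < α) {e : ℝ → ℝ}
    (he : Measurable e) (hM : ∀ ρ ∈ Set.Ioc 0 R, |e ρ| ≤ M) :
    IntegrableOn (fun ρ => e ρ * profileWeight α R ρ) (Set.Ioc 0 R) :=
  (integrableOn_profileWeight hα).bdd_mul (c := M) he.aestronglyMeasurable
    ((ae_restrict_iff' measurableSet_Ioc).2 (Filter.Eventually.of_forall hM))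

theorem sum_profile_sub_integral {α R : ℝ} (hα : 0 < α) :
    ∑ k ∈ latticeBall ι R, profile α R (euc (toReal k)) -
      ∫ x in {x : ι → ℝ | euc x ≤ R}, profile α R (euc x) =
      ∫ ρ in Set.Ioc 0 R, ballError ι ρ * profileWeight α R ρ := by
  rw [sum_profile_eq hα, integral_profile_eq hα, ← integral_sub]
  · simp only [ballError, sub_mul]
  · refine integrableOn_mul_profileWeight hα monotone_card_latticeBall.measurable
      (M := (latticeBall ι R).card) fun ρ hρ => ?_
    rw [abs_of_nonneg (Nat.cast_nonneg _)]
    exact monotone_card_latticeBall hρ.2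
  · refine integrableOn_mul_profileWeight hα (by fun_prop)
      (M := unitBallVolume ι * R ^ Fintype.card ι) fun ρ hρ => ?_
    have := unitBallVolume_nonneg (ι := ι)
    have := hρ.1.le
    rw [abs_of_nonneg (by positivity)]
    exact mul_le_mul_of_nonneg_left (pow_le_pow_left₀ hρ.1.le hρ.2 _) unitBallVolume_nonneg

/-- The weight is nonnegative with total mass `profile α R 0 = R²`. -/
theorem abs_sum_profile_sub_integral_le {α R M : ℝ} (hα : 0 < α) (hR : 0 ≤ R)
    (hM : ∀ ρ ∈ Set.Ioc 0 R, |ballError ι ρ| ≤ M) :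
    |∑ k ∈ latticeBall ι R, profile α R (euc (toReal k)) -
      ∫ x in {x : ι → ℝ | euc x ≤ R}, profile α R (euc x)| ≤ M * R ^ 2 := by
  rw [sum_profile_sub_integral hα, ← profile_zero hα hR,
    ← integral_profileWeight hα le_rfl hR, ← integral_const_mul, ← Real.norm_eq_abs]
  refine norm_integral_le_of_norm_le ((integrableOn_profileWeight hα).const_mul M)
    ((ae_restrict_iff' measurableSet_Ioc).2 (Filter.Eventually.of_forall fun ρ hρ => ?_))
  have := profileWeight_nonneg hα hρ.1.le hρ.2
  rw [Real.norm_eq_abs, abs_mul, abs_of_nonneg this]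
  exact mul_le_mul_of_nonneg_right (hM ρ hρ) this

end

/-! ### Slicing the Heisenberg ball -/

theorem mem_heisenbergBall_iff {d : ℕ} {α A R : ℝ} (hα : 0 < α) (hA : 0 < A) (hR : 0 ≤ R)
    (z : EuclideanSpace ℝ (Fin (2 * d))) (t : ℝ) : (z, t) ∈ heisenbergBall d α A R ↔
      ‖z‖ ≤ R ∧ |t| ≤ A ^ (-(2 / α)) * profile α R ‖z‖ := by
  change ‖z‖ ^ α + A * |t| ^ (α / 2) ≤ R ^ α ↔ _
  have hiff : ‖z‖ ≤ R → (‖z‖ ^ α + A * |t| ^ (α / 2) ≤ R ^ α ↔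
      |t| ≤ A ^ (-(2 / α)) * profile α R ‖z‖) := by
    intro hz
    have h1 : 0 ≤ R ^ α - ‖z‖ ^ α := sub_nonneg.2 (Real.rpow_le_rpow (norm_nonneg z) hz hα.le)
    have h2 : A ^ (-(2 / α)) * profile α R ‖z‖ = ((R ^ α - ‖z‖ ^ α) / A) ^ (2 / α) := by
      rw [profile, Real.div_rpow h1 hA.le, Real.rpow_neg hA.le]
      field_simp
    have h3 : |t| = (|t| ^ (α / 2)) ^ (2 / α) := by
      rw [← Real.rpow_mul (abs_nonneg t), show α / 2 * (2 / α) = 1 by field_simp, Real.rpow_one]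
    rw [h2]
    nth_rewrite 2 [h3]
    rw [Real.rpow_le_rpow_iff (by positivity) (by positivity) (by positivity), le_div_iff₀ hA]
    constructor <;> intro h <;> linarith
  constructor
  · intro h
    have hz : ‖z‖ ≤ R := by
      have h1 : 0 ≤ A * |t| ^ (α / 2) := by positivity
      exact (Real.rpow_le_rpow_iff (norm_nonneg z) hR hα).1 (by linarith)
    exact ⟨hz, (hiff hz).1 h⟩
  · rintro ⟨hz, h⟩
    exact (hiff hz).2 h

theorem ncard_inter_heisenbergBall {d : ℕ} {α A R : ℝ} (hα : 0 < α) (hA : 0 < A) (hR : 0 ≤ R) :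
    ((integerLattice d ∩ heisenbergBall d α A R).ncard : ℝ) =
      ∑ k ∈ latticeBall (Fin (2 * d)) R,
        (2 * (⌊A ^ (-(2 / α)) * profile α R (euc (toReal k))⌋ : ℝ) + 1) := by
  set F : (Fin (2 * d) → ℤ) → ℝ := fun k => A ^ (-(2 / α)) * profile α R (euc (toReal k)) with hF
  set P := (latticeBall (Fin (2 * d)) R).sigma fun k => Finset.Icc (-⌊F k⌋) ⌊F k⌋ with hP
  set g : (_ : Fin (2 * d) → ℤ) × ℤ → HeisenbergSpace d :=
    fun p => (WithLp.toLp 2 (toReal p.1), (p.2 : ℝ)) with hg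
  have hmem : ∀ p, p ∈ P ↔ g p ∈ heisenbergBall d α A R := by
    rintro ⟨k, m⟩
    rw [hg, mem_heisenbergBall_iff hα hA hR, hP, Finset.mem_sigma, mem_latticeBall,
      Finset.mem_Icc]
    refine and_congr Iff.rfl ?_
    change _ ↔ |(m : ℝ)| ≤ F k
    rw [← Int.cast_abs, ← Int.le_floor, abs_le]
  have himg : integerLattice d ∩ heisenbergBall d α A R = g '' (P : Set _) := by
    ext ⟨z, t⟩
    constructor
    · rintro ⟨⟨h1, m, hm⟩, h2⟩
      choose k hk using h1
      have he : g ⟨k, m⟩ = (z, t) := by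
        refine Prod.ext ?_ hm.symm
        ext i
        exact (hk i).symm
      exact ⟨⟨k, m⟩, (hmem _).2 (he ▸ h2), he⟩
    · rintro ⟨⟨k, m⟩, h1, h2⟩
      rw [← h2]
      exact ⟨⟨fun i => ⟨k i, rfl⟩, m, rfl⟩, (hmem _).1 h1⟩
  have hinj : Function.Injective g := by
    rintro ⟨k, m⟩ ⟨l, n⟩ h
    rw [hg] at h
    simp only [Prod.mk.injEq, Int.cast_inj, (WithLp.toLp_injective 2).eq_iff] at h
    obtain ⟨h1, rfl⟩ := h
    have : k = l := by
      ext i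
      have := congrFun h1 i
      simpa [toReal] using this
    rw [this]
  rw [himg, Set.ncard_image_of_injective _ hinj, Set.ncard_coe_finset, hP, Finset.card_sigma]
  push_cast
  refine Finset.sum_congr rfl fun k hk => ?_
  rw [mem_latticeBall] at hk
  have h0 : 0 ≤ F k := mul_nonneg (by positivity) (profile_nonneg hα (euc_nonneg _) hk)
  have h1 : 0 ≤ ⌊F k⌋ := Int.floor_nonneg.2 h0
  rw [Int.card_Icc]
  have h2 : (((⌊F k⌋ + 1 - -⌊F k⌋).toNat : ℤ) : ℝ) = 2 * (⌊F k⌋ : ℝ) + 1 := by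
    rw [Int.toNat_of_nonneg (by omega)]
    push_cast; ring
  exact_mod_cast h2

theorem volume_heisenbergBall {d : ℕ} {α A R : ℝ} (hα : 0 < α) (hA : 0 < A) (hR : 0 ≤ R) :
    (volume (heisenbergBall d α A R)).toReal =
      2 * A ^ (-(2 / α)) * ∫ x in {x : Fin (2 * d) → ℝ | euc x ≤ R}, profile α R (euc x) := by
  have hm : MeasurableSet (heisenbergBall d α A R) := by
    refine measurableSet_le (Continuous.measurable ?_) measurable_const
    exact (continuous_fst.norm.rpow_const fun _ => Or.inr hα.le).add
      (continuous_const.mul (continuous_snd.abs.rpow_const fun _ => Or.inr (by positivity)))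
  set Q : EuclideanSpace ℝ (Fin (2 * d)) → ℝ := fun z =>
    if ‖z‖ ≤ R then 2 * (A ^ (-(2 / α)) * profile α R ‖z‖) else 0 with hQ
  have hslice : ∀ z : EuclideanSpace ℝ (Fin (2 * d)),
      volume (Prod.mk z ⁻¹' heisenbergBall d α A R) = ENNReal.ofReal (Q z) := by
    intro z
    by_cases hz : ‖z‖ ≤ R
    · have : Prod.mk z ⁻¹' heisenbergBall d α A R =
          Set.Icc (-(A ^ (-(2 / α)) * profile α R ‖z‖)) (A ^ (-(2 / α)) * profile α R ‖z‖) := by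
        ext t
        rw [Set.mem_preimage, mem_heisenbergBall_iff hα hA hR, Set.mem_Icc, abs_le]
        exact and_iff_right hz
      rw [this, Real.volume_Icc, hQ]
      simp only [if_pos hz]
      congr 1; ring
    · have : Prod.mk z ⁻¹' heisenbergBall d α A R = ∅ := by
        ext t
        rw [Set.mem_preimage, mem_heisenbergBall_iff hα hA hR]
        simp [hz]
      rw [this, hQ]
      simp [hz]
  have hQ0 : ∀ z, 0 ≤ Q z := by
    intro z
    simp only [hQ]
    split_ifs with h
    · have := profile_nonneg hα (norm_nonneg z) h
      positivity
    · exact le_rfl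
  have hQm : Measurable Q := by
    refine Measurable.ite (measurableSet_le measurable_norm measurable_const) ?_ measurable_const
    exact (((continuous_profile hα).comp continuous_norm).measurable.const_mul _).const_mul _
  rw [Measure.volume_eq_prod, Measure.prod_apply hm]
  simp_rw [hslice]
  rw [← integral_eq_lintegral_of_nonneg_ae (Filter.Eventually.of_forall hQ0)
    hQm.aestronglyMeasurable, ← (PiLp.volume_preserving_toLp (Fin (2 * d))).integral_comp
    (MeasurableEquiv.toLp 2 _).measurableEmbedding, ← integral_const_mul,
    ← integral_indicator (measurableSet_le continuous_euc.measurable measurable_const)]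
  congr 1
  ext x
  simp only [hQ, Set.indicator, Set.mem_ofPred_eq]
  change (if euc x ≤ R then 2 * (A ^ (-(2 / α)) * profile α R (euc x)) else 0) = _
  split_ifs
  · ring
  · rfl

/-- A column of length `2x` holds `2⌊x⌋ + 1` lattice points, which is off by at most 1; this is the
first term on the right. -/
theorem latticeError_le {d : ℕ} {α A R : ℝ} (hα : 0 < α) (hA : 0 < A) (hR : 0 ≤ R) :
    latticeError d α A R ≤ (latticeBall (Fin (2 * d)) R).card +
      2 * A ^ (-(2 / α)) * |∑ k ∈ latticeBall (Fin (2 * d)) R, profile α R (euc (toReal k)) -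
        ∫ x in {x : Fin (2 * d) → ℝ | euc x ≤ R}, profile α R (euc x)| := by
  rw [latticeError, ncard_inter_heisenbergBall hα hA hR, volume_heisenbergBall hα hA hR]
  set c := A ^ (-(2 / α)) with hc
  have hc0 : 0 ≤ c := by positivity
  have h1 : |∑ k ∈ latticeBall (Fin (2 * d)) R, ((2 * (⌊c * profile α R (euc (toReal k))⌋ : ℝ) + 1) -
      2 * (c * profile α R (euc (toReal k))))| ≤ (latticeBall (Fin (2 * d)) R).card := by
    refine (Finset.abs_sum_le_sum_abs _ _).trans ?_
    rw [Finset.card_eq_sum_ones, Nat.cast_sum]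
    refine Finset.sum_le_sum fun k _ => ?_
    have h2 := Int.floor_le (c * profile α R (euc (toReal k)))
    have h3 := Int.lt_floor_add_one (c * profile α R (euc (toReal k)))
    rw [Nat.cast_one, abs_le]
    constructor <;> linarith
  have h2 : 2 * c * |∑ k ∈ latticeBall (Fin (2 * d)) R, profile α R (euc (toReal k)) -
        ∫ x in {x : Fin (2 * d) → ℝ | euc x ≤ R}, profile α R (euc x)| =
      |2 * c * (∑ k ∈ latticeBall (Fin (2 * d)) R, profile α R (euc (toReal k)) -
        ∫ x in {x : Fin (2 * d) → ℝ | euc x ≤ R}, profile α R (euc x))| := by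
    rw [abs_mul, abs_of_nonneg (by positivity : 0 ≤ 2 * c)]
  rw [h2]
  refine le_trans (le_of_eq ?_) ((abs_add_le _ _).trans (add_le_add_left h1 _))
  congr 1
  rw [Finset.sum_sub_distrib, mul_sub, Finset.mul_sum]
  have : ∀ k : Fin (2 * d) → ℤ, 2 * (c * profile α R (euc (toReal k))) =
    2 * c * profile α R (euc (toReal k)) := fun k => by ring
  simp_rw [this]
  ring

/-! ### The circle problem in terms of the sawtooth function -/

/-- Cauchy–Schwarz for two points of the circle. It replaces concavity: chords lie below the arc and
tangents above it. -/
theorem sqrt_sub_sq_mul_add_le {ρ x u : ℝ} (hx : x ^ 2 ≤ ρ ^ 2) (hu : u ^ 2 ≤ ρ ^ 2) :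
    √(ρ ^ 2 - x ^ 2) * √(ρ ^ 2 - u ^ 2) + x * u ≤ ρ ^ 2 := by
  have h1 := Real.sq_sqrt (sub_nonneg.2 hx)
  have h2 := Real.sq_sqrt (sub_nonneg.2 hu)
  nlinarith [sq_nonneg (√(ρ ^ 2 - x ^ 2) - √(ρ ^ 2 - u ^ 2)), sq_nonneg (x - u)]

theorem continuous_sqrt_sub_sq (ρ : ℝ) : Continuous fun x : ℝ => √(ρ ^ 2 - x ^ 2) := by fun_prop

/-- The trapezoidal rule on a unit interval for the circle, with the error controlled by the
increment of the slope. -/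
theorem trapezoid_sqrt_sub_sq {ρ x : ℝ} (hx : 0 ≤ x) (hρ : x + 1 < ρ) :
    (√(ρ ^ 2 - x ^ 2) + √(ρ ^ 2 - (x + 1) ^ 2)) / 2 ≤
      ∫ u in x..(x + 1), √(ρ ^ 2 - u ^ 2) ∧
    ∫ u in x..(x + 1), √(ρ ^ 2 - u ^ 2) ≤
      (√(ρ ^ 2 - x ^ 2) + √(ρ ^ 2 - (x + 1) ^ 2)) / 2 +
        ((x + 1) / √(ρ ^ 2 - (x + 1) ^ 2) - x / √(ρ ^ 2 - x ^ 2)) / 4 := by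
  have hp1 : 0 < ρ ^ 2 - (x + 1) ^ 2 := by nlinarith
  have hp0 : 0 < ρ ^ 2 - x ^ 2 := by nlinarith
  set a := √(ρ ^ 2 - x ^ 2) with ha
  set b := √(ρ ^ 2 - (x + 1) ^ 2) with hb
  have ha0 : 0 < a := Real.sqrt_pos.2 hp0
  have hb0 : 0 < b := Real.sqrt_pos.2 hp1
  have ha2 : a ^ 2 = ρ ^ 2 - x ^ 2 := Real.sq_sqrt hp0.le
  have hb2 : b ^ 2 = ρ ^ 2 - (x + 1) ^ 2 := Real.sq_sqrt hp1.le
  have hc := continuous_sqrt_sub_sq ρ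
  have hlin : ∀ p q : ℝ, ∫ u in x..(x + 1), (p + q * (u - x)) = p + q / 2 := by
    intro p q
    rw [intervalIntegral.integral_add (by simp) ((Continuous.intervalIntegrable (by fun_prop) _ _)),
      intervalIntegral.integral_const_mul, intervalIntegral.integral_comp_sub_right (fun u => u)]
    simp
    ring
  have hle : x ≤ x + 1 := by linarith
  have hmono : ∀ f g : ℝ → ℝ, Continuous f → Continuous g → (∀ u ∈ Set.Icc x (x + 1), f u ≤ g u) →
      ∫ u in x..(x + 1), f u ≤ ∫ u in x..(x + 1), g u := fun f g hf hg h =>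
    intervalIntegral.integral_mono_on hle (hf.intervalIntegrable _ _) (hg.intervalIntegrable _ _) h
  have hu2 : ∀ u ∈ Set.Icc x (x + 1), u ^ 2 ≤ ρ ^ 2 := fun u hu => by nlinarith [hu.1, hu.2]
  constructor
  · have h1 := hmono (fun u => a + (b - a) * (u - x)) _ (by fun_prop) hc fun u hu => by
      apply Real.le_sqrt_of_sq_le
      have h2 : a * b + x * (x + 1) ≤ ρ ^ 2 :=
        sqrt_sub_sq_mul_add_le (by nlinarith) (by nlinarith)
      have h3 : 0 ≤ u - x := by linarith [hu.1]
      have h4 : 0 ≤ 1 - (u - x) := by linarith [hu.2]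
      obtain ⟨t, rfl⟩ : ∃ t, u = x + t := ⟨u - x, by ring⟩
      rw [add_sub_cancel_left] at *
      have h5 := mul_nonneg h3 h4
      have e1 : (a + (b - a) * t) ^ 2 = (1 - t) ^ 2 * a ^ 2 + t ^ 2 * b ^ 2 +
        2 * (t * (1 - t)) * (a * b) := by ring
      rw [e1, ha2, hb2]
      nlinarith
    rw [hlin] at h1
    linarith
  · have h1 := hmono _ (fun u => a + (-(x / a)) * (u - x)) hc (by fun_prop) fun u hu => by
      have h2 := sqrt_sub_sq_mul_add_le (hu2 u hu) (u := x) (by nlinarith)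
      rw [← ha] at h2
      have : a + -(x / a) * (u - x) = (ρ ^ 2 - u * x) / a := by
        field_simp; linarith
      rw [this, le_div_iff₀ ha0]
      linarith
    have h1' := hmono _ (fun u => (b + (x + 1) / b) + (-((x + 1) / b)) * (u - x)) hc (by fun_prop)
      fun u hu => by
      have h2 := sqrt_sub_sq_mul_add_le (hu2 u hu) (u := x + 1) (by nlinarith)
      rw [← hb] at h2
      have : b + (x + 1) / b + -((x + 1) / b) * (u - x) = (ρ ^ 2 - u * (x + 1)) / b := by
        field_simp; linarith
      rw [this, le_div_iff₀ hb0]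
      linarith
    rw [hlin] at h1 h1'
    linarith

/-- The errors on unit intervals are nonnegative and bounded by slope increments, which telescope to
the final slope. At `M ≤ ρ / √2` that slope is at most 1, hence the use of an octant. -/
theorem trapezoid_sum_sqrt_sub_sq {ρ : ℝ} {M : ℕ} (hM : (M : ℝ) < ρ) :
    |(∫ u in (0 : ℝ)..M, √(ρ ^ 2 - u ^ 2)) - (∑ n ∈ Finset.Ico 1 (M + 1), √(ρ ^ 2 - (n : ℝ) ^ 2) +
      ρ / 2 - √(ρ ^ 2 - (M : ℝ) ^ 2) / 2)| ≤ M / √(ρ ^ 2 - (M : ℝ) ^ 2) / 4 := by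
  have key : 0 ≤ (∫ u in (0 : ℝ)..M, √(ρ ^ 2 - u ^ 2)) -
      (∑ n ∈ Finset.Ico 1 (M + 1), √(ρ ^ 2 - (n : ℝ) ^ 2) + ρ / 2 - √(ρ ^ 2 - (M : ℝ) ^ 2) / 2) ∧
      (∫ u in (0 : ℝ)..M, √(ρ ^ 2 - u ^ 2)) -
      (∑ n ∈ Finset.Ico 1 (M + 1), √(ρ ^ 2 - (n : ℝ) ^ 2) + ρ / 2 - √(ρ ^ 2 - (M : ℝ) ^ 2) / 2) ≤
      M / √(ρ ^ 2 - (M : ℝ) ^ 2) / 4 := by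
    induction M with
    | zero =>
      have : 0 ≤ ρ := by simpa using hM.le
      simp [Real.sqrt_sq this]
    | succ M ih =>
      have hM' : (M : ℝ) < ρ := by push_cast at hM; linarith
      obtain ⟨h1, h2⟩ := ih hM'
      obtain ⟨h3, h4⟩ := trapezoid_sqrt_sub_sq (ρ := ρ) (x := M) (Nat.cast_nonneg M)
        (by exact_mod_cast hM)
      have hint : ∀ p q : ℝ, IntervalIntegrable (fun u : ℝ => √(ρ ^ 2 - u ^ 2)) volume p q :=
        fun p q => (continuous_sqrt_sub_sq ρ).intervalIntegrable _ _
      rw [Finset.sum_Ico_succ_top (by omega)]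
      push_cast
      rw [← intervalIntegral.integral_add_adjacent_intervals (hint 0 M) (hint M (M + 1))]
      constructor <;> linarith
  rw [abs_of_nonneg key.1]
  exact key.2

theorem integral_sqrt_sub_sq {ρ : ℝ} (hρ : 0 < ρ) :
    ∫ u in (0 : ℝ)..(ρ / √2), √(ρ ^ 2 - u ^ 2) = (ρ ^ 2 / 2 + ρ ^ 2 * (Real.pi / 4)) / 2 := by
  have h2 : (√2) ^ 2 = (2 : ℝ) := Real.sq_sqrt (by norm_num)
  have h20 : 0 < √(2 : ℝ) := by positivity
  have hlt : ρ / √2 < ρ := by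
    rw [div_lt_iff₀ h20]
    nlinarith
  have hd : ∀ u ∈ Set.uIcc 0 (ρ / √2), HasDerivAt
      (fun u => (u * √(ρ ^ 2 - u ^ 2) + ρ ^ 2 * Real.arcsin (u / ρ)) / 2) (√(ρ ^ 2 - u ^ 2)) u := by
    intro u hu
    rw [Set.uIcc_of_le (by positivity)] at hu
    have h0 := hu.1
    have h1 : u < ρ := hu.2.trans_lt hlt
    have hp : 0 < ρ ^ 2 - u ^ 2 := by nlinarith
    have hs : 0 < √(ρ ^ 2 - u ^ 2) := Real.sqrt_pos.2 hp
    have hq : √(1 - (u / ρ) ^ 2) = √(ρ ^ 2 - u ^ 2) / ρ := by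
      rw [show 1 - (u / ρ) ^ 2 = (ρ ^ 2 - u ^ 2) / ρ ^ 2 by field_simp, Real.sqrt_div hp.le,
        Real.sqrt_sq hρ.le]
    have d1 : HasDerivAt (fun u : ℝ => √(ρ ^ 2 - u ^ 2)) _ u :=
      (((hasDerivAt_pow 2 u).const_sub (ρ ^ 2)).sqrt hp.ne')
    have d2' := Real.hasDerivAt_arcsin (x := u / ρ) (by
        have : 0 ≤ u / ρ := by positivity
        linarith) (by rw [Ne, div_eq_one_iff_eq hρ.ne']; exact h1.ne)
    have d2 : HasDerivAt (fun u : ℝ => Real.arcsin (u / ρ)) (1 / √(1 - (u / ρ) ^ 2) * (1 / ρ)) u :=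
      HasDerivAt.comp (h₂ := Real.arcsin) (h := fun u => u / ρ) u d2'
        ((hasDerivAt_id' u).div_const ρ)
    have d3 := (((hasDerivAt_id' u).mul d1).add (d2.const_mul (ρ ^ 2))).div_const 2
    refine d3.congr_deriv ?_
    rw [hq]
    have h3 := Real.sq_sqrt hp.le
    generalize √(ρ ^ 2 - u ^ 2) = s at *
    field_simp
    push_cast
    norm_num
    nlinarith
  rw [intervalIntegral.integral_eq_sub_of_hasDerivAt hd
    ((continuous_sqrt_sub_sq ρ).intervalIntegrable _ _)]
  have e1 : ρ / √2 / ρ = Real.sin (Real.pi / 4) := by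
    rw [Real.sin_pi_div_four]; field_simp; rw [h2]
  have e2 : √(ρ ^ 2 - (ρ / √2) ^ 2) = ρ / √2 := by
    rw [Real.sqrt_eq_iff_mul_self_eq (by rw [div_pow, h2]; nlinarith) (by positivity)]
    field_simp; rw [h2]; norm_num
  rw [e1, e2, Real.arcsin_sin (by linarith [Real.pi_pos]) (by linarith [Real.pi_pos])]
  simp only [zero_mul, zero_div, Real.arcsin_zero, mul_zero, add_zero, sub_zero]
  congr 2
  field_simp; rw [h2]

/-- This is the formula of `card_latticeBall_two` with `2√(ρ² - n²)` in place of `2⌊√(ρ² - n²)⌋ +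
1`: two strips minus the square in which they meet. The trapezoidal rule identifies it with the area
of the disc. -/
theorem abs_sum_sqrt_sub_sq_sub_le {ρ : ℝ} (hρ : 0 ≤ ρ) :
    |4 * (ρ + 2 * ∑ n ∈ Finset.Ico 1 (⌊ρ / √2⌋₊ + 1), √(ρ ^ 2 - (n : ℝ) ^ 2)) -
      (2 * (⌊ρ / √2⌋₊ : ℝ) + 1) ^ 2 - Real.pi * ρ ^ 2| ≤ 23 := by
  rcases hρ.eq_or_lt with rfl | hρ
  · simp
  have h2 : (√2) ^ 2 = (2 : ℝ) := Real.sq_sqrt (by norm_num)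
  have h20 : 0 < √(2 : ℝ) := by positivity
  set c := ρ / √2 with hc
  have hc0 : 0 < c := by positivity
  have hcc : ρ ^ 2 = 2 * c ^ 2 := by rw [hc, div_pow, h2]; ring
  set M := ⌊c⌋₊ with hMdef
  have hM1 : (M : ℝ) ≤ c := Nat.floor_le hc0.le
  have hM2 : c < M + 1 := Nat.lt_floor_add_one c
  have hM0 : (0 : ℝ) ≤ M := Nat.cast_nonneg M
  have hMρ : (M : ℝ) < ρ := by nlinarith
  have hint : ∀ p q : ℝ, IntervalIntegrable (fun u : ℝ => √(ρ ^ 2 - u ^ 2)) volume p q :=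
    fun p q => (continuous_sqrt_sub_sq ρ).intervalIntegrable _ _
  have hT := trapezoid_sum_sqrt_sub_sq hMρ
  have hF := integral_sqrt_sub_sq hρ
  rw [← intervalIntegral.integral_add_adjacent_intervals (hint 0 M) (hint M _)] at hF
  set y := √(ρ ^ 2 - (M : ℝ) ^ 2) with hy
  have hyc : c ≤ y := Real.le_sqrt_of_sq_le (by nlinarith)
  have hyc' : y ≤ c + 1 := by
    rw [hy]; apply Real.sqrt_le_iff.2 ⟨by positivity, by nlinarith⟩
  have hMy : M / y ≤ 1 := by rw [div_le_one (by linarith)]; linarith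
  have hI1 : (c - M) * c ≤ ∫ u in (M : ℝ)..c, √(ρ ^ 2 - u ^ 2) := by
    have := intervalIntegral.integral_mono_on hM1 (f := fun _ => c) (by simp) (hint M c)
      fun u hu => Real.le_sqrt_of_sq_le (by nlinarith [hu.1, hu.2])
    simpa using this
  have hI2 : ∫ u in (M : ℝ)..c, √(ρ ^ 2 - u ^ 2) ≤ (c - M) * (c + 1) := by
    have := intervalIntegral.integral_mono_on hM1 (g := fun _ => c + 1) (hint M c) (by simp)
      fun u hu => Real.sqrt_le_iff.2 ⟨by positivity, by nlinarith [hu.1, hu.2]⟩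
    rwa [intervalIntegral.integral_const, smul_eq_mul] at this
  set I := ∫ u in (M : ℝ)..c, √(ρ ^ 2 - u ^ 2)
  set J := ∫ u in (0 : ℝ)..M, √(ρ ^ 2 - u ^ 2)
  set S := ∑ n ∈ Finset.Ico 1 (M + 1), √(ρ ^ 2 - (n : ℝ) ^ 2)
  obtain ⟨f, hf⟩ : ∃ f, f = c - (M : ℝ) := ⟨_, rfl⟩
  have hM3 : (M : ℝ) = c - f := by linarith
  have hf0 : 0 ≤ f := by linarith
  have hf1 : f ≤ 1 := by linarith
  rw [abs_le] at hT ⊢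
  rw [show c - M = f by linarith] at hI1 hI2
  rw [hM3] at *
  have hff : f ^ 2 ≤ 1 := pow_le_one₀ hf0 hf1
  have hff0 := sq_nonneg f
  rw [hcc] at hF ⊢
  constructor <;> linarith

theorem unitBallVolume_fin_two : unitBallVolume (Fin 2) = Real.pi := by
  rw [unitBallVolume, measureReal_def, volume_euc_le, EuclideanSpace.volume_closedBall_fin_two]
  simp [Real.pi_pos.le]

theorem sum_Icc_neg_eq_of_even {f : ℤ → ℝ} (hf : ∀ n, f (-n) = f n) (M : ℕ) :
    ∑ m ∈ Finset.Icc (-(M : ℤ)) M, f m = f 0 + 2 * ∑ n ∈ Finset.Ico 1 (M + 1), f n := by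
  induction M with
  | zero => simp
  | succ M ih =>
    have : Finset.Icc (-((M + 1 : ℕ) : ℤ)) ((M + 1 : ℕ) : ℤ) =
        insert ((M : ℤ) + 1) (insert (-((M : ℤ) + 1)) (Finset.Icc (-(M : ℤ)) M)) := by
      ext x; simp only [Finset.mem_Icc, Finset.mem_insert]; push_cast; omega
    rw [this, Finset.sum_insert (by simp [Finset.mem_Icc]; omega), Finset.sum_insert (by simp), ih, hf,
      Finset.sum_Ico_succ_top (b := M + 1) (by omega)]
    push_cast; ring

/-- Every point of the disc has a coordinate of absolute value at most `ρ / √2`. The two strips so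
defined are exchanged by swapping coordinates, and they meet in the full square of side `2M + 1`,
which lies inside the disc. -/
theorem card_latticeBall_two {ρ : ℝ} (hρ : 0 ≤ ρ) : ((latticeBall (Fin 2) ρ).card : ℝ) =
    2 * ∑ m ∈ Finset.Icc (-(⌊ρ / √2⌋₊ : ℤ)) ⌊ρ / √2⌋₊, (2 * (⌊√(ρ ^ 2 - (m : ℝ) ^ 2)⌋ : ℝ) + 1) -
      (2 * (⌊ρ / √2⌋₊ : ℝ) + 1) ^ 2 := by
  have h2 : (√2) ^ 2 = (2 : ℝ) := Real.sq_sqrt (by norm_num)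
  have h20 : 0 < √(2 : ℝ) := by positivity
  set c := ρ / √2 with hc
  have hc0 : 0 ≤ c := by positivity
  have hcc : ρ ^ 2 = 2 * c ^ 2 := by rw [hc, div_pow, h2]; ring
  set M := ⌊c⌋₊ with hMdef
  have hM1 : (M : ℝ) ≤ c := Nat.floor_le hc0
  have hM2 : c < M + 1 := Nat.lt_floor_add_one c
  set I := Finset.Icc (-(M : ℤ)) M with hI
  have hIsq : ∀ m ∈ I, (m : ℝ) ^ 2 ≤ c ^ 2 := by
    intro m hm
    rw [hI, Finset.mem_Icc] at hm
    have h3 : -(M : ℝ) ≤ m := by exact_mod_cast hm.1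
    have h4 : (m : ℝ) ≤ M := by exact_mod_cast hm.2
    exact sq_le_sq' (by linarith) (by linarith)
  have hmem : ∀ k : Fin 2 → ℤ, k ∈ latticeBall (Fin 2) ρ ↔ (k 0 : ℝ) ^ 2 + (k 1 : ℝ) ^ 2 ≤ ρ ^ 2 := by
    intro k
    rw [mem_latticeBall, ← pow_le_pow_iff_left₀ (euc_nonneg _) hρ two_ne_zero, euc_sq,
      Fin.sum_univ_two]
    rfl
  set X := (latticeBall (Fin 2) ρ).filter fun k => k 0 ∈ I with hX
  set Y := (latticeBall (Fin 2) ρ).filter fun k => k 1 ∈ I with hY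
  have hXY : X ∪ Y = latticeBall (Fin 2) ρ := by
    rw [hX, hY, ← Finset.filter_or, Finset.filter_true_of_mem]
    intro k hk
    rw [hmem] at hk
    by_contra! hcon
    have hbig : ∀ m : ℤ, m ∉ I → c ^ 2 < (m : ℝ) ^ 2 := by
      intro m hm
      rw [hI, Finset.mem_Icc, not_and_or, not_le, not_le] at hm
      rw [← sq_abs (m : ℝ)]
      have : (M : ℝ) + 1 ≤ |(m : ℝ)| := by
        have : (M : ℤ) + 1 ≤ |m| := by
          rcases hm with h | h
          · exact le_trans (by omega) (neg_le_abs m)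
          · exact le_trans (by omega) (le_abs_self m)
        exact_mod_cast this
      exact pow_lt_pow_left₀ (by linarith) hc0 two_ne_zero
    have h3 := hbig _ hcon.1
    have h4 := hbig _ hcon.2
    linarith
  have hswap : Y.card = X.card := by
    refine Finset.card_nbij' (fun k => ![k 1, k 0]) (fun k => ![k 1, k 0]) ?_ ?_ ?_ ?_
    · intro k hk
      simp only [hX, hY, Finset.coe_filter, Set.mem_ofPred_eq, hmem] at hk ⊢
      exact ⟨by simpa [add_comm] using hk.1, by simpa using hk.2⟩
    · intro k hk
      simp only [hX, hY, Finset.coe_filter, Set.mem_ofPred_eq, hmem] at hk ⊢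
      exact ⟨by simpa [add_comm] using hk.1, by simpa using hk.2⟩
    · intro k _; ext i; fin_cases i <;> rfl
    · intro k _; ext i; fin_cases i <;> rfl
  have hinter : (X ∩ Y).card = (I ×ˢ I).card := by
    refine Finset.card_nbij' (fun k => (k 0, k 1)) (fun p => ![p.1, p.2]) ?_ ?_ ?_ ?_
    · intro k hk
      simp only [hX, hY, Finset.coe_inter, Finset.coe_filter, Set.mem_inter_iff,
        Set.mem_ofPred_eq] at hk
      simpa using ⟨hk.1.2, hk.2.2⟩
    · rintro ⟨m, n⟩ hk
      rw [Finset.mem_coe, Finset.mem_product] at hk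
      have h3 : ![m, n] ∈ latticeBall (Fin 2) ρ := by
        rw [hmem]
        have h4 := hIsq _ hk.1
        have h5 := hIsq _ hk.2
        simp only [Matrix.cons_val_zero, Matrix.cons_val_one] at *
        linarith
      simp only [hX, hY, Finset.coe_inter, Finset.coe_filter, Set.mem_inter_iff,
        Set.mem_ofPred_eq]
      exact ⟨⟨h3, hk.1⟩, h3, hk.2⟩
    · intro k _; ext i; fin_cases i <;> rfl
    · rintro ⟨m, n⟩ _; rfl
  have hIcard : I.card = 2 * M + 1 := by rw [hI, Int.card_Icc]; omega
  have hXcard : (X.card : ℝ) = ∑ m ∈ I, (2 * (⌊√(ρ ^ 2 - (m : ℝ) ^ 2)⌋ : ℝ) + 1) := by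
    have : X.card = (I.sigma fun m => Finset.Icc (-⌊√(ρ ^ 2 - (m : ℝ) ^ 2)⌋)
        ⌊√(ρ ^ 2 - (m : ℝ) ^ 2)⌋).card := by
      refine Finset.card_nbij' (fun k => ⟨k 0, k 1⟩) (fun p => ![p.1, p.2]) ?_ ?_ ?_ ?_
      · intro k hk
        simp only [hX, Finset.coe_filter, Set.mem_ofPred_eq, hmem] at hk
        rw [Finset.mem_coe, Finset.mem_sigma]
        refine ⟨hk.2, ?_⟩
        rw [Finset.mem_Icc, ← abs_le, Int.le_floor]
        refine Real.le_sqrt_of_sq_le ?_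
        push_cast
        rw [sq_abs]; linarith [hk.1]
      · rintro ⟨m, n⟩ hk
        rw [Finset.mem_coe, Finset.mem_sigma] at hk
        have h3 := hIsq _ hk.1
        obtain ⟨hk1, hk2⟩ := hk
        simp only at hk1 hk2 h3
        rw [Finset.mem_Icc, ← abs_le, Int.le_floor] at hk2
        have h4 := pow_le_pow_left₀ (by positivity) hk2 2
        rw [Real.sq_sqrt (by nlinarith)] at h4
        push_cast at h4
        rw [sq_abs] at h4
        simp only [hX, Finset.coe_filter, Set.mem_ofPred_eq, hmem, Matrix.cons_val_zero,
          Matrix.cons_val_one]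
        exact ⟨by linarith, hk1⟩
      · intro k _; ext i; fin_cases i <;> rfl
      · rintro ⟨m, n⟩ _; rfl
    rw [this, Finset.card_sigma]
    push_cast
    refine Finset.sum_congr rfl fun m _ => ?_
    have h1 : 0 ≤ ⌊√(ρ ^ 2 - (m : ℝ) ^ 2)⌋ := Int.floor_nonneg.2 (Real.sqrt_nonneg _)
    rw [Int.card_Icc]
    have h2 : (((⌊√(ρ ^ 2 - (m : ℝ) ^ 2)⌋ + 1 - -⌊√(ρ ^ 2 - (m : ℝ) ^ 2)⌋).toNat : ℤ) : ℝ) =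
        2 * (⌊√(ρ ^ 2 - (m : ℝ) ^ 2)⌋ : ℝ) + 1 := by
      rw [Int.toNat_of_nonneg (by omega)]
      push_cast; ring
    exact_mod_cast h2
  have h3 := Finset.card_union_add_card_inter X Y
  rw [hXY, hswap, hinter, Finset.card_product, hIcard] at h3
  have h4 : ((latticeBall (Fin 2) ρ).card : ℝ) + (2 * M + 1) * (2 * M + 1) = X.card + X.card := by
    exact_mod_cast h3
  rw [← hXcard]
  linarith

/-- The sawtooth function. -/
noncomputable def sawtooth (t : ℝ) : ℝ := Int.fract t - 1 / 2

theorem abs_sawtooth_le (t : ℝ) : |sawtooth t| ≤ 1 / 2 := by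
  have h1 := Int.fract_nonneg t
  have h2 := (Int.fract_lt_one t).le
  rw [sawtooth, abs_le]
  constructor <;> linarith

/-- The factor 8 counts two strips and two choices of sign in each coordinate. The central column
contributes `4 · sawtooth ρ`, at most 2, which raises the constant from 23 to 25. -/
theorem abs_ballError_two_add_le {ρ : ℝ} (hρ : 0 ≤ ρ) :
    |ballError (Fin 2) ρ + 8 * ∑ n ∈ Finset.Ico 1 (⌊ρ / √2⌋₊ + 1), sawtooth (√(ρ ^ 2 - (n : ℝ) ^ 2))| ≤
      25 := by
  rw [ballError, card_latticeBall_two hρ, unitBallVolume_fin_two, Fintype.card_fin,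
    sum_Icc_neg_eq_of_even (fun n => by push_cast; rw [neg_sq])]
  have h1 := abs_sum_sqrt_sub_sq_sub_le hρ
  set M := ⌊ρ / √2⌋₊
  have h2 : ∀ t : ℝ, 2 * (⌊t⌋ : ℝ) + 1 = 2 * t - 2 * sawtooth t := fun t => by
    rw [sawtooth, Int.fract]; ring
  simp_rw [h2]
  rw [Finset.sum_sub_distrib, ← Finset.mul_sum, ← Finset.mul_sum]
  simp only [Int.cast_natCast, Int.cast_zero, ne_eq, OfNat.ofNat_ne_zero, not_false_eq_true,
    zero_pow, sub_zero, Real.sqrt_sq hρ]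
  have h3 := abs_sawtooth_le ρ
  rw [abs_le] at *
  constructor <;> linarith

/-! ### Smoothing the sawtooth by Bernoulli functions and Fourier series -/

/-- The periodic second Bernoulli function. -/
noncomputable def periodicBernoulliTwo (y : ℝ) : ℝ := Int.fract y ^ 2 - Int.fract y + 1 / 6

/-- Away from the integers the function is quadratic with derivative `2 · sawtooth`, and at the
integers its slope jumps downwards, so it stays below its tangent parabola. As `h` may have either
sign, the sawtooth gets bounds on both sides. -/
theorem periodicBernoulliTwo_sub_le (y h : ℝ) :
    periodicBernoulliTwo (y + h) - periodicBernoulliTwo y ≤ 2 * h * sawtooth y + h ^ 2 := by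
  rw [periodicBernoulliTwo, periodicBernoulliTwo, sawtooth]
  have h0 := Int.fract_nonneg (y + h)
  have h1 := (Int.fract_lt_one (y + h)).le
  have e1 : Int.fract y = y - ⌊y⌋ := rfl
  have e2 : h = Int.fract (y + h) - Int.fract y + ((⌊y + h⌋ - ⌊y⌋ : ℤ) : ℝ) := by
    rw [Int.fract, Int.fract]; push_cast; ring
  set s := Int.fract (y + h)
  set t := Int.fract y
  -- This product is exactly the gap between the two sides. It is nonnegative because the first
  -- factor is an integer `j` and `-1 ≤ 2s - 1 ≤ 1`.
  have key : 0 ≤ ((⌊y + h⌋ - ⌊y⌋ : ℤ) : ℝ) * (2 * s - 1 + ((⌊y + h⌋ - ⌊y⌋ : ℤ) : ℝ)) := by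
    generalize ⌊y + h⌋ - ⌊y⌋ = j
    rcases lt_trichotomy j 0 with hj | rfl | hj
    · have : (j : ℝ) ≤ -1 := by exact_mod_cast (by omega : j ≤ -1)
      exact mul_nonneg_of_nonpos_of_nonpos (by linarith) (by linarith)
    · simp
    · have : (1 : ℝ) ≤ j := by exact_mod_cast (by omega : 1 ≤ j)
      exact mul_nonneg (by linarith) (by linarith)
  set j := ((⌊y + h⌋ - ⌊y⌋ : ℤ) : ℝ)
  have e3 : 2 * h * (t - 1 / 2) + h ^ 2 = (s - t + j) * (s + t - 1 + j) := by
    linear_combination (2 * t - 1 + h + (s - t + j)) * e2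
  rw [e3]
  nlinarith

theorem hasSum_periodicBernoulliTwo (y : ℝ) :
    HasSum (fun k : ℕ => 1 / (Real.pi ^ 2 * k ^ 2) * Real.cos (2 * Real.pi * (k * y)))
      (periodicBernoulliTwo y) := by
  have h := (hasSum_one_div_nat_pow_mul_cos one_ne_zero
    (x := Int.fract y) ⟨Int.fract_nonneg y, (Int.fract_lt_one y).le⟩).mul_left (1 / Real.pi ^ 2)
  have hp := Real.pi_pos
  have e1 : (1 : ℝ) / Real.pi ^ 2 * ((-1 : ℝ) ^ (1 + 1) * (2 * Real.pi) ^ (2 * 1) / 2 /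
      (Nat.factorial (2 * 1)) * (Polynomial.map (algebraMap ℚ ℝ)
        (Polynomial.bernoulli (2 * 1))).eval (Int.fract y)) = periodicBernoulliTwo y := by
    simp [Polynomial.bernoulli, Finset.sum_range_succ, Nat.factorial, bernoulli_two, bernoulli_one,
      periodicBernoulliTwo]
    field_simp
    ring
  rw [e1] at h
  have e3 : ∀ k : ℕ, 1 / (Real.pi ^ 2 * k ^ 2) * Real.cos (2 * Real.pi * (k * y)) =
      1 / Real.pi ^ 2 * (1 / (k : ℝ) ^ (2 * 1) * Real.cos (2 * Real.pi * k * Int.fract y)) := by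
    intro k
    have e2 : 2 * Real.pi * k * Int.fract y =
        2 * Real.pi * (k * y) - ((k * ⌊y⌋ : ℤ) : ℝ) * (2 * Real.pi) := by
      rw [Int.fract]; push_cast; ring
    rw [e2, Real.cos_sub_int_mul_two_pi]
    field_simp
  simp_rw [e3]
  exact h

theorem norm_expTwoPi_sub_one_le (x : ℝ) : ‖expTwoPi x - 1‖ ≤ 2 * Real.pi * |x| := by
  have := Real.norm_exp_I_mul_ofReal_sub_one_le (x := 2 * Real.pi * x)
  rw [mul_comm Complex.I] at this
  rw [expTwoPi]
  refine this.trans (le_of_eq ?_)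
  rw [Real.norm_eq_abs, abs_mul, abs_of_pos (by positivity)]

/-- Fourier coefficients of the difference `periodicBernoulliTwo (y + h) - periodicBernoulliTwo y`. -/
noncomputable def bernoulliCoeff (h : ℝ) (k : ℕ) : ℂ :=
  ((1 / (Real.pi ^ 2 * k ^ 2) : ℝ) : ℂ) * (expTwoPi (k * h) - 1)

theorem hasSum_bernoulliCoeff (h y : ℝ) :
    HasSum (fun k : ℕ => (bernoulliCoeff h k * expTwoPi (k * y)).re)
      (periodicBernoulliTwo (y + h) - periodicBernoulliTwo y) := by
  have h1 := (hasSum_periodicBernoulliTwo (y + h)).sub (hasSum_periodicBernoulliTwo y)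
  have e : ∀ k : ℕ, (bernoulliCoeff h k * expTwoPi (k * y)).re =
      1 / (Real.pi ^ 2 * k ^ 2) * Real.cos (2 * Real.pi * (k * (y + h))) -
        1 / (Real.pi ^ 2 * k ^ 2) * Real.cos (2 * Real.pi * (k * y)) := by
    intro k
    change (((1 / (Real.pi ^ 2 * k ^ 2) : ℝ) : ℂ) * (expTwoPi (k * h) - 1) *
      expTwoPi (k * y)).re = _
    rw [mul_assoc, Complex.re_ofReal_mul, sub_mul, one_mul, ← expTwoPi_add, ← mul_sub]
    congr 1
    rw [expTwoPi_eq_mk, expTwoPi_eq_mk]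
    simp only [Complex.sub_re]
    ring_nf
  simp_rw [e]
  exact h1

theorem norm_bernoulliCoeff_le {h : ℝ} (k : ℕ) :
    ‖bernoulliCoeff h k‖ ≤ 1 / (k : ℝ) ^ 2 ∧ ‖bernoulliCoeff h k‖ ≤ |h| / k := by
  rcases Nat.eq_zero_or_pos k with rfl | hk
  · simp [bernoulliCoeff]
  have hk' : (0 : ℝ) < k := by exact_mod_cast hk
  have hp := Real.pi_gt_three
  have h1 : ‖expTwoPi (k * h) - 1‖ ≤ 2 := (norm_sub_le _ _).trans (by simp; norm_num)
  have h2 := norm_expTwoPi_sub_one_le (k * h)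
  rw [bernoulliCoeff, norm_mul, Complex.norm_real, Real.norm_of_nonneg (by positivity)]
  rw [abs_mul, abs_of_pos hk'] at h2
  constructor
  · calc _ ≤ 1 / (Real.pi ^ 2 * k ^ 2) * 2 := by gcongr
      _ = (2 / Real.pi ^ 2) * (1 / (k : ℝ) ^ 2) := by field_simp
      _ ≤ 1 * (1 / (k : ℝ) ^ 2) := by
        gcongr
        rw [div_le_one (by positivity)]; nlinarith
      _ = _ := one_mul _
  · calc _ ≤ 1 / (Real.pi ^ 2 * k ^ 2) * (2 * Real.pi * (k * |h|)) := by gcongr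
      _ = (2 / Real.pi) * (|h| / k) := by field_simp
      _ ≤ 1 * (|h| / k) := by
        gcongr
        rw [div_le_one (by positivity)]; linarith
      _ = _ := one_mul _

/-- The exponential sum over an octant of the circle of radius `ρ`. -/
noncomputable def circleSum (k : ℕ) (ρ : ℝ) : ℂ :=
  ∑ n ∈ Finset.Ico 1 (⌊ρ / √2⌋₊ + 1), expTwoPi (k * √(ρ ^ 2 - (n : ℝ) ^ 2))

theorem continuous_expTwoPi : Continuous expTwoPi := by unfold expTwoPi; fun_prop

theorem measurable_circleSum (k : ℕ) : Measurable (circleSum k) := by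
  have h1 : ∀ N : ℕ, Measurable fun ρ : ℝ =>
      ∑ n ∈ Finset.Ico 1 (N + 1), expTwoPi (k * √(ρ ^ 2 - (n : ℝ) ^ 2)) := by
    intro N
    refine Finset.measurable_sum _ fun n _ => ?_
    have h2 : Continuous fun ρ : ℝ => k * √(ρ ^ 2 - (n : ℝ) ^ 2) := by fun_prop
    exact continuous_expTwoPi.measurable.comp h2.measurable
  have h2 : Measurable fun p : ℝ × ℕ =>
      ∑ n ∈ Finset.Ico 1 (p.2 + 1), expTwoPi (k * √(p.1 ^ 2 - (n : ℝ) ^ 2)) :=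
    measurable_from_prod_countable_left h1
  have h3 : Measurable fun ρ : ℝ => ⌊ρ / √2⌋₊ := Nat.measurable_floor.comp (measurable_id.div_const _)
  have h4 := h2.comp (measurable_id.prodMk h3)
  have h5 : circleSum k = (fun p : ℝ × ℕ =>
      ∑ n ∈ Finset.Ico 1 (p.2 + 1), expTwoPi (k * √(p.1 ^ 2 - (n : ℝ) ^ 2))) ∘
      fun ρ => (id ρ, ⌊ρ / √2⌋₊) := by
    funext ρ
    simp only [circleSum, Function.comp, id]
  rw [h5]
  exact h4

theorem floor_div_sqrt_two_le {ρ : ℝ} (hρ : 0 ≤ ρ) : (⌊ρ / √2⌋₊ : ℝ) ≤ ρ := by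
  refine (Nat.floor_le (by positivity)).trans (div_le_self hρ ?_)
  exact Real.one_le_sqrt.2 (by norm_num)

theorem norm_circleSum_le {ρ : ℝ} (hρ : 0 ≤ ρ) (k : ℕ) : ‖circleSum k ρ‖ ≤ ρ := by
  refine (norm_sum_le _ _).trans ?_
  simpa using floor_div_sqrt_two_le hρ

theorem norm_circleSum_le_sqrt {ρ : ℝ} (hρ : 0 ≤ ρ) {k : ℕ} (hk : 1 ≤ k) :
    ‖circleSum k ρ‖ ≤ 6 * √(k * ρ) := by
  refine norm_circle_expSum_le hρ hk ?_
  have h1 : (⌊ρ / √2⌋₊ : ℝ) ≤ ρ / √2 := Nat.floor_le (by positivity)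
  have h2 := pow_le_pow_left₀ (by positivity) h1 2
  rw [div_pow, Real.sq_sqrt (by norm_num)] at h2
  linarith

theorem ballError_two_mul_le {ρ : ℝ} (hρ : 0 ≤ ρ) (h : ℝ) :
    2 * h * ballError (Fin 2) ρ ≤ 50 * |h| + 8 * h ^ 2 * ρ -
      8 * (∑' k : ℕ, bernoulliCoeff h k * circleSum k ρ).re := by
  set M := ⌊ρ / √2⌋₊ with hM
  have hs : HasSum (fun k : ℕ => (bernoulliCoeff h k * circleSum k ρ).re)
      (∑ n ∈ Finset.Ico 1 (M + 1), (periodicBernoulliTwo (√(ρ ^ 2 - (n : ℝ) ^ 2) + h) -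
        periodicBernoulliTwo (√(ρ ^ 2 - (n : ℝ) ^ 2)))) := by
    have := hasSum_sum (s := Finset.Ico 1 (M + 1)) fun (n : ℕ) _ =>
      hasSum_bernoulliCoeff h (√(ρ ^ 2 - (n : ℝ) ^ 2))
    simpa only [circleSum, Finset.mul_sum, Complex.re_sum] using this
  have hsum : Summable fun k : ℕ => bernoulliCoeff h k * circleSum k ρ := by
    refine Summable.of_norm_bounded (g := fun k : ℕ => 1 / (k : ℝ) ^ 2 * ρ)
      ((Real.summable_one_div_nat_pow.2 one_lt_two).mul_right ρ) fun k => ?_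
    rw [norm_mul]
    exact mul_le_mul (norm_bernoulliCoeff_le k).1 (norm_circleSum_le hρ k) (norm_nonneg _)
      (by positivity)
  rw [Complex.re_tsum hsum, hs.tsum_eq]
  have h1 : ∑ n ∈ Finset.Ico 1 (M + 1), (periodicBernoulliTwo (√(ρ ^ 2 - (n : ℝ) ^ 2) + h) -
      periodicBernoulliTwo (√(ρ ^ 2 - (n : ℝ) ^ 2))) ≤
      2 * h * ∑ n ∈ Finset.Ico 1 (M + 1), sawtooth (√(ρ ^ 2 - (n : ℝ) ^ 2)) + M * h ^ 2 := by
    refine (Finset.sum_le_sum fun n _ => periodicBernoulliTwo_sub_le _ h).trans (le_of_eq ?_)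
    rw [Finset.sum_add_distrib, ← Finset.mul_sum]
    simp
  have h2 := abs_ballError_two_add_le hρ
  rw [← hM] at h2
  set S := ∑ n ∈ Finset.Ico 1 (M + 1), sawtooth (√(ρ ^ 2 - (n : ℝ) ^ 2))
  have h3 : 2 * h * (ballError (Fin 2) ρ + 8 * S) ≤ 2 * |h| * 25 := by
    refine (le_abs_self _).trans ?_
    rw [abs_mul, abs_mul, abs_two]
    gcongr
  have h4 : M * h ^ 2 ≤ ρ * h ^ 2 := by
    gcongr; exact floor_div_sqrt_two_le hρ
  linarith

theorem measurable_ballError (ι : Type*) [Fintype ι] : Measurable (ballError ι) :=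
  (monotone_card_latticeBall.measurable).sub ((measurable_id.pow_const _).const_mul _)

/-- The integral of the circle sums against the profile weight. -/
noncomputable def weightedCircleSum (α R : ℝ) (k : ℕ) : ℂ :=
  ∫ ρ in Set.Ioc 0 R, circleSum k ρ * (profileWeight α R ρ : ℂ)

theorem integrableOn_circleSum_mul {α R : ℝ} (hα : 0 < α) (k : ℕ) :
    IntegrableOn (fun ρ => circleSum k ρ * (profileWeight α R ρ : ℂ)) (Set.Ioc 0 R) :=
  (integrableOn_profileWeight hα).ofReal.bdd_mul (c := R)
    (measurable_circleSum k).aestronglyMeasurable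
    ((ae_restrict_iff' measurableSet_Ioc).2 (Filter.Eventually.of_forall fun _ hρ =>
      (norm_circleSum_le hρ.1.le k).trans hρ.2))

/-- The one-sided estimate is integrated against the weight, and the Fourier series is exchanged
with the integral. The integral over `ρ` is thus taken before absolute values, so its cancellation
is kept. -/
theorem integral_ballError_two_mul_le {α R E : ℝ} (hα : 0 < α) (hR : 0 ≤ R) (h : ℝ)
    (hE : ∀ N : ℕ, ∑ k ∈ Finset.range N,
      min (|h| / k) (1 / (k : ℝ) ^ 2) * ‖weightedCircleSum α R k‖ ≤ E) :
    2 * h * ∫ ρ in Set.Ioc 0 R, ballError (Fin 2) ρ * profileWeight α R ρ ≤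
      50 * |h| * R ^ 2 + 8 * h ^ 2 * R ^ 3 + 8 * E := by
  set w := profileWeight α R with hw
  set μ := volume.restrict (Set.Ioc 0 R) with hμ
  have hwI : Integrable w μ := integrableOn_profileWeight hα
  have hw0 : ∀ ρ ∈ Set.Ioc 0 R, 0 ≤ w ρ := fun ρ hρ => profileWeight_nonneg hα hρ.1.le hρ.2
  have hwint : ∫ ρ, w ρ ∂μ = R ^ 2 := by
    rw [hμ, hw, integral_profileWeight hα le_rfl hR, profile_zero hα hR]
  set F : ℕ → ℝ → ℂ := fun k ρ => bernoulliCoeff h k * (circleSum k ρ * (w ρ : ℂ)) with hF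
  have hFI : ∀ k, Integrable (F k) μ := fun k => (integrableOn_circleSum_mul hα k).const_mul _
  have hFb : ∀ k : ℕ, ∀ ρ ∈ Set.Ioc 0 R, ‖F k ρ‖ ≤ 1 / (k : ℝ) ^ 2 * (R * w ρ) := by
    intro k ρ hρ
    rw [hF, norm_mul, norm_mul, Complex.norm_real, Real.norm_of_nonneg (hw0 ρ hρ)]
    have h1 := hw0 ρ hρ
    have h2 := (norm_circleSum_le hρ.1.le k).trans hρ.2
    gcongr
    exact (norm_bernoulliCoeff_le k).1
  have hk2 : Summable fun k : ℕ => 1 / (k : ℝ) ^ 2 := Real.summable_one_div_nat_pow.2 one_lt_two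
  have hFs : Summable fun k => ∫ ρ, ‖F k ρ‖ ∂μ := by
    refine Summable.of_nonneg_of_le (fun k => integral_nonneg fun _ => norm_nonneg _) (fun k => ?_)
      (hk2.mul_right (R * R ^ 2))
    rw [← hwint, ← integral_const_mul, ← integral_const_mul]
    exact setIntegral_mono_on (hFI k).norm ((hwI.const_mul _).const_mul _) measurableSet_Ioc
      (hFb k)
  have hsum := hasSum_integral_of_summable_integral_norm hFI hFs
  have hFint : ∀ k, ∫ ρ, F k ρ ∂μ = bernoulliCoeff h k * weightedCircleSum α R k := fun k => by
    rw [hF, integral_const_mul]; rfl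
  simp_rw [hFint] at hsum
  have hbound : ‖∫ ρ, ∑' k, F k ρ ∂μ‖ ≤ E := by
    have hle : ∀ k, ‖bernoulliCoeff h k * weightedCircleSum α R k‖ ≤
        min (|h| / k) (1 / (k : ℝ) ^ 2) * ‖weightedCircleSum α R k‖ := fun k => by
      rw [norm_mul]
      gcongr
      exact le_min (norm_bernoulliCoeff_le k).2 (norm_bernoulliCoeff_le k).1
    have hnn : ∀ k : ℕ, 0 ≤ min (|h| / k) (1 / (k : ℝ) ^ 2) * ‖weightedCircleSum α R k‖ :=
      fun k => by positivity
    have hs := summable_of_sum_range_le hnn hE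
    rw [← hsum.tsum_eq]
    exact (tsum_of_norm_bounded hs.hasSum hle).trans (Real.tsum_le_of_sum_range_le hnn hE)
  have hG : Integrable (fun ρ => ∑' k, F k ρ) μ := by
    refine Integrable.mono' (g := fun ρ => (∑' k : ℕ, 1 / (k : ℝ) ^ 2) * (R * w ρ))
      ((hwI.const_mul _).const_mul _)
      (aestronglyMeasurable_of_tendsto_ae Filter.atTop
        (f := fun (N : ℕ) ρ => ∑ k ∈ Finset.range N, F k ρ)
        (fun N => (integrable_finsetSum _ fun k _ => hFI k).aestronglyMeasurable)
        ((ae_restrict_iff' measurableSet_Ioc).2 (Filter.Eventually.of_forall fun ρ hρ => ?_)))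
      ((ae_restrict_iff' measurableSet_Ioc).2 (Filter.Eventually.of_forall fun ρ hρ => ?_))
    · exact (Summable.of_norm_bounded (hk2.mul_right (R * w ρ))
        fun k => hFb k ρ hρ).hasSum.tendsto_sum_nat
    · exact tsum_of_norm_bounded (hk2.hasSum.mul_right (R * w ρ)) fun k => hFb k ρ hρ
  have hbI : Integrable (fun ρ => ballError (Fin 2) ρ * w ρ) μ := by
    refine integrableOn_mul_profileWeight (M := 25 + 8 * R) hα (measurable_ballError _)
      fun ρ hρ => ?_
    have h1 := abs_ballError_two_add_le hρ.1.le
    have h2 : |∑ n ∈ Finset.Ico 1 (⌊ρ / √2⌋₊ + 1), sawtooth (√(ρ ^ 2 - (n : ℝ) ^ 2))| ≤ R := by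
      refine (Finset.abs_sum_le_sum_abs _ _).trans ?_
      refine (Finset.sum_le_sum fun n _ => (abs_sawtooth_le _).trans
        (by norm_num : (1 / 2 : ℝ) ≤ 1)).trans ?_
      simpa using (floor_div_sqrt_two_le hρ.1.le).trans hρ.2
    rw [abs_le] at *
    constructor <;> linarith
  have hre : ∫ ρ, (∑' k, F k ρ).re ∂μ = (∫ ρ, ∑' k, F k ρ ∂μ).re :=
    integral_re hG
  have h1 : ∫ ρ, 2 * h * (ballError (Fin 2) ρ * w ρ) ∂μ ≤
      ∫ ρ, ((50 * |h| + 8 * h ^ 2 * R) * w ρ - 8 * (∑' k, F k ρ).re) ∂μ := by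
    refine setIntegral_mono_on (hbI.const_mul _) ((hwI.const_mul _).sub (hG.re.const_mul _))
      measurableSet_Ioc fun ρ hρ => ?_
    have h2 := ballError_two_mul_le hρ.1.le h
    have h3 := hw0 ρ hρ
    have h4 : (∑' k, F k ρ).re = (∑' k : ℕ, bernoulliCoeff h k * circleSum k ρ).re * w ρ := by
      rw [hF]
      simp only [← mul_assoc]
      rw [tsum_mul_right, Complex.re_mul_ofReal]
    rw [h4]
    have h5 : 8 * h ^ 2 * ρ ≤ 8 * h ^ 2 * R := by
      have := hρ.2
      gcongr
    nlinarith
  have hGre : Integrable (fun ρ => (∑' k, F k ρ).re) μ := hG.re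
  rw [integral_sub (hwI.const_mul _) (hGre.const_mul _), integral_const_mul, integral_const_mul,
    integral_const_mul, hwint] at h1
  have h6 := (abs_le.1 ((Complex.abs_re_le_norm _).trans hbound)).1
  rw [← hre] at h6
  refine h1.trans ?_
  nlinarith

theorem abs_integral_ballError_two_le {α R E : ℝ} (hα : 0 < α) (hR : 0 ≤ R) {K : ℕ} (hK : 1 ≤ K)
    (hE : ∀ N : ℕ, ∑ k ∈ Finset.range N,
      min (1 / (k : ℝ)) (K / (k : ℝ) ^ 2) * ‖weightedCircleSum α R k‖ ≤ E) :
    |∫ ρ in Set.Ioc 0 R, ballError (Fin 2) ρ * profileWeight α R ρ| ≤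
      25 * R ^ 2 + 4 * R ^ 3 / K + 4 * E := by
  have hK0 : (0 : ℝ) < K := by exact_mod_cast hK
  have key : ∀ h : ℝ, |h| = 1 / K →
      2 * h * ∫ ρ in Set.Ioc 0 R, ballError (Fin 2) ρ * profileWeight α R ρ ≤
      50 * |h| * R ^ 2 + 8 * h ^ 2 * R ^ 3 + 8 * (E / K) := by
    -- With `h = ±1/K` the two signs give the two sides of the estimate, and the coefficient bound
    -- times `K` is `min(1/k, K/k²)`.
    intro h hh
    refine integral_ballError_two_mul_le hα hR h fun N => ?_
    rw [le_div_iff₀ hK0, Finset.sum_mul]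
    refine le_trans (le_of_eq (Finset.sum_congr rfl fun k _ => ?_)) (hE N)
    rw [hh, mul_right_comm, min_mul_of_nonneg _ _ hK0.le]
    congr 2
    · field_simp
    · ring
  have h1 := key (1 / K) (abs_of_pos (by positivity))
  have h2 := key (-(1 / K)) (by rw [abs_neg, abs_of_pos (by positivity)])
  rw [abs_neg, neg_sq] at h2
  rw [abs_of_pos (by positivity)] at h1 h2
  set I := ∫ ρ in Set.Ioc 0 R, ballError (Fin 2) ρ * profileWeight α R ρ
  have e1 : 50 * (1 / (K : ℝ)) * R ^ 2 + 8 * (1 / K) ^ 2 * R ^ 3 + 8 * (E / K) =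
      2 * (25 * R ^ 2 + 4 * R ^ 3 / K + 4 * E) / K := by
    field_simp; ring
  rw [e1, le_div_iff₀ hK0] at h1 h2
  have e2 : 2 * (1 / (K : ℝ)) * I * K = 2 * I := by field_simp
  have e3 : 2 * (-(1 / (K : ℝ))) * I * K = -(2 * I) := by field_simp
  rw [e2] at h1
  rw [e3] at h2
  rw [abs_le]
  constructor <;> linarith

/-! ### Integrating the circle sums over the radius -/

/-- The second mean value theorem for integrals, in the form of an inequality. -/
theorem norm_setIntegral_mul_le_of_monotoneOn {τ K : ℝ} (hτ : 0 < τ) {ω : ℝ → ℝ}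
    (hωm : Measurable ω) (hω0 : ∀ ρ ∈ Set.Ioc 0 τ, 0 ≤ ω ρ) (hω : MonotoneOn ω (Set.Ioc 0 τ))
    {b : ℝ → ℂ} (hb : IntegrableOn b (Set.Ioc 0 τ))
    (hB : ∀ s ∈ Set.Icc 0 τ, ‖∫ ρ in Set.Ioc 0 s, b ρ‖ ≤ K) :
    ‖∫ ρ in Set.Ioc 0 τ, b ρ * (ω ρ : ℂ)‖ ≤ 2 * K * ω τ := by
  have hττ : τ ∈ Set.Ioc 0 τ := ⟨hτ, le_rfl⟩
  have hW0 := hω0 τ hττ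
  set f : ℝ → ℝ → ℂ := fun ρ s => if s ≤ ω ρ then b ρ else 0 with hf
  -- The weight `ω` is written as a superposition of indicators of its superlevel sets, so that only
  -- integrals of `b` over those sets are needed.
  have hcake : ∀ ρ ∈ Set.Ioc 0 τ, b ρ * (ω ρ : ℂ) = ∫ s in Set.Ioc 0 (ω τ), f ρ s := by
    intro ρ hρ
    have h1 : f ρ = (Set.Iic (ω ρ)).indicator fun _ => b ρ := by
      funext s; simp [hf, Set.indicator]
    have h2 : Set.Ioc 0 (ω τ) ∩ Set.Iic (ω ρ) = Set.Ioc 0 (ω ρ) := by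
      have := hω hρ hττ hρ.2
      ext s; simp only [Set.mem_inter_iff, Set.mem_Ioc, Set.mem_Iic]
      constructor
      · rintro ⟨⟨h3, _⟩, h4⟩; exact ⟨h3, h4⟩
      · rintro ⟨h3, h4⟩; exact ⟨⟨h3, h4.trans this⟩, h4⟩
    rw [h1, setIntegral_indicator measurableSet_Iic, h2, setIntegral_const, measureReal_def,
      Real.volume_Ioc, sub_zero, ENNReal.toReal_ofReal (hω0 ρ hρ), Complex.real_smul, mul_comm]
  have hint : Integrable (Function.uncurry f)
      ((volume.restrict (Set.Ioc 0 τ)).prod (volume.restrict (Set.Ioc 0 (ω τ)))) := by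
    have h1 : Integrable (fun p : ℝ × ℝ => b p.1)
        ((volume.restrict (Set.Ioc 0 τ)).prod (volume.restrict (Set.Ioc 0 (ω τ)))) :=
      hb.comp_fst _
    have h2 : Function.uncurry f = {p : ℝ × ℝ | p.2 ≤ ω p.1}.indicator fun p => b p.1 := by
      funext p; simp [hf, Set.indicator, Function.uncurry]
    rw [h2]
    exact h1.indicator (measurableSet_le measurable_snd (hωm.comp measurable_fst))
  rw [setIntegral_congr_fun measurableSet_Ioc hcake, integral_integral_swap hint]
  have hinner : ∀ s ∈ Set.Ioc 0 (ω τ), ‖∫ ρ in Set.Ioc 0 τ, f ρ s‖ ≤ 2 * K := by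
    intro s hs
    set S := {ρ | s ≤ ω ρ} with hS
    have hSm : MeasurableSet S := measurableSet_le measurable_const hωm
    have h1 : (fun ρ => f ρ s) = S.indicator b := by
      funext ρ; simp [hf, hS, Set.indicator]
    rw [h1, setIntegral_indicator hSm]
    set U := Set.Ioc 0 τ ∩ S with hU
    have hτU : τ ∈ U := ⟨hττ, hs.2⟩
    have hbdd : BddBelow U := ⟨0, fun ρ hρ => hρ.1.1.le⟩
    set σ := sInf U with hσ
    have hσ0 : 0 ≤ σ := le_csInf ⟨τ, hτU⟩ fun ρ hρ => hρ.1.1.le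
    have hστ : σ ≤ τ := csInf_le hbdd hτU
    -- By monotonicity a superlevel set is an interval ending at `τ`, up to its left end point; over
    -- it the integral of `b` is a difference of two primitives.
    have h2 : U =ᵐ[volume] Set.Ioc σ τ := by
      have h3 : U ≤ᵐ[volume] Set.Icc σ τ :=
        Filter.Eventually.of_forall fun ρ hρ => ⟨csInf_le hbdd hρ, (show ρ ∈ U from hρ).1.2⟩
      refine Filter.EventuallyLE.antisymm (h3.trans Ioc_ae_eq_Icc.symm.le)
        (Filter.Eventually.of_forall fun ρ (hρ : ρ ∈ Set.Ioc σ τ) => ?_)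
      obtain ⟨x, hx, hxρ⟩ := exists_lt_of_csInf_lt ⟨τ, hτU⟩ hρ.1
      have hρ' : ρ ∈ Set.Ioc 0 τ := ⟨hx.1.1.trans hxρ, hρ.2⟩
      exact ⟨hρ', le_trans hx.2 (hω hx.1 hρ' hxρ.le)⟩
    rw [setIntegral_congr_set h2]
    have h3 : ∫ ρ in Set.Ioc 0 τ, b ρ = (∫ ρ in Set.Ioc 0 σ, b ρ) + ∫ ρ in Set.Ioc σ τ, b ρ := by
      rw [← setIntegral_union (Set.Ioc_disjoint_Ioc_of_le le_rfl) measurableSet_Ioc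
        (hb.mono_set (Set.Ioc_subset_Ioc_right hστ)) (hb.mono_set (Set.Ioc_subset_Ioc_left hσ0)),
        Set.Ioc_union_Ioc_eq_Ioc hσ0 hστ]
    rw [show ∫ ρ in Set.Ioc σ τ, b ρ = (∫ ρ in Set.Ioc 0 τ, b ρ) - ∫ ρ in Set.Ioc 0 σ, b ρ by
      rw [h3]; ring]
    refine (norm_sub_le _ _).trans ?_
    linarith [hB τ ⟨hτ.le, le_rfl⟩, hB σ ⟨hσ0, hστ⟩]
  have := norm_setIntegral_le_of_norm_le_const (μ := volume) (s := Set.Ioc 0 (ω τ)) (by simp) hinner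
  rwa [measureReal_def, Real.volume_Ioc, sub_zero, ENNReal.toReal_ofReal hW0] at this

/-- Abel summation against a nonnegative antitone sequence. -/
theorem norm_sum_mul_le_of_antitone {y : ℕ → ℝ} (hy : Antitone y) (hy0 : ∀ n, 0 ≤ y n) {e : ℕ → ℂ}
    {P : ℝ} {M : ℕ} (hP : ∀ m ≤ M, ‖∑ n ∈ Finset.Ico 1 (m + 1), e n‖ ≤ P) :
    ‖∑ n ∈ Finset.Ico 1 (M + 1), (y n : ℂ) * e n‖ ≤ P * y 0 := by
  have key : ∀ m ≤ M, ‖∑ n ∈ Finset.Ico 1 (m + 1), (y n : ℂ) * e n -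
      y m * ∑ n ∈ Finset.Ico 1 (m + 1), e n‖ ≤ P * (y 0 - y m) := by
    intro m hm
    induction m with
    | zero => simp
    | succ m ih =>
      have h1 := ih (by omega)
      have h2 := hP m (by omega)
      rw [Finset.sum_Ico_succ_top (by omega), Finset.sum_Ico_succ_top (b := m + 1) (by omega)]
      set A := ∑ n ∈ Finset.Ico 1 (m + 1), (y n : ℂ) * e n
      set S := ∑ n ∈ Finset.Ico 1 (m + 1), e n
      rw [show A + y (m + 1) * e (m + 1) - y (m + 1) * (S + e (m + 1)) =
        (A - y m * S) + ((y m - y (m + 1) : ℝ) : ℂ) * S by push_cast; ring]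
      have h3 : 0 ≤ y m - y (m + 1) := sub_nonneg.2 (hy (Nat.le_succ m))
      refine (norm_add_le _ _).trans ?_
      rw [norm_mul, Complex.norm_real, Real.norm_of_nonneg h3]
      nlinarith [mul_le_mul_of_nonneg_left h2 h3]
  have h1 := key M le_rfl
  have h2 := mul_le_mul_of_nonneg_left (hP M le_rfl) (hy0 M)
  have h3 := norm_add_le (∑ n ∈ Finset.Ico 1 (M + 1), (y n : ℂ) * e n -
      y M * ∑ n ∈ Finset.Ico 1 (M + 1), e n) (y M * ∑ n ∈ Finset.Ico 1 (M + 1), e n)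
  rw [sub_add_cancel, norm_mul, Complex.norm_real, Real.norm_of_nonneg (hy0 M)] at h3
  linarith

theorem hasDerivAt_expTwoPi_mul (k x : ℝ) :
    HasDerivAt (fun x => expTwoPi (k * x)) (2 * Real.pi * k * Complex.I * expTwoPi (k * x)) x := by
  have h1 : HasDerivAt (fun x : ℝ => ((2 * Real.pi * (k * x) : ℝ) : ℂ) * Complex.I)
      (((2 * Real.pi * k : ℝ) : ℂ) * Complex.I) x := by
    refine (HasDerivAt.ofReal_comp ?_).mul_const _
    simpa [mul_assoc] using (hasDerivAt_id' x).const_mul (2 * Real.pi * k)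
  have h2 := h1.cexp
  refine h2.congr_deriv ?_
  rw [expTwoPi]; push_cast; ring

/-- An antiderivative of `y ↦ y e(ky)`. -/
noncomputable def circlePrimitive (k : ℕ) (y : ℝ) : ℂ :=
  ((y : ℂ) / (2 * Real.pi * k * Complex.I) + 1 / (2 * Real.pi * k) ^ 2) * expTwoPi (k * y)

theorem hasDerivAt_circlePrimitive {k : ℕ} (hk : 1 ≤ k) (y : ℝ) :
    HasDerivAt (circlePrimitive k) ((y : ℂ) * expTwoPi (k * y)) y := by
  have h1 := ((((hasDerivAt_id' y).ofReal_comp).div_const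
    (2 * Real.pi * k * Complex.I)).add_const (1 / (2 * Real.pi * k : ℂ) ^ 2)).mul
    (hasDerivAt_expTwoPi_mul k y)
  refine h1.congr_deriv ?_
  have hk' : (k : ℂ) ≠ 0 := by exact_mod_cast (by omega : k ≠ 0)
  have hp : (Real.pi : ℂ) ≠ 0 := by exact_mod_cast Real.pi_ne_zero
  have hI := Complex.I_ne_zero
  push_cast
  field_simp
  linear_combination expTwoPi (k * y) * Complex.I_sq

/-- Substitute `y = √(ρ² - n²)`, so that `ρ dρ = y dy`. The index `n` is present exactly for `ρ ≥ n
√2`, where `y` starts at the integer `n`. -/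
theorem integral_mul_expTwoPi_circle {k n : ℕ} (hk : 1 ≤ k) (hn : 1 ≤ n) {τ : ℝ}
    (hτ : n * √2 ≤ τ) :
    ∫ ρ in Set.Ioc (n * √2) τ, expTwoPi (k * √(ρ ^ 2 - (n : ℝ) ^ 2)) * (ρ : ℂ) =
      circlePrimitive k (√(τ ^ 2 - (n : ℝ) ^ 2)) - circlePrimitive k n := by
  have h2 : (√2) ^ 2 = (2 : ℝ) := Real.sq_sqrt (by norm_num)
  have h20 : 0 < √(2 : ℝ) := by positivity
  have hn0 : (0 : ℝ) < n := by exact_mod_cast hn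
  have hd : ∀ ρ ∈ Set.uIcc (n * √2) τ,
      HasDerivAt (fun ρ => circlePrimitive k (√(ρ ^ 2 - (n : ℝ) ^ 2)))
        (expTwoPi (k * √(ρ ^ 2 - (n : ℝ) ^ 2)) * (ρ : ℂ)) ρ := by
    intro ρ hρ
    rw [Set.uIcc_of_le hτ] at hρ
    have h3 := pow_le_pow_left₀ (by positivity) hρ.1 2
    rw [mul_pow, h2] at h3
    have h4 : 0 < ρ ^ 2 - (n : ℝ) ^ 2 := by nlinarith
    have h5 : 0 < √(ρ ^ 2 - (n : ℝ) ^ 2) := Real.sqrt_pos.2 h4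
    have d1 := ((hasDerivAt_pow 2 ρ).sub_const ((n : ℝ) ^ 2)).sqrt h4.ne'
    have d2 := HasDerivAt.scomp (h := fun ρ => √(ρ ^ 2 - (n : ℝ) ^ 2)) ρ
      (hasDerivAt_circlePrimitive hk (√(ρ ^ 2 - (n : ℝ) ^ 2))) d1
    refine d2.congr_deriv ?_
    have h6 : (√(ρ ^ 2 - (n : ℝ) ^ 2) : ℂ) ≠ 0 := by exact_mod_cast h5.ne'
    rw [Complex.real_smul]
    push_cast
    field_simp
  have hc : Continuous fun ρ : ℝ => expTwoPi (k * √(ρ ^ 2 - (n : ℝ) ^ 2)) * (ρ : ℂ) := by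
    have h1 : Continuous fun ρ : ℝ => k * √(ρ ^ 2 - (n : ℝ) ^ 2) := by fun_prop
    exact (continuous_expTwoPi.comp h1).mul Complex.continuous_ofReal
  rw [← intervalIntegral.integral_of_le hτ, intervalIntegral.integral_eq_sub_of_hasDerivAt hd
    (hc.intervalIntegrable _ _)]
  congr 2
  rw [mul_pow, h2, show (n : ℝ) ^ 2 * 2 - (n : ℝ) ^ 2 = (n : ℝ) ^ 2 by ring, Real.sqrt_sq hn0.le]

theorem circlePrimitive_natCast {k : ℕ} (n : ℕ) :
    circlePrimitive k n = (n : ℂ) / (2 * Real.pi * k * Complex.I) + 1 / (2 * Real.pi * k) ^ 2 := by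
  have : (k : ℝ) * (n : ℝ) = ((k * n : ℤ) : ℝ) := by push_cast; ring
  rw [circlePrimitive, this, expTwoPi_intCast, mul_one]
  push_cast; ring

theorem integral_circleSum_mul {k : ℕ} (hk : 1 ≤ k) {τ : ℝ} (hτ : 0 ≤ τ) :
    ∫ ρ in Set.Ioc 0 τ, circleSum k ρ * (ρ : ℂ) = ∑ n ∈ Finset.Ico 1 (⌊τ / √2⌋₊ + 1),
      (circlePrimitive k (√(τ ^ 2 - (n : ℝ) ^ 2)) - circlePrimitive k n) := by
  have h20 : 0 < √(2 : ℝ) := by positivity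
  have hc : ∀ n : ℕ, Continuous fun ρ : ℝ => expTwoPi (k * √(ρ ^ 2 - (n : ℝ) ^ 2)) * (ρ : ℂ) := by
    intro n
    have h1 : Continuous fun ρ : ℝ => k * √(ρ ^ 2 - (n : ℝ) ^ 2) := by fun_prop
    exact (continuous_expTwoPi.comp h1).mul Complex.continuous_ofReal
  have h1 : ∀ ρ ∈ Set.Ioc 0 τ, circleSum k ρ * (ρ : ℂ) = ∑ n ∈ Finset.Ico 1 (⌊τ / √2⌋₊ + 1),
      if n * √2 ≤ ρ then expTwoPi (k * √(ρ ^ 2 - (n : ℝ) ^ 2)) * (ρ : ℂ) else 0 := by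
    intro ρ hρ
    rw [circleSum, Finset.sum_mul, ← Finset.sum_filter]
    refine Finset.sum_congr ?_ fun _ _ => rfl
    ext n
    have h2 : n ≤ ⌊ρ / √2⌋₊ ↔ n * √2 ≤ ρ := by
      rw [Nat.le_floor_iff (div_nonneg hρ.1.le h20.le), le_div_iff₀ h20]
    have h3 : ⌊ρ / √2⌋₊ ≤ ⌊τ / √2⌋₊ := Nat.floor_mono (by gcongr; exact hρ.2)
    rw [Finset.mem_filter, ← h2, Finset.mem_Ico, Finset.mem_Ico]
    omega
  rw [setIntegral_congr_fun measurableSet_Ioc h1, integral_finsetSum]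
  · refine Finset.sum_congr rfl fun n hn => ?_
    rw [Finset.mem_Ico] at hn
    have h2 : n * √2 ≤ τ := by
      rw [← le_div_iff₀ h20, ← Nat.le_floor_iff (by positivity)]; omega
    rw [setIntegral_indicator_le (by positivity), integral_mul_expTwoPi_circle hk hn.1 h2]
  · intro n _
    have h2 : (fun ρ : ℝ => if n * √2 ≤ ρ then expTwoPi (k * √(ρ ^ 2 - (n : ℝ) ^ 2)) * (ρ : ℂ) else 0)
        = (Set.Ici (n * √2)).indicator
          fun ρ : ℝ => expTwoPi (k * √(ρ ^ 2 - (n : ℝ) ^ 2)) * (ρ : ℂ) := by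
      funext ρ; simp [Set.indicator]
    rw [h2]
    exact (((hc n).integrableOn_Icc).mono_set Set.Ioc_subset_Icc_self).integrable.indicator
      measurableSet_Ici

theorem sum_Ico_one_natCast (M : ℕ) :
    ∑ n ∈ Finset.Ico 1 (M + 1), (n : ℂ) = (M : ℂ) * (M + 1) / 2 := by
  induction M with
  | zero => simp
  | succ M ih => rw [Finset.sum_Ico_succ_top (by omega), ih]; push_cast; ring

/-- The primitive of `circleSum k ρ * ρ` is `i τ² / (8 π k)` up to a small error. -/
theorem norm_integral_circleSum_sub_le {k : ℕ} (hk : 1 ≤ k) {τ R : ℝ} (hτ : 0 ≤ τ) (hτR : τ ≤ R)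
    (hR : 1 ≤ R) :
    ‖∫ ρ in Set.Ioc 0 τ, (circleSum k ρ - Complex.I / (4 * Real.pi * k)) * (ρ : ℂ)‖ ≤
      3 * (R * √(R / k)) := by
  have hk0 : (0 : ℝ) < k := by exact_mod_cast hk
  have hk1 : (1 : ℝ) ≤ k := by exact_mod_cast hk
  have hR0 : 0 < R := by linarith
  have hp := Real.pi_gt_three
  have h2 : (√2) ^ 2 = (2 : ℝ) := Real.sq_sqrt (by norm_num)
  set M := ⌊τ / √2⌋₊ with hM
  have hM1 : (M : ℝ) ≤ τ / √2 := Nat.floor_le (by positivity)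
  have hM2 : τ / √2 < M + 1 := Nat.lt_floor_add_one _
  have hMτ : (M : ℝ) ≤ τ := floor_div_sqrt_two_le hτ
  have hc2 : (τ / √2) ^ 2 = τ ^ 2 / 2 := by rw [div_pow, h2]
  set y : ℕ → ℝ := fun n => √(τ ^ 2 - (n : ℝ) ^ 2) with hy
  have hI1 : IntegrableOn (fun ρ => circleSum k ρ * (ρ : ℂ)) (Set.Ioc 0 τ) := by
    refine Integrable.bdd_mul (c := τ)
      (Complex.continuous_ofReal.integrableOn_Icc.mono_set Set.Ioc_subset_Icc_self)
      (measurable_circleSum k).aestronglyMeasurable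
      ((ae_restrict_iff' measurableSet_Ioc).2 (Filter.Eventually.of_forall fun ρ hρ =>
        (norm_circleSum_le hρ.1.le k).trans hρ.2))
  have hI2 : IntegrableOn (fun ρ : ℝ => Complex.I / (4 * Real.pi * k) * (ρ : ℂ)) (Set.Ioc 0 τ) :=
    (continuous_const.mul Complex.continuous_ofReal).integrableOn_Icc.mono_set
      Set.Ioc_subset_Icc_self
  have hid : ∫ ρ in Set.Ioc 0 τ, (ρ : ℂ) = (τ : ℂ) ^ 2 / 2 := by
    rw [integral_complex_ofReal, ← intervalIntegral.integral_of_le hτ, integral_id]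
    push_cast; ring
  simp_rw [sub_mul]
  rw [integral_sub hI1 hI2, integral_const_mul, hid, integral_circleSum_mul hk hτ]
  have hkC : (k : ℂ) ≠ 0 := by exact_mod_cast hk0.ne'
  have hpC : (Real.pi : ℂ) ≠ 0 := by exact_mod_cast Real.pi_ne_zero
  have hIC := Complex.I_ne_zero
  -- At the lower end points `y = n` the phase is `e(kn) = 1`, so these do not oscillate; they add
  -- up to `M (M + 1) / 2`, which is `τ² / 4` up to `O(R)`. This is what the constant `i / (4πk)`
  -- compensates. The upper end points oscillate and are treated by Abel summation and van der
  -- Corput.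
  have hsplit : ∑ n ∈ Finset.Ico 1 (M + 1), (circlePrimitive k (√(τ ^ 2 - (n : ℝ) ^ 2)) -
      circlePrimitive k n) - Complex.I / (4 * Real.pi * k) * ((τ : ℂ) ^ 2 / 2) =
      (1 / (2 * Real.pi * k * Complex.I)) * ∑ n ∈ Finset.Ico 1 (M + 1), (y n : ℂ) * expTwoPi (k * y n)
      + (1 / (2 * Real.pi * k) ^ 2) * ∑ n ∈ Finset.Ico 1 (M + 1), (expTwoPi (k * y n) - 1) +
      (1 / (2 * Real.pi * k * Complex.I)) * ((τ : ℂ) ^ 2 / 4 - M * (M + 1) / 2) := by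
    have hterm : ∀ n : ℕ, circlePrimitive k (√(τ ^ 2 - (n : ℝ) ^ 2)) - circlePrimitive k n =
        1 / (2 * Real.pi * k * Complex.I) * ((y n : ℂ) * expTwoPi (k * y n)) +
          1 / (2 * Real.pi * k) ^ 2 * (expTwoPi (k * y n) - 1) -
          1 / (2 * Real.pi * k * Complex.I) * n := fun n => by
      rw [circlePrimitive_natCast, circlePrimitive]; ring
    have hI : 1 / (2 * Real.pi * k * Complex.I) = -(Complex.I / (2 * Real.pi * k)) := by
      field_simp
      exact Complex.I_sq.symm ▸ by ring
    simp_rw [hterm]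
    rw [Finset.sum_sub_distrib, Finset.sum_add_distrib, ← Finset.mul_sum, ← Finset.mul_sum,
      ← Finset.mul_sum, sum_Ico_one_natCast, hI]
    ring
  rw [hsplit]
  have hn1 : ‖1 / (2 * Real.pi * k * Complex.I)‖ ≤ 1 / (6 * k) := by
    rw [norm_div, norm_mul, norm_mul, norm_mul, Complex.norm_I, Complex.norm_real, norm_one,
      Real.norm_of_nonneg Real.pi_pos.le, Complex.norm_natCast, Complex.norm_ofNat, mul_one]
    gcongr
    linarith
  have hn2 : ‖1 / (2 * Real.pi * k : ℂ) ^ 2‖ ≤ 1 / (36 * k) := by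
    rw [norm_div, norm_pow, norm_mul, norm_mul, Complex.norm_real, norm_one,
      Real.norm_of_nonneg Real.pi_pos.le, Complex.norm_natCast, Complex.norm_ofNat]
    gcongr
    nlinarith [mul_le_mul hp.le hk1 (by norm_num) (by linarith)]
  have hyanti : Antitone y := fun m n h => Real.sqrt_le_sqrt (by gcongr)
  have hs1 : ‖∑ n ∈ Finset.Ico 1 (M + 1), (y n : ℂ) * expTwoPi (k * y n)‖ ≤ 6 * √(k * τ) * τ := by
    have h3 := norm_sum_mul_le_of_antitone hyanti (fun n => Real.sqrt_nonneg _)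
      (e := fun n => expTwoPi (k * y n)) (P := 6 * √(k * τ)) (M := M) fun m hm => by
        refine norm_circle_expSum_le hτ hk ?_
        have : (m : ℝ) ≤ τ / √2 := le_trans (by exact_mod_cast hm) hM1
        have := pow_le_pow_left₀ (by positivity) this 2
        linarith
    have h4 : y 0 = τ := by simp [hy, Real.sqrt_sq hτ]
    rwa [h4] at h3
  have hs2 : ‖∑ n ∈ Finset.Ico 1 (M + 1), (expTwoPi (k * y n) - 1)‖ ≤ 2 * R := by
    refine (norm_sum_le_of_le _ (f := fun n => expTwoPi (k * y n) - 1) (n := fun _ => (2 : ℝ))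
      fun n _ => (norm_sub_le _ _).trans (by simp; norm_num)).trans ?_
    simp
    linarith
  have hs3 : ‖((τ : ℂ) ^ 2 / 4 - M * (M + 1) / 2)‖ ≤ R := by
    have : ((τ : ℂ) ^ 2 / 4 - M * (M + 1) / 2) = ((τ ^ 2 / 4 - M * (M + 1) / 2 : ℝ) : ℂ) := by
      push_cast; ring
    rw [this, Complex.norm_real, Real.norm_eq_abs, abs_le]
    have hM0 : (0 : ℝ) ≤ M := Nat.cast_nonneg M
    have hc0 : 0 ≤ τ / √2 := by positivity
    constructor <;> nlinarith
  have hkR : R / k ≤ R * √(R / k) := by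
    have h3 : 1 / (k : ℝ) ≤ √(R / k) := by
      refine Real.le_sqrt_of_sq_le ?_
      rw [div_pow, one_pow, sq]
      rw [div_le_div_iff₀ (by positivity) hk0]
      nlinarith
    calc R / k = R * (1 / k) := by ring
      _ ≤ _ := by gcongr
  have hk6 : 1 / (6 * (k : ℝ)) * (6 * √(k * τ) * τ) ≤ R * √(R / k) := by
    have h3 : √(k * R) = k * √(R / k) := by
      rw [show (k : ℝ) * R = k ^ 2 * (R / k) by field_simp, Real.sqrt_mul (by positivity),
        Real.sqrt_sq hk0.le]
    calc 1 / (6 * (k : ℝ)) * (6 * √(k * τ) * τ) ≤ 1 / (6 * (k : ℝ)) * (6 * √(k * R) * R) := by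
          gcongr
      _ = R * √(R / k) := by rw [h3]; field_simp
  refine (norm_add₃_le).trans ?_
  rw [norm_mul, norm_mul, norm_mul]
  have e1 := mul_le_mul hn1 hs1 (norm_nonneg _) (by positivity)
  have e2 := mul_le_mul hn2 hs2 (norm_nonneg _) (by positivity)
  have e3 := mul_le_mul hn1 hs3 (norm_nonneg _) (by positivity)
  have e4 : 1 / (36 * (k : ℝ)) * (2 * R) = R / k / 18 := by field_simp; norm_num
  have e5 : 1 / (6 * (k : ℝ)) * R = R / k / 6 := by field_simp
  have e6 : 0 ≤ R / k := by positivity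
  linarith

/-! ### Weighted circle sums -/

/-- `profileWeight α R ρ / ρ`, which is monotone in `ρ` for `2 ≤ α`. -/
noncomputable def profileSlope (α R ρ : ℝ) : ℝ :=
  2 * ρ ^ (α - 2) * (R ^ α - ρ ^ α) ^ (2 / α - 1)

theorem profileSlope_mul_self {α R ρ : ℝ} (hρ : 0 < ρ) :
    profileSlope α R ρ * ρ = profileWeight α R ρ := by
  rw [profileSlope, profileWeight, show α - 1 = (α - 2) + 1 by ring, Real.rpow_add_one hρ.ne']
  ring

theorem measurable_profileSlope (α R : ℝ) : Measurable (profileSlope α R) := by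
  unfold profileSlope; fun_prop

theorem profileSlope_nonneg {α R ρ : ℝ} (hα : 0 < α) (hρ : 0 ≤ ρ) (hR : ρ ≤ R) :
    0 ≤ profileSlope α R ρ := by
  have : 0 ≤ R ^ α - ρ ^ α := sub_nonneg.2 (Real.rpow_le_rpow hρ hR hα.le)
  rw [profileSlope]
  positivity

theorem monotoneOn_profileSlope {α R : ℝ} (hα : 2 ≤ α) :
    MonotoneOn (profileSlope α R) (Set.Ico 0 R) := by
  intro ρ hρ σ hσ h
  have h1 : 0 < R ^ α - σ ^ α := sub_pos.2 (Real.rpow_lt_rpow hσ.1 hσ.2 (by linarith))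
  have h2 : R ^ α - σ ^ α ≤ R ^ α - ρ ^ α :=
    sub_le_sub_left (Real.rpow_le_rpow hρ.1 h (by linarith)) _
  have h3 : 2 / α - 1 ≤ 0 := by
    rw [sub_nonpos, div_le_one (by linarith)]; exact hα
  rw [profileSlope, profileSlope]
  have h4 := Real.rpow_le_rpow_of_nonpos h1 h2 h3
  have h5 := Real.rpow_le_rpow hρ.1 h (by linarith : 0 ≤ α - 2)
  have h6 := Real.rpow_nonneg hρ.1 (α - 2)
  have h7 := hσ.1
  exact mul_le_mul (by linarith) h4 (Real.rpow_nonneg (h1.le.trans h2) _) (by positivity)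

theorem mul_rpow_le_rpow_sub_rpow {α R x : ℝ} (hα : 1 ≤ α) (hx : 0 ≤ x) (hR : 0 < R)
    (hxR : x ≤ R) : (R - x) * R ^ (α - 1) ≤ R ^ α - x ^ α := by
  rcases hx.eq_or_lt with rfl | hx
  · rw [sub_zero, Real.zero_rpow (by linarith), sub_zero, Real.rpow_sub_one hR.ne']
    field_simp; rfl
  have h1 : R ^ α = R ^ (α - 1) * R := by rw [Real.rpow_sub_one hR.ne']; field_simp
  have h2 : x ^ α = x ^ (α - 1) * x := by rw [Real.rpow_sub_one hx.ne']; field_simp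
  have h3 := Real.rpow_le_rpow hx.le hxR (by linarith : 0 ≤ α - 1)
  rw [h1, h2]
  nlinarith

theorem rpow_sub_rpow_le {α R x : ℝ} (hα : 1 ≤ α) (hx : 0 ≤ x) (hR : 0 < R) :
    R ^ α - x ^ α ≤ α * R ^ (α - 1) * (R - x) := by
  have h1 := one_add_mul_self_le_rpow_one_add (s := x / R - 1) (by
    have : 0 ≤ x / R := by positivity
    linarith) hα
  rw [add_sub_cancel, Real.div_rpow hx hR.le, le_div_iff₀ (by positivity)] at h1
  have h2 : R ^ α = R ^ (α - 1) * R := by rw [Real.rpow_sub_one hR.ne']; field_simp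
  have h3 : (1 + α * (x / R - 1)) * R ^ α = R ^ α - α * R ^ (α - 1) * (R - x) := by
    rw [h2]; field_simp; ring
  linarith

theorem profileSlope_sub_le {α R t : ℝ} (hα : 2 ≤ α) (ht : 0 < t) (htR : t < R) :
    profileSlope α R (R - t) ≤ 2 * (R / t) ^ (1 - 2 / α) := by
  have hR : 0 < R := ht.trans htR
  have h1 := mul_rpow_le_rpow_sub_rpow (α := α) (x := R - t) (by linarith) (by linarith) hR
    (by linarith)
  rw [sub_sub_cancel] at h1
  have h3 : 2 / α - 1 ≤ 0 := by
    rw [sub_nonpos, div_le_one (by linarith)]; exact hα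
  have h4 := Real.rpow_le_rpow_of_nonpos (by positivity) h1 h3
  have h5 := Real.rpow_le_rpow (by linarith) (by linarith : R - t ≤ R) (by linarith : 0 ≤ α - 2)
  rw [profileSlope]
  have h6 : 0 ≤ R ^ α - (R - t) ^ α := le_trans (by positivity) h1
  calc _ ≤ 2 * R ^ (α - 2) * (t * R ^ (α - 1)) ^ (2 / α - 1) := by gcongr
    _ = 2 * (R / t) ^ (1 - 2 / α) := by
      rw [Real.mul_rpow ht.le (by positivity), ← Real.rpow_mul hR.le, Real.div_rpow hR.le ht.le,
        mul_assoc, mul_left_comm (R ^ (α - 2)), ← Real.rpow_add hR,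
        show α - 2 + (α - 1) * (2 / α - 1) = 1 - 2 / α by field_simp; ring,
        show 2 / α - 1 = -(1 - 2 / α) by ring, Real.rpow_neg ht.le]
      ring

theorem profile_sub_le {α R t : ℝ} (hα : 1 ≤ α) (ht : 0 < t) (htR : t < R) :
    profile α R (R - t) ≤ α ^ (2 / α) * (R ^ 2 * (R / t) ^ (-(2 / α))) := by
  have hR : 0 < R := ht.trans htR
  have h1 := rpow_sub_rpow_le hα (by linarith : 0 ≤ R - t) hR
  rw [sub_sub_cancel] at h1
  have h0 : 0 ≤ R ^ α - (R - t) ^ α :=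
    sub_nonneg.2 (Real.rpow_le_rpow (by linarith) (by linarith) (by linarith))
  rw [profile]
  calc _ ≤ (α * R ^ (α - 1) * t) ^ (2 / α) := Real.rpow_le_rpow h0 h1 (by positivity)
    _ = _ := by
      rw [Real.mul_rpow (by positivity) ht.le, Real.mul_rpow (by positivity) (by positivity),
        ← Real.rpow_mul hR.le, Real.div_rpow hR.le ht.le, Real.rpow_neg hR.le, Real.rpow_neg ht.le,
        sub_mul, Real.rpow_sub hR, mul_div_cancel₀ _ (by positivity : α ≠ 0)]
      norm_cast
      rw [one_mul]; field_simp

/-- The range is cut at `R - 1/k`. Below, the second mean value theorem gives `R √(R/k) · (Rk)^{1 -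
2/α}`. Above, the pointwise bound times the remaining mass gives `√(kR) · R² (Rk)^{-2/α}`. Both have
the same order, which explains the cut. The mean `i / (4πk)` removed from the circle sum accounts
for `R² / k`. -/
theorem norm_weightedCircleSum_le {α R : ℝ} (hα : 2 ≤ α) (hR : 2 ≤ R) {k : ℕ} (hk : 1 ≤ k) :
    ‖weightedCircleSum α R k‖ ≤ (6 * α ^ (2 / α) + 12) *
      (R ^ (2 + (1 / 2 - 2 / α)) * (k : ℝ) ^ (1 / 2 - 2 / α)) + R ^ 2 / k := by
  have hk0 : (0 : ℝ) < k := by exact_mod_cast hk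
  have hk1 : (1 : ℝ) ≤ k := by exact_mod_cast hk
  have hα0 : 0 < α := by linarith
  have hR0 : 0 < R := by linarith
  have hp := Real.pi_gt_three
  have ht0 : 0 < 1 / (k : ℝ) := by positivity
  have ht1 : 1 / (k : ℝ) ≤ 1 := by rw [div_le_one hk0]; exact hk1
  set S := R - 1 / (k : ℝ) with hS
  have hS0 : 0 < S := by linarith
  have hSR : S < R := by linarith
  have hint := integrableOn_circleSum_mul (R := R) hα0 k
  have hintw := integrableOn_profileWeight (R := R) hα0
  have hsplit : weightedCircleSum α R k =
      (∫ ρ in Set.Ioc 0 S, circleSum k ρ * (profileWeight α R ρ : ℂ)) +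
        ∫ ρ in Set.Ioc S R, circleSum k ρ * (profileWeight α R ρ : ℂ) := by
    rw [weightedCircleSum, ← setIntegral_union (Set.Ioc_disjoint_Ioc_of_le le_rfl) measurableSet_Ioc
      (hint.mono_set (Set.Ioc_subset_Ioc_right hSR.le))
      (hint.mono_set (Set.Ioc_subset_Ioc_left hS0.le)), Set.Ioc_union_Ioc_eq_Ioc hS0.le hSR.le]
  have hRt : R / (1 / (k : ℝ)) = R * k := by field_simp
  have hsq : √(k * R) = R ^ (1 / 2 : ℝ) * (k : ℝ) ^ (1 / 2 : ℝ) := by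
    rw [Real.sqrt_eq_rpow, Real.mul_rpow hk0.le hR0.le, mul_comm]
  have htail : ‖∫ ρ in Set.Ioc S R, circleSum k ρ * (profileWeight α R ρ : ℂ)‖ ≤
      6 * α ^ (2 / α) * (R ^ (2 + (1 / 2 - 2 / α)) * (k : ℝ) ^ (1 / 2 - 2 / α)) := by
    have h1 : ‖∫ ρ in Set.Ioc S R, circleSum k ρ * (profileWeight α R ρ : ℂ)‖ ≤
        ∫ ρ in Set.Ioc S R, 6 * √(k * R) * profileWeight α R ρ := by
      refine norm_integral_le_of_norm_le
        ((hintw.mono_set (Set.Ioc_subset_Ioc_left hS0.le)).integrable.const_mul _)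
        ((ae_restrict_iff' measurableSet_Ioc).2 (Filter.Eventually.of_forall fun ρ hρ => ?_))
      have h2 : 0 < ρ := hS0.trans hρ.1
      have h3 := profileWeight_nonneg hα0 h2.le hρ.2
      rw [norm_mul, Complex.norm_real, Real.norm_of_nonneg h3]
      refine mul_le_mul_of_nonneg_right ((norm_circleSum_le_sqrt h2.le hk).trans ?_) h3
      have := hρ.2
      gcongr
    rw [integral_const_mul, integral_profileWeight hα0 hS0.le hSR.le] at h1
    have h2 := profile_sub_le (α := α) (by linarith) ht0 (ht1.trans_lt (by linarith : 1 < R))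
    rw [← hS, hRt] at h2
    refine h1.trans ((mul_le_mul_of_nonneg_left h2 (by positivity)).trans (le_of_eq ?_))
    rw [hsq, Real.mul_rpow hR0.le hk0.le, ← Real.rpow_natCast R 2]
    rw [show (2 : ℝ) + (1 / 2 - 2 / α) = 1 / 2 + ((2 : ℕ) : ℝ) + -(2 / α) by push_cast; ring,
      show (1 / 2 : ℝ) - 2 / α = 1 / 2 + -(2 / α) by ring, Real.rpow_add hR0, Real.rpow_add hR0,
      Real.rpow_add hk0]
    ring
  set b : ℝ → ℂ := fun ρ => (circleSum k ρ - Complex.I / (4 * Real.pi * k)) * (ρ : ℂ) with hb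
  have hintS := hint.mono_set (Set.Ioc_subset_Ioc_right hSR.le)
  have hintwS : IntegrableOn (fun ρ => (profileWeight α R ρ : ℂ)) (Set.Ioc 0 S) :=
    (hintw.mono_set (Set.Ioc_subset_Ioc_right hSR.le)).ofReal
  have hhead : ‖∫ ρ in Set.Ioc 0 S, circleSum k ρ * (profileWeight α R ρ : ℂ)‖ ≤
      12 * (R ^ (2 + (1 / 2 - 2 / α)) * (k : ℝ) ^ (1 / 2 - 2 / α)) + R ^ 2 / k := by
    have h1 : ∀ ρ ∈ Set.Ioc 0 S, circleSum k ρ * (profileWeight α R ρ : ℂ) -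
        Complex.I / (4 * Real.pi * k) * (profileWeight α R ρ : ℂ) =
        b ρ * (profileSlope α R ρ : ℂ) := by
      intro ρ hρ
      rw [← profileSlope_mul_self hρ.1, hb]
      push_cast; ring
    have h2 := setIntegral_congr_fun measurableSet_Ioc h1 (μ := volume)
    rw [integral_sub hintS (hintwS.const_mul _), sub_eq_iff_eq_add] at h2
    rw [h2]
    have hbI : IntegrableOn b (Set.Ioc 0 S) := by
      refine Integrable.bdd_mul (c := R + ‖Complex.I / (4 * Real.pi * k)‖)
        (Complex.continuous_ofReal.integrableOn_Icc.mono_set Set.Ioc_subset_Icc_self)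
        ((measurable_circleSum k).sub_const _).aestronglyMeasurable
        ((ae_restrict_iff' measurableSet_Ioc).2 (Filter.Eventually.of_forall fun ρ hρ =>
          (norm_sub_le _ _).trans (add_le_add_left ((norm_circleSum_le hρ.1.le k).trans
            (hρ.2.trans hSR.le)) _)))
    have h3 := norm_setIntegral_mul_le_of_monotoneOn hS0 (measurable_profileSlope α R)
      (fun ρ hρ => profileSlope_nonneg hα0 hρ.1.le (hρ.2.trans hSR.le))
      ((monotoneOn_profileSlope hα).mono fun ρ hρ => ⟨hρ.1.le, hρ.2.trans_lt hSR⟩) hbI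
      fun s hs => norm_integral_circleSum_sub_le hk hs.1 (hs.2.trans hSR.le) (by linarith)
    have h4 := profileSlope_sub_le hα ht0 (ht1.trans_lt (by linarith : 1 < R))
    rw [← hS, hRt] at h4
    have h5 : ‖∫ ρ in Set.Ioc 0 S, Complex.I / (4 * Real.pi * k) * (profileWeight α R ρ : ℂ)‖ ≤
        R ^ 2 / k := by
      have hI : 0 ≤ ∫ ρ in Set.Ioc 0 S, profileWeight α R ρ :=
        setIntegral_nonneg measurableSet_Ioc fun ρ hρ =>
          profileWeight_nonneg hα0 hρ.1.le (hρ.2.trans hSR.le)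
      rw [integral_const_mul, integral_complex_ofReal, norm_mul, Complex.norm_real,
        Real.norm_of_nonneg hI]
      have h6 : ∫ ρ in Set.Ioc 0 S, profileWeight α R ρ ≤ R ^ 2 := by
        rw [← profile_zero hα0 hR0.le, ← integral_profileWeight hα0 le_rfl hR0.le]
        exact setIntegral_mono_set hintw ((ae_restrict_iff' measurableSet_Ioc).2
          (Filter.Eventually.of_forall fun ρ hρ => profileWeight_nonneg hα0 hρ.1.le hρ.2))
          (Filter.Eventually.of_forall (Set.Ioc_subset_Ioc_right hSR.le))
      have h7 : ‖Complex.I / (4 * Real.pi * k)‖ ≤ 1 / k := by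
        rw [norm_div, norm_mul, norm_mul, Complex.norm_I, Complex.norm_real,
          Real.norm_of_nonneg Real.pi_pos.le, Complex.norm_natCast, Complex.norm_ofNat]
        gcongr
        nlinarith
      calc _ ≤ 1 / (k : ℝ) * R ^ 2 := by gcongr
        _ = _ := by ring
    have h8 : 2 * (3 * (R * √(R / k))) * profileSlope α R S ≤
        12 * (R ^ (2 + (1 / 2 - 2 / α)) * (k : ℝ) ^ (1 / 2 - 2 / α)) := by
      refine (mul_le_mul_of_nonneg_left h4 (by positivity)).trans (le_of_eq ?_)
      rw [Real.sqrt_eq_rpow, Real.div_rpow hR0.le hk0.le, Real.mul_rpow hR0.le hk0.le,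
        show (2 : ℝ) + (1 / 2 - 2 / α) = 1 + 1 / 2 + (1 - 2 / α) by ring,
        show (1 / 2 : ℝ) - 2 / α = (1 - 2 / α) - 1 / 2 by ring, Real.rpow_add hR0,
        Real.rpow_add hR0, Real.rpow_sub hk0 _ (1 / 2), Real.rpow_one]
      ring
    exact (norm_add_le _ _).trans (add_le_add (h3.trans h8) h5)
  rw [hsplit]
  refine (norm_add_le _ _).trans ?_
  linarith

/-! ### Summation over the frequencies and the planar bound -/

theorem sum_range_le_of_telescoping {f g h : ℕ → ℝ} {K : ℕ} (hf0 : f 0 = 0) (hf : ∀ k, 0 ≤ f k)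
    (hh0 : ∀ k, 0 ≤ h k) (hg : ∀ k < K, f (k + 1) ≤ g (k + 1) - g k)
    (hh : ∀ k, K ≤ k → f (k + 1) ≤ h k - h (k + 1)) (N : ℕ) :
    ∑ k ∈ Finset.range N, f k ≤ g K - g 0 + h K := by
  have h1 : ∀ M ≤ K, ∑ k ∈ Finset.range (M + 1), f k ≤ g M - g 0 := by
    intro M hM
    induction M with
    | zero => simp [hf0]
    | succ M ih =>
      rw [Finset.sum_range_succ]
      linarith [ih (by omega), hg M (by omega)]
  have h2 : ∀ M, ∑ k ∈ Finset.range (K + M + 1), f k ≤ g K - g 0 + h K - h (K + M) := by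
    intro M
    induction M with
    | zero => simpa using h1 K le_rfl
    | succ M ih =>
      rw [← add_assoc, Finset.sum_range_succ]
      linarith [hh (K + M) (by omega)]
  have h3 := Finset.sum_le_sum_of_subset_of_nonneg
    (Finset.range_mono (by omega : N ≤ K + N + 1)) fun k _ _ => hf k
  linarith [h2 N, hh0 (K + N)]

theorem one_div_succ_sq_le (k : ℕ) (hk : 1 ≤ k) :
    1 / ((k + 1 : ℕ) : ℝ) ^ 2 ≤ 1 / (k : ℝ) - 1 / ((k + 1 : ℕ) : ℝ) := by
  have hk0 : (0 : ℝ) < k := by exact_mod_cast hk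
  push_cast
  rw [div_sub_div _ _ hk0.ne' (by positivity), div_le_div_iff₀ (by positivity) (by positivity)]
  nlinarith

theorem sum_range_one_div_sq_le (N : ℕ) : ∑ k ∈ Finset.range N, 1 / (k : ℝ) ^ 2 ≤ 2 := by
  have := sum_range_le_of_telescoping (f := fun k : ℕ => 1 / (k : ℝ) ^ 2) (g := fun k : ℕ => (k : ℝ))
    (h := fun k : ℕ => 1 / (k : ℝ)) (K := 1) (by simp) (fun k => by positivity)
    (fun k => by positivity) (fun k hk => by
      obtain rfl : k = 0 := by omega
      simp) one_div_succ_sq_le N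
  norm_num at this ⊢
  exact this

theorem sum_range_min_le {K : ℕ} (hK : 1 ≤ K) (N : ℕ) :
    ∑ k ∈ Finset.range N, min (1 / (k : ℝ)) (K / (k : ℝ) ^ 2) ≤ 2 + Real.log K := by
  have hK0 : (0 : ℝ) < K := by exact_mod_cast hK
  -- The value `-1` of `g` at 0 leaves room for the term `k = 1`, since `log 1 = 0`.
  have := sum_range_le_of_telescoping (f := fun k : ℕ => min (1 / (k : ℝ)) (K / (k : ℝ) ^ 2))
    (g := fun k : ℕ => if k = 0 then -1 else Real.log k) (h := fun k : ℕ => K * (1 / (k : ℝ)))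
    (K := K) (by simp) (fun k => by positivity) (fun k => by positivity) (fun k _ => by
      refine (min_le_left _ _).trans ?_
      rcases Nat.eq_zero_or_pos k with rfl | hk
      · simp
      · have hk0 : (0 : ℝ) < k := by exact_mod_cast hk
        rw [if_neg (by omega), if_neg (by omega), ← Real.log_div (by positivity) hk0.ne']
        refine le_trans (le_of_eq ?_) (Real.one_sub_inv_le_log_of_pos (by positivity))
        push_cast; field_simp; ring) (fun k hk => by
      refine (min_le_right _ _).trans ?_
      have := mul_le_mul_of_nonneg_left (one_div_succ_sq_le k (hK.trans hk)) hK0.le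
      rw [mul_sub] at this
      exact (le_of_eq (by ring)).trans this) N
  rw [if_neg (by omega), if_pos rfl, mul_one_div_cancel hK0.ne'] at this
  linarith

theorem rpow_sub_one_le_sub {γ x : ℝ} (hγ0 : 0 < γ) (hγ1 : γ ≤ 1) (hx : 1 ≤ x) :
    x ^ (γ - 1) ≤ (x ^ γ - (x - 1) ^ γ) / γ := by
  have hx0 : 0 < x := by linarith
  have h1 := rpow_one_add_le_one_add_mul_self (s := -(1 / x)) (p := γ) (by
    rw [neg_le_neg_iff, div_le_one hx0]; exact hx) hγ0.le hγ1
  rw [show 1 + -(1 / x) = (x - 1) / x by field_simp; ring, Real.div_rpow (by linarith) hx0.le,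
    div_le_iff₀ (by positivity)] at h1
  rw [le_div_iff₀ hγ0, Real.rpow_sub_one hx0.ne']
  have : (1 + γ * -(1 / x)) * x ^ γ = x ^ γ - x ^ γ / x * γ := by field_simp; ring
  linarith

/-- A discrete form of comparing `x^{γ-2}` with its integral over the preceding unit interval, by
Bernoulli's inequality for the exponent `1 - γ` and `(1 - u)(1 + u) ≤ 1`. -/
theorem rpow_sub_two_le_sub {γ x : ℝ} (hγ0 : 0 ≤ γ) (hγ1 : γ < 1) (hx : 1 < x) :
    x ^ (γ - 2) ≤ ((x - 1) ^ (γ - 1) - x ^ (γ - 1)) / (1 - γ) := by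
  have hx0 : 0 < x := by linarith
  have hx1 : 0 < x - 1 := by linarith
  have h1 := rpow_one_add_le_one_add_mul_self (s := -(1 / x)) (p := 1 - γ) (by
    rw [neg_le_neg_iff, div_le_one hx0]; exact hx.le) (by linarith) (by linarith)
  rw [show 1 + -(1 / x) = (x - 1) / x by field_simp; ring, Real.div_rpow hx1.le hx0.le,
    div_le_iff₀ (by positivity)] at h1
  rw [le_div_iff₀ (by linarith), show γ - 2 = -(1 - γ) - 1 by ring, Real.rpow_sub_one hx0.ne',
    show γ - 1 = -(1 - γ) by ring, Real.rpow_neg hx0.le, Real.rpow_neg hx1.le]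
  set a := x ^ (1 - γ) with ha
  set b := (x - 1) ^ (1 - γ) with hb
  have ha0 : 0 < a := by positivity
  have hb0 : 0 < b := Real.rpow_pos_of_pos hx1 _
  set u := (1 - γ) / x with hu
  have hu0 : 0 ≤ u := div_nonneg (by linarith) hx0.le
  have h2 : b ≤ (1 - u) * a := by
    have : 1 + (1 - γ) * -(1 / x) = 1 - u := by rw [hu]; ring
    rwa [this] at h1
  have h3 : (1 + u) * b ≤ a := by
    have := mul_le_mul_of_nonneg_left h2 (by linarith : 0 ≤ 1 + u)
    nlinarith [mul_nonneg (mul_nonneg hu0 hu0) ha0.le]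
  have h4 : a⁻¹ * (1 + u) ≤ b⁻¹ := by
    rw [inv_mul_le_iff₀ ha0, ← div_eq_mul_inv, le_div_iff₀ hb0]; exact h3
  have h5 : a⁻¹ / x * (1 - γ) = a⁻¹ * u := by rw [hu]; ring
  rw [h5]
  linarith

theorem sum_range_min_mul_rpow_le {γ : ℝ} (hγ0 : 0 < γ) (hγ1 : γ < 1) {K : ℕ} (hK : 1 ≤ K) (N : ℕ) :
    ∑ k ∈ Finset.range N, min (1 / (k : ℝ)) (K / (k : ℝ) ^ 2) * (k : ℝ) ^ γ ≤
      (1 / γ + 1 / (1 - γ)) * (K : ℝ) ^ γ := by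
  have hK0 : (0 : ℝ) < K := by exact_mod_cast hK
  have h1γ : 0 < 1 - γ := by linarith
  have := sum_range_le_of_telescoping
    (f := fun k : ℕ => min (1 / (k : ℝ)) (K / (k : ℝ) ^ 2) * (k : ℝ) ^ γ)
    (g := fun k : ℕ => (k : ℝ) ^ γ / γ) (h := fun k : ℕ => K * ((k : ℝ) ^ (γ - 1) / (1 - γ)))
    (K := K) (by simp) (fun k => by positivity) (fun k => by positivity) (fun k _ => by
      have hk : (0 : ℝ) < ((k + 1 : ℕ) : ℝ) := by positivity
      have h1 := rpow_sub_one_le_sub hγ0 hγ1.le (x := ((k + 1 : ℕ) : ℝ)) (by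
        push_cast; linarith [(Nat.cast_nonneg k : (0 : ℝ) ≤ k)])
      rw [sub_div, show ((k + 1 : ℕ) : ℝ) - 1 = k by push_cast; ring,
        Real.rpow_sub_one hk.ne'] at h1
      refine le_trans ?_ h1
      rw [show ((k + 1 : ℕ) : ℝ) ^ γ / ((k + 1 : ℕ) : ℝ) =
        1 / ((k + 1 : ℕ) : ℝ) * ((k + 1 : ℕ) : ℝ) ^ γ by ring]
      gcongr
      exact min_le_left _ _) (fun k hk => by
      have hk0 : (0 : ℝ) < k := by exact_mod_cast hK.trans hk
      have hk1 : (0 : ℝ) < ((k + 1 : ℕ) : ℝ) := by positivity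
      have h1 := rpow_sub_two_le_sub hγ0.le hγ1 (x := ((k + 1 : ℕ) : ℝ)) (by
        push_cast; linarith)
      rw [sub_div, show ((k + 1 : ℕ) : ℝ) - 1 = k by push_cast; ring, Real.rpow_sub hk1 γ 2] at h1
      rw [← mul_sub]
      refine le_trans ?_ (mul_le_mul_of_nonneg_left h1 hK0.le)
      rw [Real.rpow_two, show (K : ℝ) * (((k + 1 : ℕ) : ℝ) ^ γ / ((k + 1 : ℕ) : ℝ) ^ 2) =
        K / ((k + 1 : ℕ) : ℝ) ^ 2 * ((k + 1 : ℕ) : ℝ) ^ γ by ring]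
      gcongr
      exact min_le_right _ _) N
  refine this.trans (le_of_eq ?_)
  rw [Nat.cast_zero, Real.zero_rpow hγ0.ne', Real.rpow_sub_one hK0.ne']
  field_simp; ring

theorem abs_integral_ballError_two_le_of_sum_le {α R B : ℝ} (hα : 2 ≤ α) (hR : 2 ≤ R) {K : ℕ}
    (hK : 1 ≤ K) (hB : ∀ N : ℕ, ∑ k ∈ Finset.range N,
      min (1 / (k : ℝ)) (K / (k : ℝ) ^ 2) * (k : ℝ) ^ (1 / 2 - 2 / α) ≤ B) :
    |∫ ρ in Set.Ioc 0 R, ballError (Fin 2) ρ * profileWeight α R ρ| ≤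
      33 * R ^ 2 + 4 * R ^ 3 / K +
        4 * (6 * α ^ (2 / α) + 12) * (R ^ (2 + (1 / 2 - 2 / α)) * B) := by
  have hR0 : 0 < R := by linarith
  have hα0 : 0 < α := by linarith
  set D := 6 * α ^ (2 / α) + 12 with hD
  set γ := 1 / 2 - 2 / α with hγ
  have key := abs_integral_ballError_two_le (E := D * (R ^ (2 + γ) * B) + R ^ 2 * 2)
    hα0 hR0.le hK fun N => ?_
  · linarith
  have hterm : ∀ k : ℕ, min (1 / (k : ℝ)) (K / (k : ℝ) ^ 2) * ‖weightedCircleSum α R k‖ ≤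
      D * R ^ (2 + γ) * (min (1 / (k : ℝ)) (K / (k : ℝ) ^ 2) * (k : ℝ) ^ γ) +
        R ^ 2 * (1 / (k : ℝ) ^ 2) := by
    intro k
    rcases Nat.eq_zero_or_pos k with rfl | hk
    · simp
    have h1 := norm_weightedCircleSum_le hα hR hk
    have h0 : 0 ≤ min (1 / (k : ℝ)) (K / (k : ℝ) ^ 2) := by positivity
    have h2 : min (1 / (k : ℝ)) (K / (k : ℝ) ^ 2) * (R ^ 2 / k) ≤ 1 / k * (R ^ 2 / k) := by
      gcongr; exact min_le_left _ _
    have h3 := mul_le_mul_of_nonneg_left h1 h0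
    have h4 : 1 / k * (R ^ 2 / k) = R ^ 2 * (1 / (k : ℝ) ^ 2) := by ring
    rw [mul_add] at h3
    rw [h4] at h2
    refine h3.trans (add_le_add (le_of_eq ?_) h2)
    ring
  refine (Finset.sum_le_sum fun k _ => hterm k).trans ?_
  rw [Finset.sum_add_distrib, ← Finset.mul_sum, ← Finset.mul_sum, ← mul_assoc]
  have h5 : 0 ≤ D * R ^ (2 + γ) := by positivity
  exact add_le_add (mul_le_mul_of_nonneg_left (hB N) h5)
    (mul_le_mul_of_nonneg_left (sum_range_one_div_sq_le N) (by positivity))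

theorem exists_natCast_between {x : ℝ} (hx : 1 ≤ x) : ∃ K : ℕ, 1 ≤ K ∧ x ≤ K ∧ (K : ℝ) ≤ 2 * x := by
  refine ⟨⌈x⌉₊, Nat.one_le_ceil_iff.2 (by linarith), Nat.le_ceil x, ?_⟩
  linarith [Nat.ceil_lt_add_one (by linarith : 0 ≤ x)]

theorem exists_abs_sum_profile_sub_integral_planar_le {α : ℝ} (hα : 2 < α) : ∃ C : ℝ, ∀ R : ℝ,
    2 ≤ R → (α ≤ 4 → |∑ k ∈ latticeBall (Fin 2) R, profile α R (euc (toReal k)) -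
      ∫ x in {x : Fin 2 → ℝ | euc x ≤ R}, profile α R (euc x)| ≤ C * (R ^ 2 * Real.log R)) ∧
    (4 < α → |∑ k ∈ latticeBall (Fin 2) R, profile α R (euc (toReal k)) -
      ∫ x in {x : Fin 2 → ℝ | euc x ≤ R}, profile α R (euc x)| ≤
        C * R ^ ((2 : ℝ) + errorExponent 1 α)) := by
  have hα0 : 0 < α := by linarith
  set γ := 1 / 2 - 2 / α with hγ
  set D := 4 * (6 * α ^ (2 / α) + 12) with hD
  have hD0 : 0 < D := by positivity
  have hγ2 : γ < 1 / 2 := by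
    have : 0 < 2 / α := by positivity
    linarith
  rcases le_or_gt α 4 with hα4 | hα4
  · have hγ0 : γ ≤ 0 := by
      have : 1 / 2 ≤ 2 / α := by rw [div_le_div_iff₀ (by norm_num) hα0]; linarith
      linarith
    refine ⟨74 + 5 * D, fun R hR => ⟨fun _ => ?_, fun h => absurd h (by linarith)⟩⟩
    have hR0 : 0 < R := by linarith
    rw [sum_profile_sub_integral hα0]
    -- Since `k^γ ≤ 1`, the sum over `k` grows only like `log K`. So `K` may be as large as `R`, and
    -- then `R³ / K ≤ R²`.
    obtain ⟨K, hK1, hK2, hK3⟩ := exists_natCast_between (by linarith : 1 ≤ R)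
    have hK0 : (0 : ℝ) < K := by linarith
    have h1 := abs_integral_ballError_two_le_of_sum_le hα.le hR hK1 fun N =>
      (Finset.sum_le_sum fun (k : ℕ) _ => show min (1 / (k : ℝ)) (K / (k : ℝ) ^ 2) *
        (k : ℝ) ^ (1 / 2 - 2 / α) ≤ min (1 / (k : ℝ)) (K / (k : ℝ) ^ 2) by
          rcases Nat.eq_zero_or_pos k with rfl | hk
          · simp
          · exact mul_le_of_le_one_right (by positivity)
              (Real.rpow_le_one_of_one_le_of_nonpos (by exact_mod_cast hk) hγ0)).trans
        (sum_range_min_le hK1 N)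
    refine h1.trans ?_
    rw [← hγ, ← hD]
    have hl2 := Real.log_two_gt_d9
    have hlR := Real.log_le_log (by norm_num) hR
    have h2 : Real.log K ≤ Real.log 2 + Real.log R := by
      rw [← Real.log_mul (by norm_num) hR0.ne']
      exact Real.log_le_log hK0 hK3
    have h3 : R ^ (2 + γ) ≤ R ^ 2 := by
      rw [← Real.rpow_two]
      exact Real.rpow_le_rpow_of_exponent_le (by linarith) (by linarith)
    have h4 : R ^ (2 + γ) * (2 + Real.log K) ≤ R ^ 2 * (5 * Real.log R) := by
      have h5 : 0 ≤ 2 + Real.log K := by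
        have := Real.log_nonneg (by exact_mod_cast hK1 : (1 : ℝ) ≤ K)
        linarith
      exact mul_le_mul h3 (by linarith) h5 (by positivity)
    have h6 : 4 * R ^ 3 / K ≤ 4 * R ^ 2 := by
      rw [div_le_iff₀ hK0]
      nlinarith [mul_le_mul_of_nonneg_left hK2 (sq_nonneg R)]
    have h7 := mul_le_mul_of_nonneg_left h4 hD0.le
    have h8 : 37 * R ^ 2 ≤ 74 * (R ^ 2 * Real.log R) := by
      have : 1 / 2 ≤ Real.log R := by linarith
      nlinarith [sq_nonneg R]
    linarith
  · have hγ0 : 0 < γ := by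
      have : 2 / α < 1 / 2 := by rw [div_lt_div_iff₀ hα0 (by norm_num)]; linarith
      linarith
    set B := 1 / γ + 1 / (1 - γ) with hB
    have hB0 : 0 < B := by
      have : 0 < 1 - γ := by linarith
      positivity
    refine ⟨37 + D * (B * 2), fun R hR => ⟨fun h => absurd h (by linarith), fun _ => ?_⟩⟩
    have hR0 : 0 < R := by linarith
    have hR1 : 1 ≤ R := by linarith
    rw [sum_profile_sub_integral hα0]
    -- With `K ≈ R^θ` the exponents `3 - θ` and `2 + γ + θγ` coincide, both being `2 + 2γ / (1 +
    -- γ)`.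
    set θ := (1 - γ) / (1 + γ) with hθ
    have hθ0 : 0 ≤ θ := div_nonneg (by linarith) (by linarith)
    have hδ : errorExponent 1 α = 2 * γ / (1 + γ) := by
      rw [errorExponent, hγ]; push_cast; ring_nf
    have h1γ : 1 + γ ≠ 0 := by linarith
    obtain ⟨K, hK1, hK2, hK3⟩ := exists_natCast_between (Real.one_le_rpow hR1 hθ0)
    have hK0 : (0 : ℝ) < K := lt_of_lt_of_le (by positivity) hK2
    have h1 := abs_integral_ballError_two_le_of_sum_le hα.le hR hK1 fun N =>
      sum_range_min_mul_rpow_le hγ0 (by linarith) hK1 N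
    refine h1.trans ?_
    rw [← hγ, ← hD, ← hB]
    have h2 : R ^ 2 ≤ R ^ ((2 : ℝ) + errorExponent 1 α) := by
      rw [← Real.rpow_two]
      refine Real.rpow_le_rpow_of_exponent_le hR1 ?_
      rw [hδ]
      have : 0 ≤ 2 * γ / (1 + γ) := by positivity
      linarith
    have h3 : 4 * R ^ 3 / K ≤ 4 * R ^ ((2 : ℝ) + errorExponent 1 α) := by
      rw [div_le_iff₀ hK0]
      have : R ^ ((2 : ℝ) + errorExponent 1 α) * R ^ θ = R ^ 3 := by
        rw [← Real.rpow_add hR0, hδ, hθ, ← Real.rpow_natCast]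
        congr 1
        push_cast; field_simp; ring
      nlinarith [mul_le_mul_of_nonneg_left hK2
        (by positivity : 0 ≤ R ^ ((2 : ℝ) + errorExponent 1 α))]
    have h4 : (K : ℝ) ^ γ ≤ 2 * R ^ (θ * γ) := by
      calc (K : ℝ) ^ γ ≤ (2 * R ^ θ) ^ γ := Real.rpow_le_rpow hK0.le hK3 hγ0.le
        _ = 2 ^ γ * R ^ (θ * γ) := by
          rw [Real.mul_rpow (by norm_num) (by positivity), ← Real.rpow_mul hR0.le]
        _ ≤ 2 ^ (1 : ℝ) * R ^ (θ * γ) := by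
          gcongr
          · norm_num
          · linarith
        _ = _ := by rw [Real.rpow_one]
    have h5 : R ^ (2 + γ) * (B * (K : ℝ) ^ γ) ≤ B * 2 * R ^ ((2 : ℝ) + errorExponent 1 α) := by
      calc R ^ (2 + γ) * (B * (K : ℝ) ^ γ) ≤ R ^ (2 + γ) * (B * (2 * R ^ (θ * γ))) := by gcongr
        _ = B * 2 * (R ^ (2 + γ) * R ^ (θ * γ)) := by ring
        _ = _ := by
          rw [← Real.rpow_add hR0, hδ, hθ]
          congr 2
          field_simp; ring
    have h6 := mul_le_mul_of_nonneg_left h5 hD0.le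
    linarith

/-! ### Assembling the three cases -/

theorem errorExponent_pos {d : ℕ} (hd : 1 ≤ d) {α : ℝ} (hα : 4 < α) : 0 < errorExponent d α := by
  have h1 : 2 / α < 1 / 2 := by rw [div_lt_div_iff₀ (by linarith) (by norm_num)]; linarith
  have h2 : (1 : ℝ) ≤ d := by exact_mod_cast hd
  rw [errorExponent]
  exact div_pos (by linarith) (by linarith)

theorem sum_profile_two_sub_integral {ι : Type*} [Fintype ι] (R : ℝ) :
    ∑ k ∈ latticeBall ι R, profile 2 R (euc (toReal k)) -
      ∫ x in {x : ι → ℝ | euc x ≤ R}, profile 2 R (euc x) =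
    ∑ k ∈ latticeBall ι R, (R ^ 2 - euc (toReal k) ^ 2) -
      ∫ x in {x : ι → ℝ | euc x ≤ R}, (R ^ 2 - euc x ^ 2) := by
  simp only [profile_two]

theorem integral_tent {ι : Type*} [Fintype ι] {R : ℝ} (hR : 0 ≤ R) :
    ∫ x in {x : ι → ℝ | euc x ≤ R}, (R ^ 2 - euc x ^ 2) = ∫ x : ι → ℝ, max (R ^ 2 - euc x ^ 2) 0 := by
  rw [← integral_indicator (measurableSet_le continuous_euc.measurable measurable_const)]
  congr 1
  ext x
  simp only [Set.indicator, Set.mem_ofPred_eq]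
  split_ifs with h
  · rw [max_eq_left (sub_nonneg.2 (pow_le_pow_left₀ (euc_nonneg x) h 2))]
  · rw [max_eq_right (sub_nonpos.2 (pow_le_pow_left₀ hR (not_le.1 h).le 2))]

/-- Pointwise ball error `O(R^{D-2} log R)` times the mass `R²` of the weight. -/
theorem exists_abs_sum_profile_sub_integral_le {D : ℕ} (hD : 4 ≤ D) {α : ℝ} (hα : 0 < α) :
    ∃ C : ℝ, ∀ R : ℝ, 2 ≤ R → |∑ k ∈ latticeBall (Fin D) R, profile α R (euc (toReal k)) -
      ∫ x in {x : Fin D → ℝ | euc x ≤ R}, profile α R (euc x)| ≤ C * (R ^ D * Real.log R) := by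
  obtain ⟨C, hC, h⟩ := exists_abs_card_latticeBall_sub_le hD
  refine ⟨C * (2 ^ (D - 2) * 2), fun R hR => ?_⟩
  have h1 := abs_sum_profile_sub_integral_le (ι := Fin D) (α := α) (R := R)
    (M := C * ((1 + R) ^ (D - 2) * Real.log (2 + R))) hα (by linarith) fun ρ hρ => by
      have h2 := h ρ hρ.1.le
      rw [ballError, Fintype.card_fin]
      refine h2.trans (mul_le_mul_of_nonneg_left ?_ hC)
      have h3 := hρ.1
      have h4 := hρ.2
      have h5 : 0 ≤ Real.log (2 + ρ) := Real.log_nonneg (by linarith)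
      exact mul_le_mul (pow_le_pow_left₀ (by linarith) (by linarith) _)
        (Real.log_le_log (by linarith) (by linarith)) h5 (by positivity)
  refine h1.trans ?_
  have h2 : Real.log (2 + R) ≤ 2 * Real.log R := by
    have : 2 * Real.log R = Real.log (R ^ 2) := by rw [Real.log_pow]; norm_num
    rw [this]
    exact Real.log_le_log (by linarith) (by nlinarith)
  have h3 : (1 + R) ^ (D - 2) ≤ 2 ^ (D - 2) * R ^ (D - 2) := by
    rw [← mul_pow]
    exact pow_le_pow_left₀ (by linarith) (by linarith) _
  have h4 : R ^ D = R ^ (D - 2) * R ^ 2 := by rw [← pow_add]; congr 1; omega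
  have h5 : 0 ≤ Real.log (2 + R) := Real.log_nonneg (by linarith)
  calc C * ((1 + R) ^ (D - 2) * Real.log (2 + R)) * R ^ 2
      ≤ C * ((2 ^ (D - 2) * R ^ (D - 2)) * (2 * Real.log R)) * R ^ 2 := by gcongr
    _ = C * (2 ^ (D - 2) * 2) * (R ^ D * Real.log R) := by rw [h4]; ring

theorem exists_card_latticeBall_le {ι : Type*} [Fintype ι] : ∃ C : ℝ, ∀ r : ℝ, 1 ≤ r →
    ((latticeBall ι r).card : ℝ) ≤ C * r ^ Fintype.card ι := by
  obtain ⟨C, -, h⟩ := card_latticeBall_le_mul_pow (ι := ι)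
  refine ⟨C, fun r hr => le_trans ?_ (h r hr)⟩
  exact monotone_card_latticeBall (by linarith [(Nat.cast_nonneg (Fintype.card ι) : (0:ℝ) ≤ _)])

/-- A bound for the lattice sum of the profile transfers to the lattice point error. -/
theorem exists_latticeError_le {d : ℕ} {α a : ℝ} (hα : 0 < α) (ha : 0 < a) {g : ℝ → ℝ}
    (hg : ∃ C : ℝ, ∀ R : ℝ, 2 ≤ R → R ^ (2 * d) ≤ C * g R)
    (h : ∃ C : ℝ, ∀ R : ℝ, 2 ≤ R →
      |∑ k ∈ latticeBall (Fin (2 * d)) R, profile α R (euc (toReal k)) -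
        ∫ x in {x : Fin (2 * d) → ℝ | euc x ≤ R}, profile α R (euc x)| ≤ C * g R) :
    ∃ C : ℝ, ∀ A : ℝ, a ≤ A → ∀ R : ℝ, 2 ≤ R → latticeError d α A R ≤ C * g R := by
  obtain ⟨C₁, h₁⟩ := exists_card_latticeBall_le (ι := Fin (2 * d))
  obtain ⟨C₂, h₂⟩ := hg
  obtain ⟨C₃, h₃⟩ := h
  rw [Fintype.card_fin] at h₁
  refine ⟨|C₁| * C₂ + 2 * a ^ (-(2 / α)) * C₃, fun A hA R hR => ?_⟩
  have hR0 : 0 ≤ R := by linarith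
  have h4 := h₁ R (by linarith)
  have h5 := h₃ R hR
  -- Uniformity in `A`: the power is negative, so the factor is largest at the lower end of the
  -- interval.
  have h6 : A ^ (-(2 / α)) ≤ a ^ (-(2 / α)) :=
    Real.rpow_le_rpow_of_nonpos ha hA (by rw [neg_nonpos]; positivity)
  calc _ ≤ _ := latticeError_le hα (ha.trans_le hA) hR0
    _ ≤ |C₁| * R ^ (2 * d) + 2 * a ^ (-(2 / α)) * (C₃ * g R) := by
      refine add_le_add (h4.trans (by gcongr; exact le_abs_self _)) ?_
      exact mul_le_mul (by gcongr) h5 (abs_nonneg _) (by positivity)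
    _ ≤ |C₁| * (C₂ * g R) + 2 * a ^ (-(2 / α)) * (C₃ * g R) := by
      gcongr; exact h₂ R hR
    _ = _ := by ring

theorem theorem3p1 (d : ℕ) (hd : 1 ≤ d) (α : ℝ) (hα : 2 ≤ α) (a b : ℝ) (ha : 0 < a) :
    ∃ C : ℝ, ∀ A : ℝ, a ≤ A → A ≤ b → ∀ R : ℝ, 2 ≤ R →
      (α = 2 → latticeError d α A R ≤ C * R ^ (2 * d)) ∧
      (2 < α → α ≤ 4 → latticeError d α A R ≤ C * (R ^ (2 * d) * Real.log R)) ∧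
      (4 < α → latticeError d α A R ≤ C * R ^ ((2 * d : ℝ) + errorExponent d α)) := by
  have hlog2 : ∀ R : ℝ, 2 ≤ R → 0 < Real.log R := fun R hR => Real.log_pos (by linarith)
  rcases hα.eq_or_lt with rfl | hα2
  · obtain ⟨C, h⟩ := exists_latticeError_le (d := d) two_pos ha (g := fun R => R ^ (2 * d))
      ⟨1, fun R hR => (one_mul _).ge⟩ (by
        obtain ⟨C, h⟩ := exists_abs_sum_tent_sub_integral_le (ι := Fin (2 * d))
        refine ⟨C, fun R hR => ?_⟩
        have h1 := h R (by linarith)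
        rw [Fintype.card_fin] at h1
        rwa [sum_profile_two_sub_integral, integral_tent (by linarith)])
    exact ⟨C, fun A hA _ R hR => ⟨fun _ => h A hA R hR, fun h1 => absurd h1 (lt_irrefl _),
      fun h1 => absurd h1 (by norm_num)⟩⟩
  have hplanar := exists_abs_sum_profile_sub_integral_planar_le hα2
  rcases le_or_gt α 4 with hα4 | hα4
  · obtain ⟨C, h⟩ := exists_latticeError_le (d := d) (α := α) (by linarith) ha
      (g := fun R => R ^ (2 * d) * Real.log R)
      ⟨1 / Real.log 2, fun R hR => by
        have h1 := Real.log_le_log (by norm_num) hR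
        have h2 := hlog2 2 le_rfl
        have h3 : 1 ≤ 1 / Real.log 2 * Real.log R := by
          rw [one_div, inv_mul_eq_div, le_div_iff₀ h2]; linarith
        have h4 : 0 ≤ R ^ (2 * d) := by positivity
        nlinarith⟩ (by
        rcases hd.eq_or_lt with rfl | hd
        · obtain ⟨C, h⟩ := hplanar
          exact ⟨C, fun R hR => (h R hR).1 hα4⟩
        · exact exists_abs_sum_profile_sub_integral_le (by omega) (by linarith))
    exact ⟨C, fun A hA _ R hR => ⟨fun h1 => absurd h1 hα2.ne', fun _ _ => h A hA R hR,
      fun h1 => absurd h1 (by linarith)⟩⟩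
  · have hδ := errorExponent_pos hd hα4
    obtain ⟨C, h⟩ := exists_latticeError_le (d := d) (α := α) (by linarith) ha
      (g := fun R => R ^ ((2 * d : ℝ) + errorExponent d α))
      ⟨1, fun R hR => by
        rw [one_mul, ← Real.rpow_natCast]
        exact Real.rpow_le_rpow_of_exponent_le (by linarith) (by push_cast; linarith)⟩ (by
        rcases hd.eq_or_lt with rfl | hd
        · obtain ⟨C, h⟩ := hplanar
          refine ⟨C, fun R hR => ?_⟩
          have := (h R hR).2 hα4
          simpa using this
        · obtain ⟨C, h⟩ := exists_abs_sum_profile_sub_integral_le (D := 2 * d) (α := α)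
            (by omega) (by linarith)
          -- For `2d ≥ 4` the bound `R^{2d} log R` is stronger than required; `log R ≤ R^δ / δ` with
          -- `δ > 0` brings it to the stated form.
          refine ⟨|C| / errorExponent d α, fun R hR => (h R hR).trans ?_⟩
          have h1 := Real.log_le_rpow_div (by linarith : 0 ≤ R) hδ
          have h2 := hlog2 R hR
          rw [Real.rpow_add (by linarith), show (2 * d : ℝ) = ((2 * d : ℕ) : ℝ) by push_cast; ring,
            Real.rpow_natCast]
          calc C * (R ^ (2 * d) * Real.log R)
              ≤ |C| * (R ^ (2 * d) * (R ^ errorExponent d α / errorExponent d α)) := by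
                gcongr; exact le_abs_self _
            _ = _ := by ring)
    exact ⟨C, fun A hA _ R hR => ⟨fun h1 => absurd h1 hα2.ne', fun _ h1 => absurd h1 (by linarith),
      fun _ => h A hA R hR⟩⟩
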